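/- **Setting.** Qubits are encoded in the concatenated $[\![7,1,3]\!]$ Steane code ($n=7$): a block$_0$ is a qubit, a block$_k$ consists of 7 subblocks$_{k-1}$. Each physical CNOT fails independently with probability at most $p$, a failure applying one of the 16 Pauli products with an arbitrary distribution that may depend on the gate; everything else (single-qubit Clifford gates, preparation, measurement, memory, classical control) is perfect. Errors are Pauli errors tracked through the circuit. The state$_0$ of a qubit is its tracked Pauli error, and the state$_k$ of a block$_k$ is obtained by error-free decoding of the states$_{k-1}$ of its subblocks. The relative states of the subblocks are given by the minimum-weight error ($Y$ counting twice) with the same syndrome as the states$_{k-1}$; a subblock is in relative error if its relative state is not $I$. Error correction has no logical effect if the state$_k$ of the output equals the state$_k$ of the input. **Wellness.** Every distribution of a block$_0$ is well$_0$. A (random) block$_k$ is well$_k(p_1,\dots,p_k)$ if, conditioned on its state$_k$ and on the errors in all other blocks, it has at most one subblock that is uncontrolled, i.e. in relative error or not well$_{k-1}(p_1,\dots,p_{k-1})$, and the probability that there is one is at most $p_k$. Here the uncontrolled subblock is a random mark; given the mark and the errors in all other (sub)blocks, each unmarked subblock is well$_{k-1}(p_1,\dots,p_{k-1})$ and not in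 relative error. Marks count as part of the errors of a block. **Circuits** ($k\ge1$). At level 0, ancilla preparation is perfect, correction is trivial, and CNOT$_0$ is the physical CNOT. - *Ancilla$_k$.* An unverified $|0\rangle_k$ is made by preparing seven ancillas$_{k-1}$ ($|+\rangle_{k-1}$ in positions 1, 2, 4 and $|0\rangle_{k-1}$ elsewhere), applying the nine CNOTs$_{k-1}$ $1\to3,5,7$; $2\to3,6,7$; $4\to5,6,7$ in this order, and then Correction$_{k-1}$ on each subblock. Make two copies, apply CNOT$_{k-1}$ transversely from the first to the second, measure the second in the $0/1$ basis, and postselect on no $X$ relative error of its subblocks and no $X$ component of its state$_k$. If the first copy's state$_k$ has a $Z$ component, multiply its tracked error by $Z$ on every qubit (which acts trivially on $|0\rangle_k$). $|+\rangle_k$ is $|0\rangle_k$ followed by transverse Hadamard gates. - *Correction$_k$.* Two rounds, each as follows. Apply Correction$_{k-1}$ to every subblock. Apply transverse CNOTs$_{k-1}$ from the block into a fresh verified $|+\rangle_k$, measure the latter in the $0/1$ basis, decode recursively to find the subblock in $X$ relative error, if any, and apply $X$ to every qubit of that subblock of the data. Symmetrically, apply transverse CNOTs$_{k-1}$ from a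 fresh verified $|0\rangle_k$ into the block, measure the former in the $\pm$ basis, and apply $Z$ to the indicated subblock. - *CNOT$_k$.* Transverse CNOTs$_{k-1}$, then Correction$_k$ on each of the two blocks. **Parameters.** $n=7$, $s=9$, $A_0=B_0=0$, $C_0=p$, and for $k\ge1$ $$N_k=1-2nA_{k-1}-2nB_{k-1}-(2s+n)C_{k-1},$$ $$A_k=\Big[\tbinom{2n}2(A_{k-1}^2+B_{k-1}^2)+\tbinom{2s+n}2C_{k-1}^2+2n(2s+n)(A_{k-1}+B_{k-1})C_{k-1}+4n^2A_{k-1}B_{k-1}\Big]/N_k,$$ $$a_k=\frac{2n(A_{k-1}+B_{k-1})+(2s+n)C_{k-1}}{(1-A_k)N_k},\qquad \varepsilon_k=4a_k+2nB_{k-1}+4nC_{k-1},$$ $$B_k'=4A_k+\varepsilon_k,\qquad b_k=\frac{\varepsilon_k}{1-B_k'},$$ $$B_k=4A_k+\tbinom{4n}2C_{k-1}^2+\tbinom42a_k^2+\tbinom{2n}2B_{k-1}^2+b_k(4nC_{k-1}+4a_k+2nB_{k-1})+4nC_{k-1}(4a_k+2nB_{k-1})+8na_kB_{k-1},$$ $$\tilde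 b_k=\frac{\varepsilon_k}{1-B_k},\qquad C_k=\big(2B_k+2nC_{k-1}B_k'+\tbinom n2C_{k-1}^2\big)+2b_k(2B_k'+nC_{k-1})+b_k^2 .$$ **Claim B$_k$ (Correction$_k$).** Let $k\ge1$, and let $p$ be in the parameter range of interest: for $1\le j\le k$, $N_j>0$, $A_j<1$, $B_j<1$, $B_j'<1$ and $\tilde b_j\le b_j$. Apply Correction$_k$ to a block$_k$ whose errors have an arbitrary joint distribution with the errors in other blocks. 1. With probability at least $1-B_k$ the output is well$_k(b_1,\dots,b_k)$ and, if the input is well$_k(b_1,\dots,b_k)$, there is no logical effect. 2. If all but at most one of the input subblocks$_{k-1}$ are well$_{k-1}(b_1,\dots,b_{k-1})$ and not in relative error, then with probability at least $1-B_k'$ there is no logical effect and the output is well$_k(b_1,\dots,b_k)$. "With probability at least $1-\delta$" means that there is a success event of probability at least $1-\delta$ such that, conditioned on success, the output distribution is well$_k$, and (where claimed) every successful run has no logical effect. -/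

import Mathlib

/-! Fault-tolerant error correction with the concatenated seven-qubit Steane code.

All circuits consist of stabilizer operations and all faults are Pauli operators, so the noisy
circuits are described by the Pauli errors that have been tracked onto the qubits. -/

noncomputable section

namespace SteaneFT

open scoped ENNReal

/-! ### Pauli errors, blocks and the Steane code -/

/-- A one-qubit Pauli error modulo phase: its X component and its Z component.
`I = (0,0)`, `X = (1,0)`, `Z = (0,1)`, `Y = (1,1)`; multiplication is addition. -/
abbrev Pauli : Type := ZMod 2 × ZMod 2

/-- The Pauli errors tracked onto the `7 ^ k` qubits of a block of level `k`. -/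
def Blk : ℕ → Type
  | 0 => Pauli
  | k + 1 => Fin 7 → Blk k

/-- The parity checks of the `[7,4,3]` Hamming code; the rows are the Z (and, dually, the X)
stabilizer generators `IIIZZZZ`, `IZZIIZZ`, `ZIZIZIZ`. -/
def hamming : Matrix (Fin 3) (Fin 7) (ZMod 2) :=
  !![0, 0, 0, 1, 1, 1, 1;
     0, 1, 1, 0, 0, 1, 1;
     1, 0, 1, 0, 1, 0, 1]

/-- The syndrome of the X components (or of the Z components) of seven Pauli errors. -/
def syndrome (x : Fin 7 → ZMod 2) : Fin 3 → ZMod 2 := hamming.mulVec x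

/-- The unique bit string of minimum weight that has the same syndrome as `x`: it is zero if the
syndrome vanishes, and has its only one where the column of `hamming` is the syndrome otherwise. -/
def relBits (x : Fin 7 → ZMod 2) : Fin 7 → ZMod 2 :=
  fun i => if syndrome x = fun r => hamming r i then 1 else 0

/-- Perfect decoding of one level: after the correction `relBits x`, the string is a codeword, and
it represents the logical flip (transverse flip, modulo the stabilizer) iff its parity is odd. -/
def decodeBits (x : Fin 7 → ZMod 2) : ZMod 2 := ∑ i, (x i + relBits x i)

/-- The relative states of seven subblocks with the given states: the error of minimum weight
(`Y` counting twice) that generates the same syndrome. -/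
def relState (s : Fin 7 → Pauli) (i : Fin 7) : Pauli :=
  (relBits (fun j => (s j).1) i, relBits (fun j => (s j).2) i)

/-- Error-free decoding of seven Pauli states. -/
def decode (s : Fin 7 → Pauli) : Pauli :=
  (decodeBits fun j => (s j).1, decodeBits fun j => (s j).2)

/-- The state of a block, by perfect bottom-up recursive decoding. -/
def state : (k : ℕ) → Blk k → Pauli
  | 0, b => b
  | k + 1, b => decode fun i => state k (b i)

/-- Apply the same Pauli operator to every qubit of a block (this is the logical operator). -/
def applyAll (P : Pauli) : (k : ℕ) → Blk k → Blk k
  | 0, b => (b.1 + P.1, b.2 + P.2)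
  | k + 1, b => fun i => applyAll P k (b i)

/-- Transverse (perfect) Hadamard gates: X and Z errors are exchanged. -/
def hadamardAll : (k : ℕ) → Blk k → Blk k
  | 0, b => (b.2, b.1)
  | k + 1, b => fun i => hadamardAll k (b i)

/-- The block without errors. -/
def noError : (k : ℕ) → Blk k
  | 0 => (0, 0)
  | k + 1 => fun _ => noError k

/-! ### The base error model -/

/-- For each location of a physical CNOT gate (addressed by a list of numbers), the distribution of
the Pauli product that is applied to the two qubits after a perfect CNOT gate. -/
abbrev Noise : Type := List ℕ → PMF (Pauli × Pauli)

/-- The part of the noise seen by the `i`-th component of a circuit; different components use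
different physical gates. -/
def Noise.sub (ν : Noise) (i : ℕ) : Noise := fun l => ν (i :: l)

/-- Every CNOT gate fails with probability `p`, independently (gates are sampled
independently below), and a failure results in any of the sixteen Pauli products, `I ⊗ I` included,
with an arbitrary distribution: that is, no error is applied with probability at least `1 - p`. -/
def BaseErrorModel (p : ℝ) (ν : Noise) : Prop := ∀ l, ENNReal.ofReal (1 - p) ≤ ν l (0, 0)

/-- The physical CNOT gate (control, target): X errors are copied forward, Z errors backward, and
then the gate error is applied. -/
def physCNOT (ν : Noise) (c t : Pauli) : PMF (Pauli × Pauli) :=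
  (ν []).map fun e => ((c.1, c.2 + t.2) + e.1, (t.1 + c.1, t.2) + e.2)

/-! ### The circuits -/

/-- Independent parallel composition. -/
def transverse {α : Type} : (n : ℕ) → (Fin n → PMF α) → PMF (Fin n → α)
  | 0, _ => pure Fin.elim0
  | n + 1, f => do
    let a ← f 0
    let v ← transverse n fun i => f i.succ
    pure (Fin.cons a v)

open Classical in
/-- Repeat a random experiment until the outcome lies in `S`: the conditional distribution given
`S`. (If `S` has probability zero, the experiment is not conditioned.) -/
def postselect {α : Type} (m : PMF α) (S : Set α) : PMF α :=
  if h : ∃ a ∈ S, a ∈ m.support then m.filter S h else m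

/-- The noisy implementations of the three operations at level `k`: preparation of `|0⟩`, error
correction, and CNOT (control, target). -/
structure Gadgets (k : ℕ) where
  zero : Noise → PMF (Blk k)
  correct : Noise → Blk k → PMF (Blk k)
  cnot : Noise → Blk k → Blk k → PMF (Blk k × Blk k)

/-- `|+⟩`: transverse perfect Hadamard gates applied to `|0⟩`. -/
def plusOf {k : ℕ} (zero : Noise → PMF (Blk k)) (ν : Noise) : PMF (Blk k) :=
  (zero ν).map (hadamardAll k)

/-- Level-`k` CNOTs between the listed pairs (control, target) of subblocks, one after another. -/
def runCNOTs {k : ℕ} (G : Gadgets k) :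
    List (Fin 7 × Fin 7) → Noise → (Fin 7 → Blk k) → PMF (Fin 7 → Blk k)
  | [], _, v => pure v
  | (c, t) :: l, ν, v => do
    let r ← G.cnot (ν.sub 0) (v c) (v t)
    runCNOTs G l (ν.sub 1) (Function.update (Function.update v c r.1) t r.2)

/-- The nine CNOTs of the encoding circuit for `|0⟩`. -/
def encodingCNOTs : List (Fin 7 × Fin 7) :=
  [(0, 2), (0, 4), (0, 6), (1, 2), (1, 5), (1, 6), (3, 4), (3, 5), (3, 6)]

/-- Transverse CNOTs between two blocks of level `k + 1`. -/
def transverseCNOT {k : ℕ} (G : Gadgets k) (ν : Noise) (c t : Blk (k + 1)) :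
    PMF (Blk (k + 1) × Blk (k + 1)) :=
  (transverse 7 fun i => G.cnot (ν.sub i) (c i) (t i)).map
    fun r => (fun i => (r i).1, fun i => (r i).2)

/-- Transverse error corrections of the subblocks. -/
def transverseCorrect {k : ℕ} (G : Gadgets k) (ν : Noise) (b : Blk (k + 1)) :
    PMF (Blk (k + 1)) :=
  transverse 7 fun i => G.correct (ν.sub i) (b i)

/-- Preparation of an unverified `|0⟩` of level `k + 1`: prepare seven `|+⟩` or `|0⟩` of level `k`,
apply the encoding CNOTs, and correct each subblock. -/
def unverifiedZero {k : ℕ} (G : Gadgets k) (ν : Noise) : PMF (Blk (k + 1)) := do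
  let v ← transverse 7 fun i =>
    if i = 0 ∨ i = 1 ∨ i = 3 then plusOf G.zero ((ν.sub 0).sub i) else G.zero ((ν.sub 0).sub i)
  let w ← runCNOTs G encodingCNOTs (ν.sub 1) v
  transverseCorrect G (ν.sub 2) w

/-- Transverse measurement of a block in the 0/1 basis and recursive decoding down to its subblocks:
the X components of the relative states of the subblocks. (In the absence of errors the outcome is a
random codeword; the syndrome depends on the tracked errors only.) -/
def measuredX {k : ℕ} (b : Blk (k + 1)) (i : Fin 7) : ZMod 2 :=
  (relState (fun j => state k (b j)) i).1

/-- The same for the conjugate basis (of `|+⟩`): the Z components of the relative states. -/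
def measuredZ {k : ℕ} (b : Blk (k + 1)) (i : Fin 7) : ZMod 2 :=
  (relState (fun j => state k (b j)) i).2

/-- Verified preparation of `|0⟩` at level `k + 1`: transverse CNOTs from one unverified copy
to a second one, which is measured in the 0/1 basis; postselect on no X relative error and no X
component of its state. Since transverse Z stabilizes `|0⟩`, a Z component of the state of the
prepared block is then removed from the tracked error by applying Z to every qubit. -/
def verifiedZero {k : ℕ} (G : Gadgets k) (ν : Noise) : PMF (Blk (k + 1)) :=
  (postselect
    (do
      let c₁ ← unverifiedZero G (ν.sub 0)
      let c₂ ← unverifiedZero G (ν.sub 1)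
      transverseCNOT G (ν.sub 2) c₁ c₂)
    {r | (∀ i, measuredX r.2 i = 0) ∧ (state (k + 1) r.2).1 = 0}).map
  fun r => applyAll (0, (state (k + 1) r.1).2) (k + 1) r.1

/-- One round of error correction at level `k + 1`: correct each subblock; extract the Z syndrome
by transverse CNOTs into a `|+⟩` ancilla, measured in the 0/1 basis, and apply X to every qubit of
the indicated subblock; then symmetrically extract the X syndrome by transverse CNOTs from a
`|0⟩` ancilla, measured in the conjugate basis, and apply Z to every qubit of the indicated subblock. -/
def correctionRound {k : ℕ} (G : Gadgets k) (zero : Noise → PMF (Blk (k + 1))) (ν : Noise)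
    (b : Blk (k + 1)) : PMF (Blk (k + 1)) := do
  let d ← transverseCorrect G (ν.sub 0) b
  let plus ← plusOf zero (ν.sub 1)
  let r ← transverseCNOT G (ν.sub 2) d plus
  let d' : Blk (k + 1) := fun i => applyAll (measuredX r.2 i, 0) k (r.1 i)
  let z ← zero (ν.sub 3)
  let r' ← transverseCNOT G (ν.sub 4) z d'
  pure (fun i => applyAll (0, measuredZ r'.1 i) k (r'.2 i))

/-- Error correction: two rounds. -/
def correction {k : ℕ} (G : Gadgets k) (zero : Noise → PMF (Blk (k + 1))) (ν : Noise)
    (b : Blk (k + 1)) : PMF (Blk (k + 1)) := do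
  let d ← correctionRound G zero (ν.sub 0) b
  correctionRound G zero (ν.sub 1) d

/-- The operations at level `k`. At level zero preparation is perfect, there is no error
correction, and the CNOT is the physical gate; an encoded CNOT is transverse CNOTs followed by
error correction of each block. -/
def gadgets : (k : ℕ) → Gadgets k
  | 0 =>
    { zero := fun _ => pure (noError 0)
      correct := fun _ b => pure b
      cnot := physCNOT }
  | k + 1 =>
    let G := gadgets k
    let zero := verifiedZero G
    let correct := correction G zero
    { zero := zero
      correct := correct
      cnot := fun ν c t => do
        let r ← transverseCNOT G (ν.sub 0) c t
        let c' ← correct (ν.sub 1) r.1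
        let t' ← correct (ν.sub 2) r.2
        pure (c', t') }

/-! ### Wellness -/

/-- A block of level `k` together with marks: in each block, at most one subblock is marked as
uncontrolled. (Being well is a property of a distribution and not of a sample, so the event that a
subblock is uncontrolled has to be carried along as a random variable. The marks are part of the
errors of a block, in particular when other blocks are conditioned on them.) -/
def MBlk : ℕ → Type
  | 0 => Pauli
  | k + 1 => Option (Fin 7) × (Fin 7 → MBlk k)

/-- Forget the marks. -/
def MBlk.errors : {k : ℕ} → MBlk k → Blk k
  | 0, B => B
  | _ + 1, B => fun i => MBlk.errors (B.2 i)

/-- Let `m` be the (not necessarily normalized) distribution of a marked block, conditioned on the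
errors in all other blocks, and let `W` be a property of distributions of subblocks.
All subblocks but the marked one are not in relative error and, conditioned on the mark and on
the errors in all other subblocks, their distribution has the property `W`. -/
def Controlled {k : ℕ} (W : (MBlk k → ℝ≥0∞) → Prop) (m : MBlk (k + 1) → ℝ≥0∞) : Prop :=
  (∀ B : MBlk (k + 1), m B ≠ 0 → ∀ i, B.1 ≠ some i →
    relState (fun j => state k (B.2 j).errors) i = 0) ∧
  (∀ B : MBlk (k + 1), ∀ i, B.1 ≠ some i →
    W fun c => m (B.1, Function.update B.2 i c))

open Classical in
/-- `Well b k m`: the distribution `m` (not necessarily normalized, conditioned on the errors in all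
other blocks) of a marked block is well with parameters `b 1, …, b k`: at most one
subblock is in relative error or not well, and conditioned on the state of the block, the probability
of such an uncontrolled subblock is at most `b k`. There is no condition at level zero. -/
def Well (b : ℕ → ℝ) : (k : ℕ) → (MBlk k → ℝ≥0∞) → Prop
  | 0, _ => True
  | k + 1, m =>
    Controlled (Well b k) m ∧
    ∀ s : Pauli,
      (∑' B : MBlk (k + 1), if state (k + 1) B.errors = s ∧ B.1 ≠ none then m B else 0) ≤
        ENNReal.ofReal (b (k + 1)) *
          ∑' B : MBlk (k + 1), if state (k + 1) B.errors = s then m B else 0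

/-- A block, jointly distributed with the errors in all other blocks (with values in `Env`), is
well: for some marking, its distribution conditioned on the other blocks is well. -/
def IsWell {Env : Type*} (b : ℕ → ℝ) (k : ℕ) (μ : PMF (Env × Blk k)) : Prop :=
  ∃ M : PMF (Env × MBlk k), M.map (fun x => (x.1, x.2.errors)) = μ ∧
    ∀ e, Well b k fun B => M (e, B)

/-- All subblocks but at most one are well and not in relative error. -/
def IsWellButOne {Env : Type*} (b : ℕ → ℝ) (k : ℕ) (μ : PMF (Env × Blk (k + 1))) : Prop :=
  ∃ M : PMF (Env × MBlk (k + 1)), M.map (fun x => (x.1, x.2.errors)) = μ ∧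
    ∀ e, Controlled (Well b k) fun B => M (e, B)

/-! ### Success of an error correction -/

/-- The Pauli operator by which an operation with trivial ideal effect has acted on the decoded
block, if it has changed the tracked error from `x` to `y`. -/
def logicalEffect (k : ℕ) (x y : Blk k) : Pauli := state k y - state k x

/-- The joint distribution of the errors in the other blocks, the input errors and the output
errors when error correction is applied to a block. -/
def correctionRun {Env : Type*} (k : ℕ) (ν : Noise) (μ : PMF (Env × Blk k)) :
    PMF (Env × Blk k × Blk k) :=
  μ.bind fun x => ((gadgets k).correct ν x.2).map fun y => (x.1, x.2, y)

/-- With probability at least `1 - δ` the output is well with parameters `b 1, …, b k`, and, if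
`noEffect` holds, there is no logical effect. More precisely: the run can be extended by
marks for the output block and a success flag, such that failure has probability at most `δ`, the
output conditioned on success is well (conditioned on the errors in the other blocks), and a
success is without logical effect if `noEffect` holds. -/
def Succeeds {Env : Type*} (b : ℕ → ℝ) (δ : ℝ) (noEffect : Prop) (k : ℕ)
    (run : PMF (Env × Blk k × Blk k)) : Prop :=
  ∃ R : PMF (Env × Blk k × MBlk k × Bool),
    R.map (fun x => (x.1, x.2.1, x.2.2.1.errors)) = run ∧
    R.toOuterMeasure {x | x.2.2.2 = false} ≤ ENNReal.ofReal δ ∧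
    (∀ e, Well b k fun B => ∑' x : Blk k, R (e, x, B, true)) ∧
    (noEffect → ∀ e x B, R (e, x, B, true) ≠ 0 → logicalEffect k x B.errors = 0)

/-! ### The failure and wellness parameters -/

/-- The parameters of one level: failure probabilities `A` (ancilla preparation), `B`, `B'` (error
correction) and `C` (CNOT), wellness parameters `a` (ancilla), `bt` and `b` (error correction), and
the bound `N` on the acceptance probability in ancilla preparation. -/
structure Params where
  N : ℝ
  A : ℝ
  a : ℝ
  B' : ℝ
  b : ℝ
  B : ℝ
  bt : ℝ
  C : ℝ

/-- The recursion, for codes of length `n` whose `|0⟩` is encoded by `s` CNOTs. Here `ε` is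
`(1 - B) * bt`. -/
def Params.next (n s : ℕ) (P : Params) : Params :=
  let N := 1 - 2 * n * P.A - 2 * n * P.B - (2 * s + n) * P.C
  let A := (((2 * n).choose 2 : ℝ) * (P.A ^ 2 + P.B ^ 2) + ((2 * s + n).choose 2 : ℝ) * P.C ^ 2
    + 2 * n * (2 * s + n) * (P.A + P.B) * P.C + 4 * n ^ 2 * P.A * P.B) / N
  let a := (2 * n * (P.A + P.B) + (2 * s + n) * P.C) / ((1 - A) * N)
  let ε := 4 * a + 2 * n * P.B + 4 * n * P.C
  let B' := 4 * A + ε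
  let b := ε / (1 - B')
  let B := 4 * A + ((4 * n).choose 2 : ℝ) * P.C ^ 2 + (Nat.choose 4 2 : ℝ) * a ^ 2
    + ((2 * n).choose 2 : ℝ) * P.B ^ 2 + b * (4 * n * P.C + 4 * a + 2 * n * P.B)
    + 4 * n * P.C * (4 * a + 2 * n * P.B) + 8 * n * a * P.B
  let bt := ε / (1 - B)
  let C := (2 * B + 2 * n * P.C * B' + (n.choose 2 : ℝ) * P.C ^ 2)
    + 2 * b * (2 * B' + n * P.C) + b ^ 2
  { N := N, A := A, a := a, B' := B', b := b, B := B, bt := bt, C := C }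

/-- The parameters at level `k`, for the Steane code (`n = 7`, `s = 9`) and CNOT failure probability
`p`: initially `A = B = 0` and `C = p` (the other entries of level zero are not used). -/
def params (p : ℝ) : ℕ → Params
  | 0 => { N := 1, A := 0, a := 0, B' := 0, b := 0, B := 0, bt := 0, C := p }
  | k + 1 => (params p k).next 7 9

/-- The parameter range of interest: up to level `k` the recursion does not break down (no
denominator is zero or negative) and `bt ≤ b`. -/
def InRange (p : ℝ) (k : ℕ) : Prop :=
  ∀ j, 1 ≤ j → j ≤ k →
    0 < (params p j).N ∧ (params p j).A < 1 ∧ (params p j).B < 1 ∧ (params p j).B' < 1 ∧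
      (params p j).bt ≤ (params p j).b

end SteaneFT

end

namespace SteaneFT
open scoped ENNReal

/-! ### Integration against discrete measures -/

section Integration

variable {X Y Z : Type}

/-! Wellness belongs to a distribution conditioned on everything outside the block, not to a single
error pattern. The proof therefore works with unnormalised discrete measures and with classes of
measures closed under mixtures (`IsCone`). `Well` is such a class. It is also stable under
reweighting by a function of the state of the block and under transverse Pauli operators chosen from
that state (`Well.restrict`, `Well.pushforward`). Syndrome extraction, postselection and correction
use a subblock only through its state, so they do not destroy its wellness.

Every noisy operation is extended to a kernel on marked blocks that also emits a success flag
(`StepSim`), and forgetting marks and flag gives the operation back exactly. `Step` demands, for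
every finite input measure in a class, that the failed mass is at most `q` times the input mass and
that the successful part lies in the output class. The classes for several blocks are conditional on
all the other blocks (`Both`, `Joint`). Hence failures at two different positions cost `q²` even if
the blocks are correlated.

One level higher, a single failed subblock is harmless if it is remembered. `FT` describes kernels
whose status records the first fault and which fail on a second one. Under composition (`FT.comp`)
first-order bounds add, and pairs of faults contribute products; this is the origin of the quadratic
expressions in the recursion. Two properties of the Hamming code make the status meaningful. Errors
confined to one common position add linearly, and the content of that position does not influence
decoding (`Near.add`, `Near.congr`). The code is also perfect, so every syndrome is explained by one
position (`exists_near`).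

For an ancilla, a fault in the encoder may spread anywhere, but the subsequent corrections make the
subblocks well again, and verification excludes X errors. The remaining Z errors amount to one
relative error, which is marked, and a logical Z, which is trivial on the prepared state
(`verifiedConf_spec`).

A round of correction without faults turns any input into an unmarked controlled block
(`RoundParts.strict`). A round with one fault on an unmarked input leaves one mark. Of two rounds on
an arbitrary input, the first either is faultless, and then the second may have one fault, or it is
faulty, and then the second has to be faultless; both events being bad is second order. For a well
input, failure needs two faults among the incoming mark and the two rounds, apart from failing
ancillas. The wellness of the output is a conditional probability bound. It follows from
conservation of mass together with the preservation of the state (`RoundSpec.marked_le`,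
`RoundSpec.well`).

`GadgetSpec.next` carries the guarantees for preparation, correction and CNOT from one level to the
next, and induction on the level yields the claim. -/

open Classical in
/-- The indicator of a proposition. -/
noncomputable def ind (p : Prop) : ℝ≥0∞ := if p then 1 else 0

theorem ind_of {p : Prop} (h : p) : ind p = 1 := if_pos h

theorem ind_of_not {p : Prop} (h : ¬p) : ind p = 0 := if_neg h

theorem ind_le_one (p : Prop) : ind p ≤ 1 := by
  by_cases h : p <;> simp [ind, h]

theorem ind_mono {p q : Prop} (h : p → q) : ind p ≤ ind q := by
  by_cases hp : p
  · rw [ind_of hp, ind_of (h hp)]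
  · simp [ind_of_not hp]

theorem ind_congr {p q : Prop} (h : p ↔ q) : ind p = ind q := by rw [propext h]

theorem ind_and (p q : Prop) : ind (p ∧ q) = ind p * ind q := by
  by_cases hp : p <;> by_cases hq : q <;> simp [ind, hp, hq]

theorem ind_ne_zero {p : Prop} : ind p ≠ 0 ↔ p := by
  by_cases hp : p <;> simp [ind, hp]

theorem ind_add_not (p : Prop) : ind p + ind (¬p) = 1 := by
  by_cases hp : p <;> simp [ind, hp]

/-- The integral of `h` against the discrete measure `m`. -/
noncomputable def integral (m h : X → ℝ≥0∞) : ℝ≥0∞ := ∑' x, m x * h x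

/-- The total mass of a discrete measure. -/
noncomputable def mass (m : X → ℝ≥0∞) : ℝ≥0∞ := ∑' x, m x

theorem integral_one (m : X → ℝ≥0∞) : integral m (fun _ => 1) = mass m := by
  simp [integral, mass]

theorem integral_mono {m h h' : X → ℝ≥0∞} (H : ∀ x, m x ≠ 0 → h x ≤ h' x) :
    integral m h ≤ integral m h' := by
  refine ENNReal.tsum_le_tsum fun x => ?_
  by_cases hx : m x = 0
  · simp [hx]
  · gcongr; exact H x hx

theorem integral_congr {m h h' : X → ℝ≥0∞} (H : ∀ x, m x ≠ 0 → h x = h' x) :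
    integral m h = integral m h' :=
  le_antisymm (integral_mono fun x hx => (H x hx).le) (integral_mono fun x hx => (H x hx).ge)

theorem integral_add (m h h' : X → ℝ≥0∞) :
    integral m (fun x => h x + h' x) = integral m h + integral m h' := by
  simp [integral, mul_add, ENNReal.tsum_add]

theorem integral_const_mul (m h : X → ℝ≥0∞) (c : ℝ≥0∞) :
    integral m (fun x => c * h x) = c * integral m h := by
  simp only [integral, ← ENNReal.tsum_mul_left]
  exact tsum_congr fun x => by ring

theorem integral_finset_sum {ι : Type} (s : Finset ι) (m : X → ℝ≥0∞) (h : ι → X → ℝ≥0∞) :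
    integral m (fun x => ∑ i ∈ s, h i x) = ∑ i ∈ s, integral m (h i) := by
  classical
  induction s using Finset.induction_on with
  | empty => simp [integral]
  | insert a s ha ih => simp [Finset.sum_insert ha, integral_add, ih]

theorem integral_le_mass {m h : X → ℝ≥0∞} (H : ∀ x, m x ≠ 0 → h x ≤ 1) : integral m h ≤ mass m := by
  rw [← integral_one]; exact integral_mono H

theorem integral_pmf_le_one (p : PMF X) {h : X → ℝ≥0∞} (H : ∀ x, h x ≤ 1) :
    integral p h ≤ 1 := by
  refine (integral_le_mass fun x _ => H x).trans ?_
  simp [mass]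

theorem mass_pmf (p : PMF X) : mass p = 1 := p.tsum_coe

theorem integral_ne_zero {m h : X → ℝ≥0∞} : integral m h ≠ 0 ↔ ∃ x, m x ≠ 0 ∧ h x ≠ 0 := by
  simp [integral, ENNReal.tsum_eq_zero]

theorem integral_prod (m h : X × Y → ℝ≥0∞) :
    integral m h = ∑' x, integral (fun y => m (x, y)) fun y => h (x, y) :=
  ENNReal.tsum_prod'

theorem mass_prod (m : X × Y → ℝ≥0∞) : mass m = ∑' x, mass fun y => m (x, y) :=
  ENNReal.tsum_prod'

theorem mass_equiv (e : X ≃ Y) (m : Y → ℝ≥0∞) : mass (fun x => m (e x)) = mass m := e.tsum_eq m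

theorem integral_equiv (e : X ≃ Y) (m h : Y → ℝ≥0∞) :
    integral (fun x => m (e x)) (fun x => h (e x)) = integral m h :=
  e.tsum_eq fun y => m y * h y

theorem mass_comp_le {f : X → Y} (hf : Function.Injective f) (m : Y → ℝ≥0∞) :
    mass (fun x => m (f x)) ≤ mass m :=
  ENNReal.tsum_comp_le_tsum_of_injective hf m

theorem mass_comp_ne_top {f : X → Y} (hf : Function.Injective f) {m : Y → ℝ≥0∞} (h : mass m ≠ ⊤) :
    mass (fun x => m (f x)) ≠ ⊤ :=
  ne_top_of_le_ne_top h (mass_comp_le hf m)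

theorem integral_pure (a : X) (h : X → ℝ≥0∞) : integral (PMF.pure a) h = h a := by
  rw [integral, tsum_eq_single a]
  · simp
  · intro b hb; simp [hb]

theorem integral_bind (p : PMF X) (f : X → PMF Y) (h : Y → ℝ≥0∞) :
    integral (p.bind f) h = integral p fun x => integral (f x) h := by
  simp only [integral, PMF.bind_apply, ← ENNReal.tsum_mul_left, ← ENNReal.tsum_mul_right]
  rw [ENNReal.tsum_comm]
  exact tsum_congr fun x => tsum_congr fun y => by ring

theorem integral_map (p : PMF X) (f : X → Y) (h : Y → ℝ≥0∞) :
    integral (p.map f) h = integral p fun x => h (f x) := by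
  simp only [PMF.map, integral_bind]
  exact integral_congr fun x _ => integral_pure _ _

theorem apply_eq_integral (m : X → ℝ≥0∞) (x : X) : m x = integral m fun y => ind (x = y) := by
  rw [integral, tsum_eq_single x]
  · simp [ind]
  · intro y hy; simp [ind, hy.symm]

theorem map_apply_eq_integral (p : PMF X) (f : X → Y) (y : Y) :
    p.map f y = integral p fun x => ind (y = f x) := by
  rw [apply_eq_integral (p.map f), integral_map]

/-- The image of a measure under a Markov kernel. -/
noncomputable def push (m : X → ℝ≥0∞) (K : X → PMF Y) (y : Y) : ℝ≥0∞ := integral m fun x => K x y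

theorem integral_push (m : X → ℝ≥0∞) (K : X → PMF Y) (h : Y → ℝ≥0∞) :
    integral (push m K) h = integral m fun x => integral (K x) h := by
  simp only [integral, push, ← ENNReal.tsum_mul_left, ← ENNReal.tsum_mul_right]
  rw [ENNReal.tsum_comm]
  exact tsum_congr fun x => tsum_congr fun y => by ring

theorem push_map (m : X → ℝ≥0∞) (K : X → PMF Y) (f : Y → Z) (z : Z) :
    push m (fun x => (K x).map f) z = integral (push m K) fun y => ind (z = f y) := by
  rw [integral_push]
  exact integral_congr fun x _ => map_apply_eq_integral _ _ _

/-- The part of the output of a flagged kernel that is flagged as successful. -/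
noncomputable def okPart (m : X → ℝ≥0∞) (K : X → PMF (Y × Bool)) (y : Y) : ℝ≥0∞ :=
  push m K (y, true)

/-- The probability of failure of a flagged distribution. -/
noncomputable def failProb (p : PMF (Y × Bool)) : ℝ≥0∞ := integral p fun r => ind (r.2 = false)

/-- The mass of the output of a flagged kernel that is flagged as failed. -/
noncomputable def failMass (m : X → ℝ≥0∞) (K : X → PMF (Y × Bool)) : ℝ≥0∞ :=
  integral m fun x => failProb (K x)

theorem failProb_le_one (p : PMF (Y × Bool)) : failProb p ≤ 1 :=
  integral_pmf_le_one p fun _ => ind_le_one _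

theorem failMass_le_mass (m : X → ℝ≥0∞) (K : X → PMF (Y × Bool)) : failMass m K ≤ mass m :=
  integral_le_mass fun _ _ => failProb_le_one _

theorem tsum_flag (f : Y × Bool → ℝ≥0∞) : ∑' r, f r = ∑' y, f (y, true) + ∑' y, f (y, false) := by
  rw [ENNReal.tsum_prod', ← ENNReal.tsum_add]
  exact tsum_congr fun y => by rw [tsum_bool, add_comm]

theorem integral_okPart (m : X → ℝ≥0∞) (K : X → PMF (Y × Bool)) (h : Y → ℝ≥0∞) :
    integral (okPart m K) h =
      integral m fun x => integral (K x) fun r => ind (r.2 = true) * h r.1 := by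
  rw [← integral_push]
  conv_rhs => rw [integral, tsum_flag]
  simp [ind, integral, okPart]

theorem mass_okPart (m : X → ℝ≥0∞) (K : X → PMF (Y × Bool)) :
    mass (okPart m K) = integral m fun x => integral (K x) fun r => ind (r.2 = true) := by
  rw [← integral_one, integral_okPart]; simp

/-- Conservation of mass. It later converts bounds relative to the input mass into bounds
conditional on success. -/
theorem mass_okPart_add_failMass (m : X → ℝ≥0∞) (K : X → PMF (Y × Bool)) :
    mass (okPart m K) + failMass m K = mass m := by
  rw [mass_okPart, failMass, ← integral_add, ← integral_one]
  refine integral_congr fun x _ => ?_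
  rw [failProb, ← integral_add, ← mass_pmf (K x), ← integral_one]
  refine integral_congr fun r _ => ?_
  cases r.2 <;> simp [ind]

theorem mass_okPart_le (m : X → ℝ≥0∞) (K : X → PMF (Y × Bool)) : mass (okPart m K) ≤ mass m := by
  rw [← mass_okPart_add_failMass m K]; exact le_self_add

theorem mass_okPart_ne_top {m : X → ℝ≥0∞} (hm : mass m ≠ ⊤) (K : X → PMF (Y × Bool)) :
    mass (okPart m K) ≠ ⊤ :=
  ne_top_of_le_ne_top hm (mass_okPart_le m K)

theorem okPart_ne_zero {m : X → ℝ≥0∞} {K : X → PMF (Y × Bool)} {y : Y} :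
    okPart m K y ≠ 0 ↔ ∃ x, m x ≠ 0 ∧ K x (y, true) ≠ 0 :=
  integral_ne_zero

theorem okPart_map (m : X → ℝ≥0∞) (K : X → PMF Y) (f : Y → Z × Bool) (z : Z) :
    okPart m (fun x => (K x).map f) z = integral (push m K) fun y => ind ((z, true) = f y) :=
  push_map m K f (z, true)

theorem failProb_map (p : PMF Y) (f : Y → Z × Bool) :
    failProb (p.map f) = integral p fun y => ind ((f y).2 = false) :=
  integral_map _ _ _

end Integration

/-! ### Independent products -/

section Transverse

variable {X Y Z : Type}

/-- Fubini for product functions. Point masses, images and marginals of `transverse` all follow by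
taking indicators or the constant `1` in the individual coordinates. -/
theorem integral_transverse_prod : ∀ (n : ℕ) (f : Fin n → PMF X) (h : Fin n → X → ℝ≥0∞),
    integral (transverse n f) (fun z => ∏ i, h i (z i)) = ∏ i, integral (f i) (h i)
  | 0, f, h => by
    simp only [Finset.univ_eq_empty, Finset.prod_empty, integral_one]
    exact mass_pmf _
  | n + 1, f, h => by
    have hT : transverse (n + 1) f = (f 0).bind fun a =>
      (transverse n fun i => f i.succ).bind fun v => PMF.pure (Fin.cons a v) := rfl
    rw [hT, integral_bind]
    simp only [integral_bind, integral_pure, Fin.prod_univ_succ, Fin.cons_zero, Fin.cons_succ]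
    simp only [integral_const_mul]
    rw [integral_transverse_prod n (fun i => f i.succ) fun i => h i.succ, mul_comm,
      ← integral_const_mul]
    exact integral_congr fun x _ => mul_comm _ _

theorem transverse_apply (n : ℕ) (f : Fin n → PMF X) (z : Fin n → X) :
    transverse n f z = ∏ i, f i (z i) := by
  rw [apply_eq_integral (transverse n f)]
  have : ∀ i, f i (z i) = integral (f i) fun x => ind (z i = x) := fun i => apply_eq_integral _ _
  simp only [this]
  rw [← integral_transverse_prod]
  refine integral_congr fun w _ => ?_
  by_cases h : z = w
  · subst h; simp [ind]
  · obtain ⟨i, hi⟩ := Function.ne_iff.1 h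
    rw [ind_of_not h, Finset.prod_eq_zero (Finset.mem_univ i) (ind_of_not hi)]

theorem transverse_map (n : ℕ) (f : Fin n → PMF X) (g : Fin n → X → Y) :
    (transverse n f).map (fun z i => g i (z i)) = transverse n fun i => (f i).map (g i) := by
  ext w
  rw [map_apply_eq_integral, transverse_apply]
  simp only [map_apply_eq_integral]
  rw [← integral_transverse_prod]
  refine integral_congr fun z _ => ?_
  by_cases h : w = fun i => g i (z i)
  · subst h; simp [ind]
  · obtain ⟨i, hi⟩ := Function.ne_iff.1 h
    rw [ind_of_not h, Finset.prod_eq_zero (Finset.mem_univ i) (ind_of_not hi)]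

theorem integral_transverse_coord {n : ℕ} (f : Fin n → PMF X) (i : Fin n) (h : X → ℝ≥0∞) :
    integral (transverse n f) (fun z => h (z i)) = integral (f i) h := by
  have := integral_transverse_prod n f fun j => if j = i then h else fun _ => 1
  rw [Finset.prod_eq_single i] at this
  · rw [if_pos rfl] at this
    rw [← this]
    refine integral_congr fun z _ => ?_
    rw [Finset.prod_eq_single i]
    · simp
    · intro j _ hj; simp [hj]
    · simp
  · intro j _ hj; simp [hj, integral_one, mass_pmf]
  · simp

/-- Independence of two different gates: this is where products of two failure probabilities enter.
-/
theorem integral_transverse_coord_pair {n : ℕ} (f : Fin n → PMF X) {i j : Fin n} (hij : i ≠ j)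
    (h h' : X → ℝ≥0∞) :
    integral (transverse n f) (fun z => h (z i) * h' (z j)) =
      integral (f i) h * integral (f j) h' := by
  have := integral_transverse_prod n f
    fun l => if l = i then h else if l = j then h' else fun _ => 1
  have key : ∀ g : Fin n → ℝ≥0∞, (∀ l, l ≠ i → l ≠ j → g l = 1) → ∏ l, g l = g i * g j := by
    intro g hg
    rw [← Finset.prod_subset (Finset.subset_univ {i, j})]
    · rw [Finset.prod_pair hij]
    · intro l _ hl
      simp only [Finset.mem_insert, Finset.mem_singleton, not_or] at hl
      exact hg l hl.1 hl.2
  rw [key] at this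
  · rw [if_pos rfl, if_neg hij.symm, if_pos rfl] at this
    rw [← this]
    refine integral_congr fun z _ => ?_
    rw [key]
    · simp [hij.symm]
    · intro l h1 h2; simp [h1, h2]
  · intro l h1 h2; simp [h1, h2, integral_one, mass_pmf]

end Transverse
end SteaneFT

namespace SteaneFT
open scoped ENNReal

/-! ### Flagged kernels with guarantees -/

section Steps

variable {X Y Z X' Y' : Type}

/-- A property of measures that is preserved under mixtures. -/
def IsCone (W : (X → ℝ≥0∞) → Prop) : Prop :=
  ∀ ⦃ι : Type⦄ (c : ι → ℝ≥0∞) (m : ι → X → ℝ≥0∞), (∀ i, c i ≠ 0 → W (m i)) →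
    W fun x => integral c fun i => m i x

theorem IsCone.smul {W : (X → ℝ≥0∞) → Prop} (hW : IsCone W) {m : X → ℝ≥0∞} (hm : W m) (c : ℝ≥0∞) :
    W fun x => c * m x := by
  have := hW (fun _ : Unit => c) (fun _ => m) fun _ _ => hm
  simpa [integral] using this

theorem IsCone.add {W : (X → ℝ≥0∞) → Prop} (hW : IsCone W) {m m' : X → ℝ≥0∞} (hm : W m)
    (hm' : W m') : W fun x => m x + m' x := by
  have := hW (fun _ : Bool => 1) (fun b => if b then m else m') fun b _ => by cases b <;> simpa
  simpa [integral, tsum_bool, add_comm] using this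

/-- A flagged kernel that maps measures in the class `W` to measures in `W'` if it succeeds, then
acts as described by `rel`, and fails with probability at most `q`. -/
structure Step (W : (X → ℝ≥0∞) → Prop) (W' : (Y → ℝ≥0∞) → Prop) (rel : X → Y → Prop) (q : ℝ≥0∞)
    (K : X → PMF (Y × Bool)) : Prop where
  ok : ∀ m, W m → mass m ≠ ⊤ → W' (okPart m K)
  fail : ∀ m, W m → mass m ≠ ⊤ → failMass m K ≤ q * mass m
  supp : ∀ m, W m → mass m ≠ ⊤ → ∀ x y, m x ≠ 0 → K x (y, true) ≠ 0 → rel x y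

theorem Step.mono {W V : (X → ℝ≥0∞) → Prop} {W' V' : (Y → ℝ≥0∞) → Prop} {rel rel' : X → Y → Prop}
    {q q' : ℝ≥0∞} {K : X → PMF (Y × Bool)} (h : Step W W' rel q K) (hV : ∀ m, V m → W m)
    (hW : ∀ m, W' m → V' m) (hrel : ∀ x y, rel x y → rel' x y) (hq : q ≤ q') :
    Step V V' rel' q' K where
  ok m hm hf := hW _ (h.ok m (hV m hm) hf)
  fail m hm hf := (h.fail m (hV m hm) hf).trans (by gcongr)
  supp m hm hf x y hx hy := hrel _ _ (h.supp m (hV m hm) hf x y hx hy)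

/-- Sequential composition of flagged kernels; after a failure `K'` is used instead of `K₂`. -/
noncomputable def seqK (K₁ : X → PMF (Y × Bool)) (K₂ : Y → PMF (Z × Bool)) (K' : Y → PMF Z) (x : X) :
    PMF (Z × Bool) :=
  (K₁ x).bind fun r => if r.2 then K₂ r.1 else (K' r.1).map fun z => (z, false)

theorem seqK_true (K₁ : X → PMF (Y × Bool)) (K₂ : Y → PMF (Z × Bool)) (K' : Y → PMF Z) (x : X)
    (z : Z) : seqK K₁ K₂ K' x (z, true) = ∑' y, K₁ x (y, true) * K₂ y (z, true) := by
  rw [seqK, PMF.bind_apply, tsum_flag]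
  simp [PMF.map_apply]

theorem seqK_true_ne_zero {K₁ : X → PMF (Y × Bool)} {K₂ : Y → PMF (Z × Bool)} {K' : Y → PMF Z}
    {x : X} {z : Z} (h : seqK K₁ K₂ K' x (z, true) ≠ 0) :
    ∃ y, K₁ x (y, true) ≠ 0 ∧ K₂ y (z, true) ≠ 0 := by
  rw [seqK_true] at h
  simpa [ENNReal.tsum_eq_zero] using h

/-- A composite run succeeds only if both stages do, so the kernel used after a failure does not
contribute. -/
theorem okPart_seqK (m : X → ℝ≥0∞) (K₁ : X → PMF (Y × Bool)) (K₂ : Y → PMF (Z × Bool))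
    (K' : Y → PMF Z) : okPart m (seqK K₁ K₂ K') = okPart (okPart m K₁) K₂ := by
  ext z
  simp only [okPart, push, integral, seqK_true, ← ENNReal.tsum_mul_left, ← ENNReal.tsum_mul_right]
  rw [ENNReal.tsum_comm]
  exact tsum_congr fun x => tsum_congr fun y => by ring

theorem failMass_seqK (m : X → ℝ≥0∞) (K₁ : X → PMF (Y × Bool)) (K₂ : Y → PMF (Z × Bool))
    (K' : Y → PMF Z) :
    failMass m (seqK K₁ K₂ K') = failMass m K₁ + failMass (okPart m K₁) K₂ := by
  rw [failMass, failMass, failMass, integral_okPart, ← integral_add]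
  refine integral_congr fun x _ => ?_
  rw [seqK, failProb, integral_bind, failProb, ← integral_add]
  refine integral_congr fun r _ => ?_
  cases hr : r.2
  · have := failProb_map (K' r.1) fun z => (z, false)
    rw [failProb, show (fun y : Z => ind ((y, false).2 = false)) = fun _ => 1 from
      funext fun _ => ind_of rfl, integral_one, mass_pmf] at this
    rw [if_neg (by simp), this]
    simp [ind]
  · simp [ind, failProb]

/-- The second kernel acts on the unnormalised successful output of the first, which lies in `W₂`
and has no more mass than the input. Hence the failure bounds add, and nothing is required of `K'`.
-/
theorem Step.comp {W₁ : (X → ℝ≥0∞) → Prop} {W₂ : (Y → ℝ≥0∞) → Prop} {W₃ : (Z → ℝ≥0∞) → Prop}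
    {r₁ : X → Y → Prop} {r₂ : Y → Z → Prop} {q₁ q₂ : ℝ≥0∞} {K₁ : X → PMF (Y × Bool)}
    {K₂ : Y → PMF (Z × Bool)} (h₁ : Step W₁ W₂ r₁ q₁ K₁) (h₂ : Step W₂ W₃ r₂ q₂ K₂)
    (K' : Y → PMF Z) :
    Step W₁ W₃ (fun x z => ∃ y, r₁ x y ∧ r₂ y z) (q₁ + q₂) (seqK K₁ K₂ K') where
  ok m hm hf := by
    rw [okPart_seqK]
    exact h₂.ok _ (h₁.ok m hm hf) (mass_okPart_ne_top hf _)
  fail m hm hf := by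
    rw [failMass_seqK, add_mul]
    refine add_le_add (h₁.fail m hm hf) ?_
    refine (h₂.fail _ (h₁.ok m hm hf) (mass_okPart_ne_top hf _)).trans ?_
    gcongr
    exact mass_okPart_le _ _
  supp m hm hf x z hx hz := by
    obtain ⟨y, hy, hz⟩ := seqK_true_ne_zero hz
    exact ⟨y, h₁.supp m hm hf x y hx hy, h₂.supp _ (h₁.ok m hm hf) (mass_okPart_ne_top hf _) y z
      (okPart_ne_zero.2 ⟨x, hx, hy⟩) hz⟩

/-- Two independent flagged kernels in parallel. -/
noncomputable def parK (K₁ : X → PMF (Y × Bool)) (K₂ : X' → PMF (Y' × Bool)) (p : X × X') :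
    PMF ((Y × Y') × Bool) :=
  (K₁ p.1).bind fun r => (K₂ p.2).map fun r' => ((r.1, r'.1), r.2 && r'.2)

theorem parK_true (K₁ : X → PMF (Y × Bool)) (K₂ : X' → PMF (Y' × Bool)) (p : X × X') (y : Y)
    (y' : Y') : parK K₁ K₂ p ((y, y'), true) = K₁ p.1 (y, true) * K₂ p.2 (y', true) := by
  rw [parK, PMF.bind_apply, tsum_eq_single (y, true)]
  · rw [PMF.map_apply, tsum_eq_single (y', true)]
    · simp
    · rintro ⟨b, _ | _⟩ hb
      · simp
      · simp only [ne_eq, Prod.mk.injEq, and_true] at hb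
        simp [Ne.symm hb]
  · rintro ⟨b, _ | _⟩ hb
    · simp [PMF.map_apply]
    · simp only [ne_eq, Prod.mk.injEq, and_true] at hb
      simp [PMF.map_apply, Ne.symm hb]

/-- For each value of the other component, each component of a pair lies in the class. -/
def Both (W : (X → ℝ≥0∞) → Prop) (W' : (X' → ℝ≥0∞) → Prop) (m : X × X' → ℝ≥0∞) : Prop :=
  (∀ x', W fun x => m (x, x')) ∧ ∀ x, W' fun x' => m (x, x')

theorem IsCone.both {W : (X → ℝ≥0∞) → Prop} {W' : (X' → ℝ≥0∞) → Prop} (h : IsCone W)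
    (h' : IsCone W') : IsCone (Both W W') := fun _ c _ hm =>
  ⟨fun _ => h c _ fun i hi => (hm i hi).1 _, fun _ => h' c _ fun i hi => (hm i hi).2 _⟩

theorem failProb_parK_le (K₁ : X → PMF (Y × Bool)) (K₂ : X' → PMF (Y' × Bool)) (p : X × X') :
    failProb (parK K₁ K₂ p) ≤ failProb (K₁ p.1) + failProb (K₂ p.2) := by
  rw [parK, failProb, integral_bind]
  simp only [integral_map]
  calc _ ≤ integral (K₁ p.1) fun r => ind (r.2 = false) + failProb (K₂ p.2) := by
        refine integral_mono fun r _ => ?_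
        calc _ ≤ integral (K₂ p.2) fun r' => ind (r.2 = false) + ind (r'.2 = false) := by
              refine integral_mono fun r' _ => ?_
              cases r.2 <;> cases r'.2 <;> simp [ind]
          _ = _ := by
              rw [integral_add]
              congr 1
              have := integral_const_mul (K₂ p.2) (fun _ => 1) (ind (r.2 = false))
              simpa [integral_one, mass_pmf] using this
    _ = _ := by
        rw [integral_add]
        congr 1
        have := integral_const_mul (K₁ p.1) (fun _ => 1) (failProb (K₂ p.2))
        simpa [integral_one, mass_pmf] using this

/-- For a fixed output of one side, the successful output of the other side is a mixture over the
inputs of the first side, weighted with its transition probabilities; the cone property applies. The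
failure bound is a union bound, and each term is evaluated slice by slice. -/
theorem Step.prod {W : (X → ℝ≥0∞) → Prop} {W' : (X' → ℝ≥0∞) → Prop} {V : (Y → ℝ≥0∞) → Prop}
    {V' : (Y' → ℝ≥0∞) → Prop} {r₁ : X → Y → Prop} {r₂ : X' → Y' → Prop} {q₁ q₂ : ℝ≥0∞}
    {K₁ : X → PMF (Y × Bool)} {K₂ : X' → PMF (Y' × Bool)} (h₁ : Step W V r₁ q₁ K₁)
    (h₂ : Step W' V' r₂ q₂ K₂) (hV : IsCone V) (hV' : IsCone V') :
    Step (Both W W') (Both V V') (fun p s => r₁ p.1 s.1 ∧ r₂ p.2 s.2) (q₁ + q₂) (parK K₁ K₂) where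
  ok m hm hf := by
    have hinj (x' : X') : Function.Injective fun x : X => (x, x') := Prod.mk_left_injective x'
    have hinj' (x : X) : Function.Injective fun x' : X' => (x, x') := Prod.mk_right_injective x
    constructor
    · intro y'
      have := hV (fun x' => K₂ x' (y', true)) (fun x' => okPart (fun x => m (x, x')) K₁)
        fun x' _ => h₁.ok _ (hm.1 x') (mass_comp_ne_top (hinj x') hf)
      convert this using 2 with y
      simp only [okPart, push, integral, parK_true, ← ENNReal.tsum_mul_left]
      rw [ENNReal.tsum_prod', ENNReal.tsum_comm]
      exact tsum_congr fun _ => tsum_congr fun _ => by ring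
    · intro y
      have := hV' (fun x => K₁ x (y, true)) (fun x => okPart (fun x' => m (x, x')) K₂)
        fun x _ => h₂.ok _ (hm.2 x) (mass_comp_ne_top (hinj' x) hf)
      convert this using 2 with y'
      simp only [okPart, push, integral, parK_true, ← ENNReal.tsum_mul_left]
      rw [ENNReal.tsum_prod']
      exact tsum_congr fun _ => tsum_congr fun _ => by ring
  fail m hm hf := by
    have hinj (x' : X') : Function.Injective fun x : X => (x, x') := Prod.mk_left_injective x'
    have hinj' (x : X) : Function.Injective fun x' : X' => (x, x') := Prod.mk_right_injective x
    calc failMass m (parK K₁ K₂)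
        ≤ integral m fun p => failProb (K₁ p.1) + failProb (K₂ p.2) :=
          integral_mono fun p _ => failProb_parK_le _ _ _
      _ ≤ q₁ * mass m + q₂ * mass m := by
          rw [integral_add]
          refine add_le_add ?_ ?_
          · rw [mass, integral, ENNReal.tsum_prod', ENNReal.tsum_prod', ENNReal.tsum_comm,
              ENNReal.tsum_comm (f := fun a b => m (a, b)), ← ENNReal.tsum_mul_left]
            exact ENNReal.tsum_le_tsum fun x' =>
              h₁.fail _ (hm.1 x') (mass_comp_ne_top (hinj x') hf)
          · rw [mass, integral, ENNReal.tsum_prod', ENNReal.tsum_prod', ← ENNReal.tsum_mul_left]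
            exact ENNReal.tsum_le_tsum fun x =>
              h₂.fail _ (hm.2 x) (mass_comp_ne_top (hinj' x) hf)
      _ = _ := by ring
  supp m hm hf p s hp hs := by
    have hinj (x' : X') : Function.Injective fun x : X => (x, x') := Prod.mk_left_injective x'
    have hinj' (x : X) : Function.Injective fun x' : X' => (x, x') := Prod.mk_right_injective x
    obtain ⟨y, y'⟩ := s
    rw [parK_true] at hs
    exact ⟨h₁.supp _ (hm.1 p.2) (mass_comp_ne_top (hinj _) hf) p.1 y hp (left_ne_zero_of_mul hs),
      h₂.supp _ (hm.2 p.1) (mass_comp_ne_top (hinj' _) hf) p.2 y' hp (right_ne_zero_of_mul hs)⟩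

end Steps

/-! ### Transverse flagged kernels -/

section Joint

variable {X Y Z : Type} {n : ℕ}

/-- For each index `i` and all values of the other coordinates, the `i`-th coordinate lies in the
class `W i`. -/
def Joint (W : Fin n → (X → ℝ≥0∞) → Prop) (m : (Fin n → X) → ℝ≥0∞) : Prop :=
  ∀ i v, W i fun x => m (Function.update v i x)

theorem update_injective_right (v : Fin n → X) (i : Fin n) :
    Function.Injective fun x => Function.update v i x := fun a b h => by
  simpa using congrFun h i

/-- Some extension of a partial assignment. -/
noncomputable def extend [Nonempty X] (i : Fin n) (r : {j // j ≠ i} → X) : Fin n → X :=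
  (Equiv.funSplitAt i X).symm (Classical.arbitrary X, r)

theorem funSplitAt_symm [Nonempty X] (i : Fin n) (x : X) (r : {j // j ≠ i} → X) :
    (Equiv.funSplitAt i X).symm (x, r) = Function.update (extend i r) i x := by
  ext j
  by_cases h : j = i
  · subst h; simp
  · simp [extend, h]

theorem integral_split [Nonempty X] (i : Fin n) (m h : (Fin n → X) → ℝ≥0∞) :
    integral m h = ∑' r : {j // j ≠ i} → X, integral (fun x => m (Function.update (extend i r) i x))
      fun x => h (Function.update (extend i r) i x) := by
  rw [← integral_equiv (Equiv.funSplitAt i X).symm, integral_prod]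
  simp only [integral]
  rw [ENNReal.tsum_comm]
  simp only [funSplitAt_symm]

variable {W : Fin n → (X → ℝ≥0∞) → Prop} {W' : Fin n → (Y → ℝ≥0∞) → Prop}
  {rel : Fin n → X → Y → Prop} {q : ℝ≥0∞} {K : Fin n → X → PMF (Y × Bool)}

/-- Transverse application of flagged kernels, with all flags. -/
noncomputable def transK (K : Fin n → X → PMF (Y × Bool)) (v : Fin n → X) : PMF (Fin n → Y × Bool) :=
  transverse n fun i => K i (v i)

/-- For fixed outputs and flags of the other coordinates, coordinate `i` is distributed as a
mixture, over the inputs of those coordinates, of the successful outputs of `K i`. The flags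
elsewhere are arbitrary, so a failed coordinate does not spoil the successful ones. -/
theorem Joint.push_transK [Nonempty X] (hK : ∀ i, Step (W i) (W' i) (rel i) q (K i))
    (hW' : ∀ i, IsCone (W' i)) {m : (Fin n → X) → ℝ≥0∞} (hm : Joint W m) (hf : mass m ≠ ⊤)
    (F : Fin n → Bool) {i : Fin n} (hi : F i = true) (w : Fin n → Y) :
    W' i fun y => push m (transK K) fun j => (Function.update w i y j, F j) := by
  have := hW' i
    (fun r : {j // j ≠ i} → X => ∏ j ∈ Finset.univ.erase i, K j (extend i r j) (w j, F j))
    (fun r => okPart (fun x => m (Function.update (extend i r) i x)) (K i))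
    fun r _ => (hK i).ok _ (hm i _) (mass_comp_ne_top (update_injective_right _ _) hf)
  convert this using 2 with y
  rw [push, integral_split i]
  refine tsum_congr fun r => ?_
  simp only [okPart, push]
  rw [← integral_const_mul]
  refine integral_congr fun x _ => ?_
  rw [transK, transverse_apply, ← Finset.mul_prod_erase _ _ (Finset.mem_univ i), mul_comm]
  simp only [Function.update_self, hi]
  congr 1
  refine Finset.prod_congr rfl fun j hj => ?_
  have := Finset.ne_of_mem_erase hj
  simp [this]

/-- Since `g` ignores coordinate `i`, that coordinate can be integrated first with all others fixed.
Taking for `g` the failure probability of another coordinate gives `q²` without any independence of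
the inputs. -/
theorem Joint.integral_failProb_le [Nonempty X] (hK : ∀ i, Step (W i) (W' i) (rel i) q (K i))
    {m : (Fin n → X) → ℝ≥0∞} (hm : Joint W m) (hf : mass m ≠ ⊤) (i : Fin n)
    (g : (Fin n → X) → ℝ≥0∞) (hg : ∀ v x, g (Function.update v i x) = g v) :
    integral m (fun v => failProb (K i (v i)) * g v) ≤ q * integral m g := by
  rw [integral_split i, integral_split i m g, ← ENNReal.tsum_mul_left]
  refine ENNReal.tsum_le_tsum fun r => ?_
  simp only [hg, Function.update_self]
  have := (hK i).fail _ (hm i (extend i r)) (mass_comp_ne_top (update_injective_right _ _) hf)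
  calc _ = g (extend i r) * failMass (fun x => m (Function.update (extend i r) i x)) (K i) := by
        rw [failMass, ← integral_const_mul]; simp only [mul_comm]
    _ ≤ g (extend i r) * (q * mass fun x => m (Function.update (extend i r) i x)) := by gcongr
    _ = _ := by
        rw [← integral_one, mul_left_comm, ← integral_const_mul]; simp

theorem Joint.supp_transK (hK : ∀ i, Step (W i) (W' i) (rel i) q (K i))
    {m : (Fin n → X) → ℝ≥0∞} (hm : Joint W m) (hf : mass m ≠ ⊤) {v : Fin n → X}
    {z : Fin n → Y × Bool} (hv : m v ≠ 0) (hz : transK K v z ≠ 0) {i : Fin n}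
    (hi : (z i).2 = true) : rel i (v i) (z i).1 := by
  rw [transK, transverse_apply] at hz
  have h := Finset.prod_ne_zero_iff.1 hz i (Finset.mem_univ i)
  refine (hK i).supp _ (hm i v) (mass_comp_ne_top (update_injective_right _ _) hf) _ _ ?_
    (by rw [← hi]; exact h)
  simpa using hv

theorem integral_transK_fail (v : Fin n → X) (i : Fin n) :
    integral (transK K v) (fun z => ind ((z i).2 = false)) = failProb (K i (v i)) :=
  integral_transverse_coord _ i fun r : Y × Bool => ind (r.2 = false)

theorem Joint.integral_exists_fail_le [Nonempty X] (hK : ∀ i, Step (W i) (W' i) (rel i) q (K i))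
    {m : (Fin n → X) → ℝ≥0∞} (hm : Joint W m) (hf : mass m ≠ ⊤) :
    integral m (fun v => integral (transK K v) fun z => ind (¬∀ i, (z i).2 = true)) ≤
      n * q * mass m := by
  calc _ ≤ integral m fun v => ∑ i, failProb (K i (v i)) := by
        refine integral_mono fun v _ => ?_
        simp only [← integral_transK_fail v]
        rw [← integral_finset_sum]
        refine integral_mono fun z _ => ?_
        by_cases h : ∀ i, (z i).2 = true
        · simp [ind, h]
        · push Not at h
          obtain ⟨i, hi⟩ := h
          refine (ind_le_one _).trans ?_
          refine le_trans ?_ (Finset.single_le_sum (fun _ _ => zero_le) (Finset.mem_univ i))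
          simp [ind, hi]
    _ = ∑ i, integral m fun v => failProb (K i (v i)) := integral_finset_sum _ _ _
    _ ≤ ∑ _i : Fin n, q * mass m := by
        refine Finset.sum_le_sum fun i _ => ?_
        have := hm.integral_failProb_le hK hf i (fun _ => 1) fun _ _ => rfl
        simpa [integral_one] using this
    _ = _ := by simp [mul_assoc]

/-- If the successes do not cover all coordinates but one, two different coordinates have failed.
There are 21 pairs, and each costs `q²` by two applications of `Joint.integral_failProb_le`. -/
theorem Joint.integral_two_fail_le {W : Fin 7 → (X → ℝ≥0∞) → Prop} {W' : Fin 7 → (Y → ℝ≥0∞) → Prop}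
    {rel : Fin 7 → X → Y → Prop} {K : Fin 7 → X → PMF (Y × Bool)} [Nonempty X]
    (hK : ∀ i, Step (W i) (W' i) (rel i) q (K i))
    {m : (Fin 7 → X) → ℝ≥0∞} (hm : Joint W m) (hf : mass m ≠ ⊤) :
    integral m (fun v => integral (transK K v) fun z => ind (¬∃ j, ∀ i, i ≠ j → (z i).2 = true)) ≤
      21 * q ^ 2 * mass m := by
  let S : Finset (Fin 7 × Fin 7) := Finset.univ.filter fun p => p.1 < p.2
  calc _ ≤ integral m fun v => ∑ p ∈ S, failProb (K p.1 (v p.1)) * failProb (K p.2 (v p.2)) := by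
        refine integral_mono fun v _ => ?_
        calc _ ≤ integral (transK K v) fun z =>
                ∑ p ∈ S, ind ((z p.1).2 = false) * ind ((z p.2).2 = false) := by
              refine integral_mono fun z _ => ?_
              by_cases h : ∃ j, ∀ i, i ≠ j → (z i).2 = true
              · simp [ind, h]
              · refine (ind_le_one _).trans ?_
                push Not at h
                -- Exempting an arbitrary coordinate exhibits one failure at `i`; exempting `i` then
                -- exhibits a second one elsewhere.
                obtain ⟨i, -, hi⟩ := h 0
                obtain ⟨j, hij, hj⟩ := h i
                have hi' : (z i).2 = false := by simpa using hi
                have hj' : (z j).2 = false := by simpa using hj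
                rcases lt_or_gt_of_ne hij with h | h
                · have hS : (j, i) ∈ S := by simp [S, h]
                  refine le_trans ?_ (Finset.single_le_sum (fun _ _ => zero_le) hS)
                  simp [ind, hi', hj']
                · have hS : (i, j) ∈ S := by simp [S, h]
                  refine le_trans ?_ (Finset.single_le_sum (fun _ _ => zero_le) hS)
                  simp [ind, hi', hj']
          _ = _ := by
              rw [integral_finset_sum]
              refine Finset.sum_congr rfl fun p hp => ?_
              have hp : p.1 ≠ p.2 := (by simpa [S] using hp : p.1 < p.2).ne
              exact integral_transverse_coord_pair _ hp
                (fun r : Y × Bool => ind (r.2 = false)) fun r : Y × Bool => ind (r.2 = false)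
    _ = ∑ p ∈ S, integral m fun v => failProb (K p.1 (v p.1)) * failProb (K p.2 (v p.2)) :=
        integral_finset_sum _ _ _
    _ ≤ ∑ _p ∈ S, q * (q * mass m) := by
        refine Finset.sum_le_sum fun p hp => ?_
        have hp : p.1 ≠ p.2 := (by simpa [S] using hp : p.1 < p.2).ne
        refine (hm.integral_failProb_le hK hf p.1 (fun v => failProb (K p.2 (v p.2)))
          fun v x => by simp [hp.symm]).trans ?_
        gcongr
        have := hm.integral_failProb_le hK hf p.2 (fun _ => 1) fun _ _ => rfl
        simpa [integral_one] using this
    _ = _ := by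
        rw [Finset.sum_const, show S.card = 21 by decide]
        simp only [nsmul_eq_mul]
        push_cast
        ring

/-- Transverse application, successful if all components are. -/
noncomputable def strictK (K : Fin n → X → PMF (Y × Bool)) (v : Fin n → X) :
    PMF ((Fin n → Y) × Bool) :=
  (transK K v).map fun z => (fun i => (z i).1, decide (∀ i, (z i).2 = true))

theorem strictK_true (v : Fin n → X) (w : Fin n → Y) :
    strictK K v (w, true) = transK K v fun i => (w i, true) := by
  rw [strictK, PMF.map_apply, tsum_eq_single fun i => (w i, true)]
  · simp
  · intro z hz
    rw [if_neg]
    intro h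
    apply hz
    simp only [Prod.mk.injEq, eq_comm (a := true), decide_eq_true_eq] at h
    ext i
    · simp [h.1]
    · simp [h.2 i]

theorem Step.strict [Nonempty X] (hK : ∀ i, Step (W i) (W' i) (rel i) q (K i))
    (hW' : ∀ i, IsCone (W' i)) :
    Step (Joint W) (Joint W') (fun v w => ∀ i, rel i (v i) (w i)) (n * q) (strictK K) where
  ok m hm hf i w := by
    have := hm.push_transK hK hW' hf (fun _ => true) (i := i) rfl w
    simpa only [okPart, push, strictK_true] using this
  fail m hm hf := by
    refine le_trans (le_of_eq ?_) (hm.integral_exists_fail_le hK hf)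
    refine integral_congr fun v _ => ?_
    rw [strictK, failProb_map]
    refine integral_congr fun z _ => ind_congr ?_
    simp
  supp m hm hf v w hv hw i := by
    rw [strictK_true] at hw
    exact hm.supp_transK hK hf hv hw (i := i) rfl

end Joint
end SteaneFT

namespace SteaneFT
open scoped ENNReal

/-! ### Fault-tolerant kernels on systems with a status -/

section Status

variable {X Y Z Δ : Type}

/-- The mass of the runs with the perfect status `none`. -/
noncomputable def unmarkedMass (m : Option Δ × X → ℝ≥0∞) : ℝ≥0∞ :=
  integral m fun p => ind (p.1 = none)

/-- The mass of the runs in which a fault has been recorded in the status. -/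
noncomputable def markedMass (m : Option Δ × X → ℝ≥0∞) : ℝ≥0∞ :=
  integral m fun p => ind (p.1 ≠ none)

theorem unmarkedMass_add_markedMass (m : Option Δ × X → ℝ≥0∞) :
    unmarkedMass m + markedMass m = mass m := by
  rw [unmarkedMass, markedMass, ← integral_add, ← integral_one]
  simp only [ne_eq, ind_add_not]

theorem unmarkedMass_eq (m : Option Δ × X → ℝ≥0∞) :
    unmarkedMass m = mass fun x => m (none, x) := by
  rw [unmarkedMass, integral_prod, tsum_eq_single none]
  · simp [ind, integral_one]
  · intro γ hγ; simp [ind, hγ, integral]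

theorem integral_none (m h : Option Δ × X → ℝ≥0∞) :
    integral m (fun p => ind (p.1 = none) * h p) =
      integral (fun x => m (none, x)) fun x => h (none, x) := by
  rw [integral_prod, tsum_eq_single none]
  · simp [ind]
  · intro γ hγ; simp [ind, hγ, integral]

theorem markedMass_eq (m : Option Δ × X → ℝ≥0∞) :
    markedMass m = ∑' γ : Option Δ, ind (γ ≠ none) * mass fun x => m (γ, x) := by
  rw [markedMass, integral_prod]
  refine tsum_congr fun γ => ?_
  rw [← integral_one, ← integral_const_mul]; simp

theorem unmarkedMass_le (m : Option Δ × X → ℝ≥0∞) : unmarkedMass m ≤ mass m := by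
  rw [← unmarkedMass_add_markedMass m]; exact le_self_add

/-- A flagged kernel on systems whose status records the first fault. A fault in a run with a
recorded fault is a failure, and so are two new faults. A new fault occurs with probability at most
`e₁`, two new faults with probability at most `e₂`, and other failures with probability at most
`α`; `es` bounds the probability that anything goes wrong in a perfect run. -/
structure FT (W : (Option Δ × X → ℝ≥0∞) → Prop) (W' : (Option Δ × Y → ℝ≥0∞) → Prop)
    (rel : Option Δ × X → Option Δ × Y → Prop) (α e₁ e₂ es : ℝ≥0∞)
    (K : Option Δ × X → PMF ((Option Δ × Y) × Bool)) : Prop where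
  keep : ∀ p s, K p (s, true) ≠ 0 → p.1 ≠ none → s.1 = p.1
  ok : ∀ m, W m → mass m ≠ ⊤ → W' (okPart m K)
  supp : ∀ m, W m → mass m ≠ ⊤ → ∀ p s, m p ≠ 0 → K p (s, true) ≠ 0 → rel p s
  marked : ∀ m, W m → mass m ≠ ⊤ →
    markedMass (okPart m K) ≤ markedMass m + e₁ * unmarkedMass m
  fail : ∀ m, W m → mass m ≠ ⊤ →
    failMass m K ≤ α * mass m + e₂ * unmarkedMass m + e₁ * markedMass m
  strict : ∀ m, W m → mass m ≠ ⊤ →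
    failMass m K + markedMass (okPart m K) ≤ markedMass m + es * unmarkedMass m

/-- By `keep`, a recorded fault is never forgotten, so perfect outputs stem from perfect inputs. -/
theorem FT.unmarkedMass_okPart_le {W : (Option Δ × X → ℝ≥0∞) → Prop}
    {W' : (Option Δ × Y → ℝ≥0∞) → Prop} {rel : Option Δ × X → Option Δ × Y → Prop}
    {α e₁ e₂ es : ℝ≥0∞} {K : Option Δ × X → PMF ((Option Δ × Y) × Bool)}
    (h : FT W W' rel α e₁ e₂ es K) (m : Option Δ × X → ℝ≥0∞) :
    unmarkedMass (okPart m K) ≤ unmarkedMass m := by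
  rw [unmarkedMass, integral_okPart]
  refine integral_mono fun p _ => ?_
  by_cases hp : p.1 = none
  · rw [ind_of hp]
    refine integral_pmf_le_one _ fun r => ?_
    exact mul_le_one' (ind_le_one _) (ind_le_one _)
  · rw [ind_of_not hp, nonpos_iff_eq_zero, integral, ENNReal.tsum_eq_zero]
    rintro ⟨s, _ | _⟩
    · simp [ind]
    · by_cases hs : K p (s, true) = 0
      · simp [hs]
      · simp [ind, h.keep p s hs hp, hp]

/-- The new second-order term `e₁ * e₁'` is a fault recorded in the first stage followed by a fault
in the second. Two faults within one stage are already covered by `e₂` and `e₂'`. -/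
theorem FT.comp {W₁ : (Option Δ × X → ℝ≥0∞) → Prop} {W₂ : (Option Δ × Y → ℝ≥0∞) → Prop}
    {W₃ : (Option Δ × Z → ℝ≥0∞) → Prop} {r₁ : Option Δ × X → Option Δ × Y → Prop}
    {r₂ : Option Δ × Y → Option Δ × Z → Prop} {α e₁ e₂ es α' e₁' e₂' es' : ℝ≥0∞}
    {K₁ : Option Δ × X → PMF ((Option Δ × Y) × Bool)}
    {K₂ : Option Δ × Y → PMF ((Option Δ × Z) × Bool)} (h₁ : FT W₁ W₂ r₁ α e₁ e₂ es K₁)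
    (h₂ : FT W₂ W₃ r₂ α' e₁' e₂' es' K₂) (K' : Option Δ × Y → PMF (Option Δ × Z)) :
    FT W₁ W₃ (fun p s => ∃ t, r₁ p t ∧ r₂ t s) (α + α') (e₁ + e₁') (e₂ + e₂' + e₁ * e₁') (es + es')
      (seqK K₁ K₂ K') where
  keep p s hs hp := by
    obtain ⟨t, ht, hs⟩ := seqK_true_ne_zero hs
    have := h₁.keep p t ht hp
    rw [← this] at hp ⊢
    exact h₂.keep t s hs hp
  ok m hm hf := by
    rw [okPart_seqK]
    exact h₂.ok _ (h₁.ok m hm hf) (mass_okPart_ne_top hf _)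
  supp m hm hf x z hx hz := by
    obtain ⟨y, hy, hz⟩ := seqK_true_ne_zero hz
    exact ⟨y, h₁.supp m hm hf x y hx hy, h₂.supp _ (h₁.ok m hm hf) (mass_okPart_ne_top hf _) y z
      (okPart_ne_zero.2 ⟨x, hx, hy⟩) hz⟩
  marked m hm hf := by
    rw [okPart_seqK]
    calc _ ≤ markedMass (okPart m K₁) + e₁' * unmarkedMass (okPart m K₁) :=
          h₂.marked _ (h₁.ok m hm hf) (mass_okPart_ne_top hf _)
      _ ≤ (markedMass m + e₁ * unmarkedMass m) + e₁' * unmarkedMass m := by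
          gcongr
          · exact h₁.marked m hm hf
          · exact h₁.unmarkedMass_okPart_le m
      _ = _ := by ring
  fail m hm hf := by
    rw [failMass_seqK]
    calc _ ≤ failMass m K₁ + (α' * mass (okPart m K₁) + e₂' * unmarkedMass (okPart m K₁) +
            e₁' * markedMass (okPart m K₁)) := by
          gcongr
          exact h₂.fail _ (h₁.ok m hm hf) (mass_okPart_ne_top hf _)
      _ ≤ (α * mass m + e₂ * unmarkedMass m + e₁ * markedMass m) + (α' * mass m +
            e₂' * unmarkedMass m + e₁' * (markedMass m + e₁ * unmarkedMass m)) := by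
          gcongr
          · exact h₁.fail m hm hf
          · exact mass_okPart_le _ _
          · exact h₁.unmarkedMass_okPart_le m
          · exact h₁.marked m hm hf
      _ = _ := by ring
  strict m hm hf := by
    rw [failMass_seqK, okPart_seqK]
    calc _ = failMass m K₁ + (failMass (okPart m K₁) K₂ +
            markedMass (okPart (okPart m K₁) K₂)) := by ring
      _ ≤ failMass m K₁ + (markedMass (okPart m K₁) + es' * unmarkedMass (okPart m K₁)) := by
          exact add_le_add le_rfl (h₂.strict _ (h₁.ok m hm hf) (mass_okPart_ne_top hf _))
      _ = (failMass m K₁ + markedMass (okPart m K₁)) + es' * unmarkedMass (okPart m K₁) := by ring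
      _ ≤ (markedMass m + es * unmarkedMass m) + es' * unmarkedMass m := by
          refine add_le_add (h₁.strict m hm hf) ?_
          gcongr
          exact h₁.unmarkedMass_okPart_le m
      _ = _ := by ring

theorem FT.mono {W V : (Option Δ × X → ℝ≥0∞) → Prop} {W' V' : (Option Δ × Y → ℝ≥0∞) → Prop}
    {rel rel' : Option Δ × X → Option Δ × Y → Prop} {α e₁ e₂ es : ℝ≥0∞}
    {K : Option Δ × X → PMF ((Option Δ × Y) × Bool)} (h : FT W W' rel α e₁ e₂ es K)
    (hV : ∀ m, V m → W m) (hW : ∀ m, W' m → V' m) (hrel : ∀ x y, rel x y → rel' x y) :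
    FT V V' rel' α e₁ e₂ es K where
  keep := h.keep
  ok m hm hf := hW _ (h.ok m (hV m hm) hf)
  supp m hm hf x y hx hy := hrel _ _ (h.supp m (hV m hm) hf x y hx hy)
  marked m hm := h.marked m (hV m hm)
  fail m hm := h.fail m (hV m hm)
  strict m hm := h.strict m (hV m hm)

/-- Successful runs without faults. -/
noncomputable def strictOf (K : Option Δ × X → PMF ((Option Δ × Y) × Bool)) (x : X) :
    PMF (Y × Bool) :=
  (K (none, x)).map fun r => (r.1.2, r.2 && r.1.1.isNone)

theorem strictOf_true (K : Option Δ × X → PMF ((Option Δ × Y) × Bool)) (x : X) (y : Y) :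
    strictOf K x (y, true) = K (none, x) ((none, y), true) := by
  rw [strictOf, PMF.map_apply, tsum_eq_single ((none, y), true)]
  · simp
  · rintro ⟨⟨_ | γ, z⟩, _ | _⟩ h
    · simp
    · simp only [ne_eq, Prod.mk.injEq, true_and, and_true] at h
      simp [Ne.symm h]
    · simp
    · simp

open Classical in
-- Put the input measure on the status `none` and count every recorded fault as a failure; the field
-- `strict` bounds precisely the sum of both.
theorem FT.strictOf {W : (Option Δ × X → ℝ≥0∞) → Prop} {W' : (Option Δ × Y → ℝ≥0∞) → Prop}
    {rel : Option Δ × X → Option Δ × Y → Prop} {α e₁ e₂ es : ℝ≥0∞}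
    {K : Option Δ × X → PMF ((Option Δ × Y) × Bool)} (h : FT W W' rel α e₁ e₂ es K)
    {V : (X → ℝ≥0∞) → Prop} {V' : (Y → ℝ≥0∞) → Prop}
    (hV : ∀ m, V m → W fun p => if p.1 = none then m p.2 else 0)
    (hV' : ∀ m, W' m → V' fun y => m (none, y)) :
    Step V V' (fun x y => rel (none, x) (none, y)) es (strictOf K) := by
  have hmass : ∀ m : X → ℝ≥0∞,
      mass (fun p : Option Δ × X => if p.1 = none then m p.2 else 0) = mass m := by
    intro m
    rw [mass_prod, tsum_eq_single none]
    · simp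
    · intro γ hγ; simp [hγ, mass]
  have hint : ∀ (m : X → ℝ≥0∞) (g : Option Δ × X → ℝ≥0∞),
      integral (fun p : Option Δ × X => if p.1 = none then m p.2 else 0) g =
        integral m fun x => g (none, x) := by
    intro m g
    rw [integral_prod, tsum_eq_single none]
    · simp
    · intro γ hγ; simp [hγ, integral]
  constructor
  · intro m hm hf
    have := hV' _ (h.ok _ (hV m hm) (by rwa [hmass]))
    convert this using 2 with y
    simp only [okPart, push, strictOf_true, hint]
  · intro m hm hf
    have := h.strict _ (hV m hm) (by rwa [hmass])
    have hu : unmarkedMass (fun p : Option Δ × X => if p.1 = none then m p.2 else 0) = mass m := by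
      rw [unmarkedMass, hint]; simp [ind, integral_one]
    have hk : markedMass (fun p : Option Δ × X => if p.1 = none then m p.2 else 0) = 0 := by
      rw [markedMass, hint]; simp [ind, integral]
    rw [hu, hk, zero_add] at this
    refine le_trans (le_of_eq ?_) this
    rw [markedMass, integral_okPart, failMass, failMass, hint, hint, ← integral_add]
    refine integral_congr fun x _ => ?_
    rw [SteaneFT.strictOf, failProb_map, failProb, ← integral_add]
    refine integral_congr fun r _ => ?_
    obtain ⟨⟨_ | γ, z⟩, _ | _⟩ := r <;> simp [ind]
  · intro m hm hf x y hx hy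
    rw [strictOf_true] at hy
    exact h.supp _ (hV m hm) (by rwa [hmass]) _ _ (by simpa using hx) hy

/-- The membership in `W` of those of the coordinates that do not belong to the set `S`. -/
def Off (S : Set (Fin 7)) (W : (X → ℝ≥0∞) → Prop) (i : Fin 7) (m : X → ℝ≥0∞) : Prop := i ∉ S → W m

theorem IsCone.off {W : (X → ℝ≥0∞) → Prop} (h : IsCone W) (S : Set (Fin 7)) (i : Fin 7) :
    IsCone (Off S W i) := fun _ c _ hm hi => h c _ fun j hj => hm j hj hi

/-- For every status `γ`, the components satisfy `W γ` jointly. -/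
def StatusJoint (W : Option Δ → Fin 7 → (X → ℝ≥0∞) → Prop) (m : Option Δ × (Fin 7 → X) → ℝ≥0∞) :
    Prop :=
  ∀ γ, Joint (W γ) fun v => m (γ, v)

open Classical in
/-- The status and the success flag after a transverse operation, depending on the flags of the
components. -/
noncomputable def outcome (single : Fin 7 → Δ) (γ : Option Δ) (F : Fin 7 → Bool) :
    Option Δ × Bool :=
  if ∀ i, F i = true then (γ, true)
  else if h : γ = none ∧ ∃ j, ∀ i, i ≠ j → F i = true then (some (single h.2.choose), true)
  else (γ, false)

theorem outcome_true {single : Fin 7 → Δ} {γ γ' : Option Δ} {F : Fin 7 → Bool}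
    (h : outcome single γ F = (γ', true)) :
    (γ' = γ ∧ ∀ i, F i = true) ∨
      (γ = none ∧ ∃ j, γ' = some (single j) ∧ ∀ i, i ≠ j → F i = true) := by
  unfold outcome at h
  split_ifs at h with h1 h2
  · simp only [Prod.mk.injEq, and_true] at h
    exact Or.inl ⟨h.symm, h1⟩
  · simp only [Prod.mk.injEq, and_true] at h
    exact Or.inr ⟨h2.1, h2.2.choose, h.symm, h2.2.choose_spec⟩
  · simp at h

/-- Transverse application of flagged kernels that depend on the status. -/
noncomputable def statusK (single : Fin 7 → Δ) (K : Option Δ → Fin 7 → X → PMF (Y × Bool))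
    (p : Option Δ × (Fin 7 → X)) : PMF ((Option Δ × (Fin 7 → Y)) × Bool) :=
  (transK (K p.1) p.2).map fun z =>
    (((outcome single p.1 fun i => (z i).2).1, fun i => (z i).1),
      (outcome single p.1 fun i => (z i).2).2)

theorem statusK_true_ne_zero {single : Fin 7 → Δ} {K : Option Δ → Fin 7 → X → PMF (Y × Bool)}
    {γ γ' : Option Δ} {v : Fin 7 → X} {w : Fin 7 → Y}
    (h : statusK single K (γ, v) ((γ', w), true) ≠ 0) :
    ∃ z, transK (K γ) v z ≠ 0 ∧ (∀ i, (z i).1 = w i) ∧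
      outcome single γ (fun i => (z i).2) = (γ', true) := by
  rw [statusK, map_apply_eq_integral, integral_ne_zero] at h
  obtain ⟨z, hz, h⟩ := h
  rw [ind_ne_zero] at h
  simp only [Prod.mk.injEq] at h
  exact ⟨z, hz, fun i => (congrFun h.1.2 i).symm, Prod.ext h.1.1.symm h.2.symm⟩

/-- This displays the successful output as a mixture over the initial statuses and the flag patterns
that lead to `γ'`, so that a cone property can be checked for one such pattern at a time. -/
theorem okPart_statusK (single : Fin 7 → Δ) (K : Option Δ → Fin 7 → X → PMF (Y × Bool))
    (m : Option Δ × (Fin 7 → X) → ℝ≥0∞) (γ' : Option Δ) (w : Fin 7 → Y) :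
    okPart m (statusK single K) (γ', w) =
      integral (fun c : Option Δ × (Fin 7 → Bool) => ind (outcome single c.1 c.2 = (γ', true)))
        fun c => push (fun v => m (c.1, v)) (transK (K c.1)) fun i => (w i, c.2 i) := by
  simp only [okPart, push]
  rw [integral_prod, integral_prod]
  refine tsum_congr fun γ => ?_
  have h1 := push_map (fun v => m (γ, v)) (transK (K γ)) (fun z =>
    (((outcome single γ fun i => (z i).2).1, fun i => (z i).1),
      (outcome single γ fun i => (z i).2).2)) ((γ', w), true)
  change integral _ (fun v => (transK (K γ) v).map _ ((γ', w), true)) = _ at h1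
  refine h1.trans ?_
  rw [← integral_equiv (Equiv.arrowProdEquivProdArrow (Fin 7) (fun _ => Y) fun _ => Bool).symm,
    integral_prod, tsum_eq_single w]
  · refine tsum_congr fun F => ?_
    rw [mul_comm]
    congr 1
    refine ind_congr ?_
    simp only [Equiv.arrowProdEquivProdArrow, Equiv.coe_fn_symm_mk, and_true,
      Prod.ext_iff]
    tauto
  · intro w' hw'
    rw [integral, ENNReal.tsum_eq_zero]
    intro F
    rw [ind_of_not, mul_zero]
    simp only [Equiv.arrowProdEquivProdArrow, Equiv.coe_fn_symm_mk, Prod.mk.injEq]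
    exact fun h => hw' h.1.2.symm

/-- The action of a transverse operation on the components. -/
def statusRel (single : Fin 7 → Δ) (rel : Option Δ → Fin 7 → X → Y → Prop)
    (p : Option Δ × (Fin 7 → X)) (s : Option Δ × (Fin 7 → Y)) : Prop :=
  (s.1 = p.1 ∧ ∀ i, rel p.1 i (p.2 i) (s.2 i)) ∨
    (p.1 = none ∧ ∃ j, s.1 = some (single j) ∧ ∀ i, i ≠ j → rel none i (p.2 i) (s.2 i))

/-- Starting from `none`, one failed component is tolerated and becomes the status, so failure needs
two failed components. Starting from a recorded fault, any failed component is a failure. The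
hypothesis `hs` says that the new status `single j` asks nothing beyond what the components other
than `j` already satisfy. -/
theorem FT.transverse [Nonempty X] {single : Fin 7 → Δ}
    {K : Option Δ → Fin 7 → X → PMF (Y × Bool)}
    {W : Option Δ → Fin 7 → (X → ℝ≥0∞) → Prop} {W' : Option Δ → Fin 7 → (Y → ℝ≥0∞) → Prop}
    {rel : Option Δ → Fin 7 → X → Y → Prop} {q : ℝ≥0∞}
    (hK : ∀ γ i, Step (W γ i) (W' γ i) (rel γ i) q (K γ i)) (hW' : ∀ γ i, IsCone (W' γ i))
    (hs : ∀ j i m, (i ≠ j → W' none i m) → W' (some (single j)) i m) :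
    FT (StatusJoint W) (StatusJoint W') (statusRel single rel) 0 (7 * q) (21 * q ^ 2) (7 * q)
      (statusK single K) := by
  have hslice : ∀ {m : Option Δ × (Fin 7 → X) → ℝ≥0∞}, mass m ≠ ⊤ → ∀ γ,
      mass (fun v => m (γ, v)) ≠ ⊤ := fun hf γ =>
    mass_comp_ne_top (Prod.mk_right_injective γ) hf
  have hgood : ∀ m, StatusJoint W m → mass m ≠ ⊤ → ∀ γ,
      integral (fun v => m (γ, v)) (fun v => integral (transK (K γ) v) fun z =>
        ind (¬∀ i, (z i).2 = true)) ≤ 7 * q * mass fun v => m (γ, v) := fun m hm hf γ => by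
    simpa using (hm γ).integral_exists_fail_le (hK γ) (hslice hf γ)
  have hfailK : ∀ γ v, failProb (statusK single K (γ, v)) ≤
      integral (transK (K γ) v) fun z => ind (¬∀ i, (z i).2 = true) := by
    intro γ v
    rw [statusK, failProb_map]
    refine integral_mono fun z _ => ind_mono fun h h' => ?_
    simp [outcome, h'] at h
  have hbadK : ∀ v, failProb (statusK single K (none, v)) +
      (integral (statusK single K (none, v)) fun r => ind (r.2 = true) * ind (r.1.1 ≠ none)) ≤
      integral (transK (K none) v) fun z => ind (¬∀ i, (z i).2 = true) := by
    intro v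
    rw [statusK, failProb_map, integral_map, ← integral_add]
    refine integral_mono fun z _ => ?_
    simp only
    by_cases h : ∀ i, (z i).2 = true
    · simp [outcome, h, ind]
    · rw [ind_of h]
      rcases hb : (outcome single none fun i => (z i).2).2
      · simp [ind]
      · simp only [ind]
        split_ifs <;> simp_all
  have hstrict : ∀ m, StatusJoint W m → mass m ≠ ⊤ →
      failMass m (statusK single K) + markedMass (okPart m (statusK single K)) ≤
        markedMass m + 7 * q * unmarkedMass m := by
    intro m hm hf
    rw [failMass, markedMass, integral_okPart, ← integral_add]
    calc _ ≤ integral m fun p => ind (p.1 ≠ none) + ind (p.1 = none) *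
            integral (transK (K none) p.2) fun z => ind (¬∀ i, (z i).2 = true) := by
          refine integral_mono fun p _ => ?_
          obtain ⟨_ | γ, v⟩ := p
          · simpa [ind] using hbadK v
          · simp only [ne_eq, reduceCtorEq, not_false_eq_true, ind_of, ind_of_not, zero_mul,
              add_zero]
            rw [failProb, ← integral_add]
            refine integral_pmf_le_one _ fun r => ?_
            cases r.2 <;> simp [ind]
            split_ifs <;> simp
      _ = markedMass m + integral (fun v => m (none, v)) fun v =>
            integral (transK (K none) v) fun z => ind (¬∀ i, (z i).2 = true) := by
          rw [integral_add, markedMass]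
          congr 1
          exact integral_none m fun p =>
            integral (transK (K none) p.2) fun z => ind (¬∀ i, (z i).2 = true)
      _ ≤ _ := by
          rw [unmarkedMass_eq]
          gcongr
          exact hgood m hm hf none
  refine ⟨?_, ?_, ?_, ?_, ?_, hstrict⟩
  · rintro ⟨γ, v⟩ ⟨γ', w⟩ h hγ
    obtain ⟨z, -, -, h⟩ := statusK_true_ne_zero h
    rcases outcome_true h with h | h
    · exact h.1
    · exact absurd h.1 hγ
  · intro m hm hf γ' i w
    simp only [okPart_statusK]
    refine hW' γ' i _ _ fun c hc => ?_
    rw [ind_ne_zero] at hc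
    rcases outcome_true hc with ⟨rfl, h⟩ | ⟨h0, j, rfl, h⟩
    · exact (hm _).push_transK (hK _) (hW' _) (hslice hf _) c.2 (h i) w
    · refine hs j i _ fun hij => ?_
      rw [h0]
      exact (hm _).push_transK (hK _) (hW' _) (hslice hf _) c.2 (h i hij) w
  · rintro m hm hf ⟨γ, v⟩ ⟨γ', w⟩ hp h
    obtain ⟨z, hz, hw, h⟩ := statusK_true_ne_zero h
    rcases outcome_true h with ⟨rfl, h'⟩ | ⟨rfl, j, rfl, h'⟩
    · refine Or.inl ⟨rfl, fun i => ?_⟩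
      simp only [← hw]
      exact (hm _).supp_transK (hK _) (hslice hf _) hp hz (h' i)
    · refine Or.inr ⟨rfl, j, rfl, fun i hi => ?_⟩
      simp only [← hw]
      exact (hm _).supp_transK (hK _) (hslice hf _) hp hz (h' i hi)
  · intro m hm hf
    exact le_add_self.trans (hstrict m hm hf)
  · intro m hm hf
    calc failMass m (statusK single K)
        ≤ integral m fun p => ind (p.1 = none) * (integral (transK (K none) p.2) fun z =>
            ind (¬∃ j, ∀ i, i ≠ j → (z i).2 = true)) + ind (p.1 ≠ none) *
            integral (transK (K p.1) p.2) fun z => ind (¬∀ i, (z i).2 = true) := by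
          refine integral_mono fun p _ => ?_
          obtain ⟨_ | γ, v⟩ := p
          · simp only [ind_of, ne_eq, not_true_eq_false, not_false_eq_true, ind_of_not, one_mul,
              zero_mul, add_zero]
            rw [statusK, failProb_map]
            refine integral_mono fun z _ => ind_mono fun h h' => ?_
            by_cases h0 : ∀ i, (z i).2 = true <;> simp [outcome, h', h0] at h
          · simpa [ind] using hfailK (some γ) v
      _ ≤ 21 * q ^ 2 * unmarkedMass m + 7 * q * markedMass m := by
          rw [integral_add, integral_none, unmarkedMass_eq]
          refine add_le_add ((hm _).integral_two_fail_le (hK _) (hslice hf _)) ?_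
          rw [markedMass_eq, integral_prod, ← ENNReal.tsum_mul_left]
          refine ENNReal.tsum_le_tsum fun γ => ?_
          simp only [integral_const_mul]
          rw [mul_left_comm]
          gcongr
          exact hgood m hm hf γ
      _ = _ := by ring

/-- A source of systems: failure has probability at most `α`, a recorded fault probability at most
`a`, and both together at most `es`. -/
structure Source (W : (Option Δ × X → ℝ≥0∞) → Prop) (Φ : Option Δ × X → Prop) (α a es : ℝ≥0∞)
    (R : PMF ((Option Δ × X) × Bool)) : Prop where
  ok : W fun p => R (p, true)
  supp : ∀ p, R (p, true) ≠ 0 → Φ p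
  fail : failProb R ≤ α
  marked : markedMass (fun p => R (p, true)) ≤ a
  strict : failProb R + markedMass (fun p => R (p, true)) ≤ es

theorem mass_true_le_one (R : PMF (X × Bool)) : mass (fun p => R (p, true)) ≤ 1 := by
  rw [← mass_pmf R]
  exact mass_comp_le (Prod.mk_left_injective true) R

theorem mass_true_add_failProb (R : PMF (X × Bool)) : mass (fun p => R (p, true)) + failProb R = 1 := by
  rw [← mass_pmf R, mass, mass, tsum_flag, failProb, integral, tsum_flag]
  simp [ind]

/-- Apply a flagged kernel to the output of a source. -/
noncomputable def seqS (R : PMF (X × Bool)) (K : X → PMF (Y × Bool)) (K' : X → PMF Y) :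
    PMF (Y × Bool) :=
  seqK (fun _ : Unit => R) K K' ()

theorem okPart_unit (R : PMF (X × Bool)) (x : X) :
    okPart (fun _ : Unit => 1) (fun _ => R) x = R (x, true) := by
  simp [okPart, push, integral]

theorem seqS_true (R : PMF (X × Bool)) (K : X → PMF (Y × Bool)) (K' : X → PMF Y) :
    (fun y => seqS R K K' (y, true)) = okPart (fun x => R (x, true)) K := by
  ext y
  rw [seqS, seqK_true]
  rfl

theorem failProb_seqS (R : PMF (X × Bool)) (K : X → PMF (Y × Bool)) (K' : X → PMF Y) :
    failProb (seqS R K K') = failProb R + failMass (fun x => R (x, true)) K := by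
  have := failMass_seqK (fun _ : Unit => 1) (fun _ => R) K K'
  rw [funext (okPart_unit R)] at this
  simpa [failMass, integral, seqS] using this

/-- As in `FT.comp`, with the total mass bounded by one: a fault recorded in the source meets a
fault of the kernel with probability at most `e₁ * a`. -/
theorem Source.comp {W : (Option Δ × X → ℝ≥0∞) → Prop} {W' : (Option Δ × Y → ℝ≥0∞) → Prop}
    {Φ : Option Δ × X → Prop} {rel : Option Δ × X → Option Δ × Y → Prop}
    {α a es α' e₁ e₂ es' : ℝ≥0∞} {R : PMF ((Option Δ × X) × Bool)}
    {K : Option Δ × X → PMF ((Option Δ × Y) × Bool)} (hR : Source W Φ α a es R)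
    (hK : FT W W' rel α' e₁ e₂ es' K) (K' : Option Δ × X → PMF (Option Δ × Y)) :
    Source W' (fun s => ∃ p, Φ p ∧ rel p s) (α + α' + e₂ + e₁ * a) (a + e₁) (es + es')
      (seqS R K K') := by
  have hone := mass_true_le_one R
  have hf : mass (fun p => R (p, true)) ≠ ⊤ := ne_top_of_le_ne_top ENNReal.one_ne_top hone
  have hu := (unmarkedMass_le fun p => R (p, true)).trans hone
  constructor
  · rw [seqS_true]; exact hK.ok _ hR.ok hf
  · intro s hs
    obtain ⟨p, hp, hs⟩ := seqK_true_ne_zero hs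
    exact ⟨p, hR.supp p hp, hK.supp _ hR.ok hf p s hp hs⟩
  · rw [failProb_seqS]
    calc _ ≤ α + (α' * 1 + e₂ * 1 + e₁ * a) := by
          refine add_le_add hR.fail ((hK.fail _ hR.ok hf).trans ?_)
          gcongr
          exact hR.marked
      _ = _ := by ring
  · rw [seqS_true]
    calc _ ≤ a + e₁ * 1 := by
          refine (hK.marked _ hR.ok hf).trans ?_
          gcongr
          exact hR.marked
      _ = _ := by ring
  · rw [seqS_true, failProb_seqS]
    calc _ = failProb R + (failMass (fun x => R (x, true)) K +
            markedMass (okPart (fun x => R (x, true)) K)) := by ring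
      _ ≤ failProb R + (markedMass (fun x => R (x, true)) + es' * 1) := by
          refine add_le_add le_rfl ((hK.strict _ hR.ok hf).trans ?_)
          gcongr
      _ = (failProb R + markedMass (fun x => R (x, true))) + es' := by ring
      _ ≤ _ := by gcongr; exact hR.strict

theorem Source.mono {W W' : (Option Δ × X → ℝ≥0∞) → Prop} {Φ Φ' : Option Δ × X → Prop}
    {α a es α' a' es' : ℝ≥0∞} {R : PMF ((Option Δ × X) × Bool)} (h : Source W Φ α a es R)
    (hW : ∀ m, W m → W' m) (hΦ : ∀ p, Φ p → Φ' p) (hα : α ≤ α') (ha : a ≤ a') (hes : es ≤ es') :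
    Source W' Φ' α' a' es' R :=
  ⟨hW _ h.ok, fun p hp => hΦ p (h.supp p hp), h.fail.trans hα, h.marked.trans ha,
    h.strict.trans hes⟩

end Status

/-! ### Attaching an independent ancilla -/

section Attach

variable {X X' Δ : Type}

/-- Add the components of an independent system; both systems having a fault is a failure. -/
noncomputable def attachK (R : PMF ((Option Δ × (Fin 7 → X')) × Bool))
    (p : Option Δ × (Fin 7 → X)) : PMF ((Option Δ × (Fin 7 → X × X')) × Bool) :=
  R.map fun r => ((p.1.or r.1.1, fun i => (p.2 i, r.1.2 i)),
    r.2 && (p.1.isNone || r.1.1.isNone))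

theorem attachK_true (R : PMF ((Option Δ × (Fin 7 → X')) × Bool)) (p : Option Δ × (Fin 7 → X))
    (γ : Option Δ) (v : Fin 7 → X × X') :
    attachK R p ((γ, v), true) = ∑' γ' : Option Δ,
      ind ((p.1 = none ∨ γ' = none) ∧ γ = p.1.or γ' ∧ ∀ i, (v i).1 = p.2 i) *
        R ((γ', fun i => (v i).2), true) := by
  rw [attachK, map_apply_eq_integral, integral, tsum_flag, ENNReal.tsum_prod']
  have : ∑' y, R (y, false) * ind (((γ, v), true) = ((p.1.or y.1, fun i => (p.2 i, y.2 i)),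
    false && (p.1.isNone || y.1.isNone))) = 0 := by simp [ind]
  rw [this, add_zero]
  refine tsum_congr fun γ' => ?_
  rw [tsum_eq_single fun i => (v i).2, mul_comm]
  · congr 1
    refine ind_congr ?_
    simp only [Bool.true_and, eq_comm (a := true), Bool.or_eq_true,
      Option.isNone_iff_eq_none, funext_iff, Prod.ext_iff, and_true]
    tauto
  · intro w hw
    rw [ind_of_not, mul_zero]
    simp only [funext_iff, Prod.ext_iff]
    exact fun h => hw (funext fun i => (h.1.2 i).2.symm)

/-- The ancilla is independent, so the joint measure is a sum of products. In a success at most one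
of the two statuses is nontrivial, and the system with status `none` meets the weaker requirements
of the joint status by `hW0` or `hV0`. There is no separate second-order term, as two faults inside
the ancilla belong to `α`; a marked ancilla meeting marked data is charged through `a`. -/
theorem FT.attach {W : Option Δ → Fin 7 → (X → ℝ≥0∞) → Prop}
    {V : Option Δ → Fin 7 → (X' → ℝ≥0∞) → Prop} {Φ : Option Δ × (Fin 7 → X') → Prop}
    {α a es : ℝ≥0∞} {R : PMF ((Option Δ × (Fin 7 → X')) × Bool)}
    (hR : Source (StatusJoint V) Φ α a es R) (hW : ∀ γ i, IsCone (W γ i))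
    (hV : ∀ γ i, IsCone (V γ i)) (hW0 : ∀ γ i m, W none i m → W γ i m)
    (hV0 : ∀ γ i m, V none i m → V γ i m) :
    FT (StatusJoint W) (StatusJoint fun γ i => Both (W γ i) (V γ i))
      (fun p s => (∃ γ, (p.1 = none ∨ γ = none) ∧ s.1 = p.1.or γ ∧ Φ (γ, fun i => (s.2 i).2)) ∧
        ∀ i, (s.2 i).1 = p.2 i)
      α a 0 es (attachK R) := by
  have hupd : ∀ (v : Fin 7 → X × X') (i : Fin 7) (x : X) (x' : X'),
      (fun j => (Function.update v i (x, x') j).1) = Function.update (fun j => (v j).1) i x ∧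
      (fun j => (Function.update v i (x, x') j).2) = Function.update (fun j => (v j).2) i x' := by
    intro v i x x'
    constructor <;> ext j <;> by_cases h : j = i <;> simp [h]
  have hok : ∀ (m : Option Δ × (Fin 7 → X) → ℝ≥0∞) (γ : Option Δ) (v : Fin 7 → X × X'), okPart m (attachK R) (γ, v) =
      integral (fun c : Option Δ × Option Δ => ind ((c.1 = none ∨ c.2 = none) ∧ γ = c.1.or c.2))
        fun c => m (c.1, fun i => (v i).1) * R ((c.2, fun i => (v i).2), true) := by
    intro m γ v
    simp only [okPart, push, attachK_true]
    rw [integral_prod, integral_prod]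
    refine tsum_congr fun γ₁ => ?_
    rw [integral, tsum_eq_single fun i => (v i).1]
    · rw [← ENNReal.tsum_mul_left]
      refine tsum_congr fun γ₂ => ?_
      simp only [implies_true, and_true]
      ring
    · intro w hw
      rw [mul_eq_zero]
      refine Or.inr (ENNReal.tsum_eq_zero.2 fun γ₂ => ?_)
      rw [ind_of_not, zero_mul]
      exact fun h => hw (funext fun i => (h.2.2 i).symm)
  have hfail : ∀ p : Option Δ × (Fin 7 → X), failProb (attachK R p) + (integral (attachK R p) fun r =>
      ind (r.2 = true) * ind (r.1.1 ≠ none)) ≤ ind (p.1 ≠ none) + ind (p.1 = none) * es := by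
    intro p
    by_cases hp : p.1 = none
    · rw [ind_of hp, ind_of_not (by simp [hp]), one_mul, zero_add]
      refine le_trans (le_of_eq ?_) hR.strict
      rw [attachK, failProb_map, integral_map, markedMass, failProb]
      congr 1
      · refine integral_congr fun r _ => ?_
        simp [hp]
      · conv_lhs => rw [integral, tsum_flag]
        simp [hp, ind, integral]
    · rw [ind_of hp, ind_of_not hp, zero_mul, add_zero, failProb, ← integral_add]
      refine integral_pmf_le_one _ fun r => ?_
      cases r.2 <;> simp [ind]
      split_ifs <;> simp
  refine ⟨?_, ?_, ?_, ?_, ?_, ?_⟩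
  · rintro ⟨γ, v⟩ ⟨γ', w⟩ h hγ
    rw [attachK_true] at h
    simp only [ne_eq, ENNReal.tsum_eq_zero, not_forall, mul_eq_zero, not_or] at h
    obtain ⟨γ₂, h, -⟩ := h
    have h := ind_ne_zero.1 h
    obtain ⟨rfl | rfl, h, -⟩ := h
    · simp at hγ
    · simpa using h
  · intro m hm hf γ i v
    simp only [hok]
    refine IsCone.both (hW γ i) (hV γ i) _ _ fun c hc => ?_
    have hc := ind_ne_zero.1 hc
    have hWi : ∀ u, W γ i fun x => m (c.1, Function.update u i x) := by
      intro u
      obtain ⟨h | h, rfl⟩ := hc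
      · rw [h]; exact hW0 _ _ _ (hm _ _ _)
      · rw [h]; simpa using hm _ _ _
    have hVi : ∀ u, V γ i fun x => R ((c.2, Function.update u i x), true) := by
      intro u
      obtain ⟨h | h, rfl⟩ := hc
      · rw [h]; simpa using hR.ok _ _ _
      · rw [h]; exact hV0 _ _ _ (hR.ok _ _ _)
    constructor
    · intro x'
      simp only [fun x => (hupd v i x x').1, fun x => (hupd v i x x').2]
      convert IsCone.smul (hW γ i) (hWi fun j => (v j).1)
        (R ((c.2, Function.update (fun j => (v j).2) i x'), true)) using 2
      exact mul_comm _ _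
    · intro x
      simp only [fun x' => (hupd v i x x').1, fun x' => (hupd v i x x').2]
      exact IsCone.smul (hV γ i) (hVi _) _
  · rintro m hm hf ⟨γ, v⟩ ⟨γ', w⟩ - h
    rw [attachK_true] at h
    simp only [ne_eq, ENNReal.tsum_eq_zero, not_forall, mul_eq_zero, not_or] at h
    obtain ⟨γ₂, h, h'⟩ := h
    have h := ind_ne_zero.1 h
    exact ⟨⟨γ₂, h.1, h.2.1, hR.supp _ h'⟩, h.2.2⟩
  · intro m hm hf
    rw [markedMass, integral_okPart, markedMass, unmarkedMass, ← integral_const_mul,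
      ← integral_add]
    refine integral_mono fun p _ => ?_
    by_cases hp : p.1 = none
    · rw [ind_of hp, ind_of_not (by simp [hp]), mul_one, zero_add]
      refine le_trans (le_of_eq ?_) hR.marked
      rw [attachK, integral_map, markedMass]
      conv_lhs => rw [integral, tsum_flag]
      simp [hp, ind, integral]
    · rw [ind_of hp, ind_of_not hp, mul_zero, add_zero]
      exact integral_pmf_le_one _ fun r => mul_le_one' (ind_le_one _) (ind_le_one _)
  · intro m hm hf
    rw [failMass, ← integral_one, ← integral_const_mul, markedMass, zero_mul, add_zero,
      ← integral_const_mul, ← integral_add]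
    refine integral_mono fun p _ => ?_
    rw [attachK, failProb_map]
    by_cases hp : p.1 = none
    · rw [ind_of_not (by simp [hp]), mul_one, mul_zero, add_zero]
      refine le_trans (le_of_eq ?_) hR.fail
      refine integral_congr fun r _ => ?_
      simp [hp]
    · rw [ind_of hp, mul_one, mul_one]
      -- If the data already carry a fault, the ancilla must neither have failed nor be marked.
      refine le_trans ?_ (add_le_add hR.fail hR.marked)
      rw [markedMass, failProb]
      conv_lhs => rw [integral, tsum_flag, add_comm]
      conv_rhs => rw [integral, tsum_flag, integral]
      simp [hp, ind, Option.isSome_iff_ne_none]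
  · intro m hm hf
    rw [failMass, markedMass, integral_okPart, ← integral_add, markedMass, unmarkedMass,
      ← integral_const_mul, ← integral_add]
    refine integral_mono fun p _ => (hfail p).trans (le_of_eq ?_)
    ring

end Attach
end SteaneFT

namespace SteaneFT
open scoped ENNReal

/-! ### The Hamming code -/

section Bits

/-- The syndrome `s` determines the bits of minimum weight with this syndrome. -/
def bitsOf (s : Fin 3 → ZMod 2) (i : Fin 7) : ZMod 2 := if s = fun r => hamming r i then 1 else 0

theorem relBits_eq (x : Fin 7 → ZMod 2) : relBits x = bitsOf (syndrome x) := rfl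

theorem syndrome_add (x y : Fin 7 → ZMod 2) : syndrome (x + y) = syndrome x + syndrome y :=
  Matrix.mulVec_add _ _ _

/-- The string that has the entry `t` at the position `g`, if any. -/
def sing (g : Option (Fin 7)) (t : ZMod 2) (i : Fin 7) : ZMod 2 := if g = some i then t else 0

theorem bitsOf_syndrome_sing : ∀ g t, bitsOf (syndrome (sing g t)) = sing g t := by decide +kernel

theorem syndrome_bitsOf : ∀ s, syndrome (bitsOf s) = s := by decide +kernel

/-- The code is perfect: the seven columns of `hamming` are all the nonzero syndromes. -/
theorem exists_bitsOf_eq_sing : ∀ s, ∃ j, bitsOf s = sing (some j) 1 ∨ bitsOf s = 0 := by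
  decide +kernel

theorem syndrome_const : ∀ t : ZMod 2, syndrome (fun _ => t) = 0 := by decide +kernel

theorem two_eq_zero_zmod (t : ZMod 2) : t + t = 0 := CharTwo.add_self_eq_zero t

theorem sing_add (g : Option (Fin 7)) (t t' : ZMod 2) : sing g t + sing g t' = sing g (t + t') := by
  ext i; simp only [sing, Pi.add_apply]; split_ifs <;> simp

theorem decodeBits_eq (x : Fin 7 → ZMod 2) : decodeBits x = ∑ i, x i + ∑ i, relBits x i :=
  Finset.sum_add_distrib

/-- The relative state of a bit string vanishes outside of the position `g`. -/
def Near (g : Option (Fin 7)) (x : Fin 7 → ZMod 2) : Prop := ∀ i, g ≠ some i → relBits x i = 0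

theorem relBits_of_syndrome {g : Option (Fin 7)} {t : ZMod 2} {x : Fin 7 → ZMod 2}
    (h : syndrome x = syndrome (sing g t)) : relBits x = sing g t := by
  rw [relBits_eq, h, bitsOf_syndrome_sing]

/-- Expresses confinement to `g` by the syndrome, which is linear, whereas `relBits` is not. -/
theorem near_iff {g : Option (Fin 7)} {x : Fin 7 → ZMod 2} :
    Near g x ↔ ∃ t, syndrome x = syndrome (sing g t) := by
  constructor
  · intro h
    refine ⟨match g with | none => 0 | some j => relBits x j, ?_⟩
    rw [← syndrome_bitsOf (syndrome x), ← relBits_eq]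
    congr 1
    ext i
    rcases g with _ | j
    · simpa [sing] using h i
    · by_cases hij : j = i
      · simp [sing, hij]
      · simpa [sing, hij] using h i
  · rintro ⟨t, h⟩ i hi
    rw [relBits_of_syndrome h]
    simp [sing, hi]

theorem Near.of_none {x : Fin 7 → ZMod 2} (h : Near none x) (g : Option (Fin 7)) : Near g x :=
  fun i _ => h i (by simp)

theorem near_none_iff {x : Fin 7 → ZMod 2} : Near none x ↔ syndrome x = 0 := by
  have h0 : ∀ t, syndrome (sing none t) = 0 := by decide +kernel
  rw [near_iff]
  simp [h0]

/-- Minimum-weight decoding is not additive in general. It is additive when both errors are confined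
to the same position, because the two syndromes are then multiples of one column. Hence transverse
gates between blocks with a common mark act correctly on the decoded states. -/
theorem Near.add {g : Option (Fin 7)} {x y : Fin 7 → ZMod 2} (hx : Near g x) (hy : Near g y) :
    Near g (x + y) ∧ decodeBits (x + y) = decodeBits x + decodeBits y := by
  obtain ⟨t, hx⟩ := near_iff.1 hx
  obtain ⟨u, hy⟩ := near_iff.1 hy
  have h : syndrome (x + y) = syndrome (sing g (t + u)) := by
    rw [syndrome_add, hx, hy, ← syndrome_add, sing_add]
  refine ⟨near_iff.2 ⟨_, h⟩, ?_⟩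
  rw [decodeBits_eq, decodeBits_eq, decodeBits_eq, relBits_of_syndrome h, relBits_of_syndrome hx,
    relBits_of_syndrome hy, ← sing_add]
  simp only [Pi.add_apply, Finset.sum_add_distrib]
  ring

theorem near_sing (g : Option (Fin 7)) (t : ZMod 2) : Near g (sing g t) := near_iff.2 ⟨t, rfl⟩

theorem decodeBits_sing (g : Option (Fin 7)) (t : ZMod 2) : decodeBits (sing g t) = 0 := by
  rw [decodeBits_eq, relBits_of_syndrome rfl, two_eq_zero_zmod]

/-- Changing the entry at `g` adds a string supported at `g`, which decodes to zero. Whatever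
happens inside the marked subblock is therefore irrelevant to the state and to the other relative
states. -/
theorem Near.congr {g : Option (Fin 7)} {x y : Fin 7 → ZMod 2} (hx : Near g x)
    (h : ∀ i, g ≠ some i → y i = x i) : Near g y ∧ decodeBits y = decodeBits x := by
  obtain ⟨t, hy⟩ : ∃ t, y = x + sing g t := by
    rcases g with _ | j
    · exact ⟨0, by ext i; simpa [sing] using h i⟩
    · refine ⟨y j + x j, ?_⟩
      ext i
      by_cases hij : j = i
      · subst hij
        simp only [Pi.add_apply, sing, if_true]
        rw [add_comm (y j), ← add_assoc, two_eq_zero_zmod, zero_add]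
      · simpa [sing, hij] using h i
  have := hx.add (near_sing g t)
  rw [← hy, decodeBits_sing, add_zero] at this
  exact this

theorem near_add_relBits (x : Fin 7 → ZMod 2) :
    Near none (x + relBits x) ∧ decodeBits (x + relBits x) = decodeBits x := by
  have h : syndrome (x + relBits x) = 0 := by
    rw [syndrome_add, relBits_eq, syndrome_bitsOf]
    ext r
    exact two_eq_zero_zmod _
  refine ⟨near_none_iff.2 h, ?_⟩
  have h0 : relBits (x + relBits x) = 0 := by
    ext i; exact near_none_iff.2 h i (by simp)
  rw [decodeBits_eq (x + relBits x), h0]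
  simp [decodeBits]

theorem exists_near (x : Fin 7 → ZMod 2) : ∃ j, Near (some j) x := by
  obtain ⟨j, h | h⟩ := exists_bitsOf_eq_sing (syndrome x)
  · exact ⟨j, fun i hi => by rw [relBits_eq, h]; simp [sing, hi]⟩
  · exact ⟨j, fun i _ => by rw [relBits_eq, h]; rfl⟩

theorem relBits_add_of_near_none {x y : Fin 7 → ZMod 2} (hy : Near none y) :
    relBits (x + y) = relBits x := by
  rw [relBits_eq, relBits_eq, syndrome_add, near_none_iff.1 hy, add_zero]

/-- As the code is perfect, `x` is near some position, and a string with zero syndrome is near every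
position; `Near.add` applies to this common position. -/
theorem decodeBits_add_of_near_none {x y : Fin 7 → ZMod 2} (hy : Near none y) :
    decodeBits (x + y) = decodeBits x + decodeBits y := by
  obtain ⟨j, hx⟩ := exists_near x
  exact (hx.add (hy.of_none _)).2

theorem near_none_zero : Near none (0 : Fin 7 → ZMod 2) := by
  have := near_sing none 0
  rwa [show sing none 0 = 0 from rfl] at this

theorem decodeBits_zero : decodeBits (0 : Fin 7 → ZMod 2) = 0 := decodeBits_sing none 0

theorem near_none_const (t : ZMod 2) : Near none fun _ => t := near_none_iff.2 (syndrome_const t)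

theorem decodeBits_const : ∀ t : ZMod 2, decodeBits (fun _ => t) = t := by decide +kernel

/-- The relative state of seven subblocks vanishes outside of the position `g`. -/
def PNear (g : Option (Fin 7)) (s : Fin 7 → Pauli) : Prop :=
  Near g (fun i => (s i).1) ∧ Near g fun i => (s i).2

theorem pnear_iff {g : Option (Fin 7)} {s : Fin 7 → Pauli} :
    PNear g s ↔ ∀ i, g ≠ some i → relState s i = 0 := by
  simp only [PNear, Near, relState, Prod.ext_iff, ← forall_and]
  exact Iff.rfl

theorem PNear.congr {g : Option (Fin 7)} {s s' : Fin 7 → Pauli} (hs : PNear g s)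
    (h : ∀ i, g ≠ some i → s' i = s i) : PNear g s' ∧ decode s' = decode s := by
  have h1 := hs.1.congr (y := fun i => (s' i).1) fun i hi => by rw [h i hi]
  have h2 := hs.2.congr (y := fun i => (s' i).2) fun i hi => by rw [h i hi]
  exact ⟨⟨h1.1, h2.1⟩, Prod.ext h1.2 h2.2⟩

theorem PNear.of_none {s : Fin 7 → Pauli} (h : PNear none s) (g : Option (Fin 7)) : PNear g s :=
  ⟨h.1.of_none g, h.2.of_none g⟩

theorem pnear_zero : PNear none fun _ => (0 : Pauli) := ⟨near_none_zero, near_none_zero⟩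

theorem decode_zero : decode (fun _ => (0 : Pauli)) = 0 := Prod.ext decodeBits_zero decodeBits_zero

/-- The states after a CNOT gate. -/
def cnotState (c t : Pauli) : Pauli × Pauli := ((c.1, c.2 + t.2), (t.1 + c.1, t.2))

theorem PNear.cnot {g : Option (Fin 7)} {s t : Fin 7 → Pauli} (hs : PNear g s) (ht : PNear g t) :
    (PNear g (fun i => (cnotState (s i) (t i)).1) ∧
      PNear g fun i => (cnotState (s i) (t i)).2) ∧
    (decode (fun i => (cnotState (s i) (t i)).1), decode fun i => (cnotState (s i) (t i)).2) =
      cnotState (decode s) (decode t) :=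
  ⟨⟨⟨hs.1, (hs.2.add ht.2).1⟩, (ht.1.add hs.1).1, ht.2⟩,
    Prod.ext (Prod.ext rfl (hs.2.add ht.2).2) (Prod.ext (ht.1.add hs.1).2 rfl)⟩

end Bits

/-! ### Symmetries of blocks -/

section Symmetries

/-- Apply a map to every qubit. -/
def bmap (f : Pauli → Pauli) : (k : ℕ) → Blk k → Blk k
  | 0, b => f b
  | k + 1, b => fun i => bmap f k (b i)

/-- Apply a map to every qubit, and keep the marks. -/
def mmap (f : Pauli → Pauli) : (k : ℕ) → MBlk k → MBlk k
  | 0, B => f B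
  | k + 1, B => (B.1, fun i => mmap f k (B.2 i))

theorem applyAll_eq (P : Pauli) : ∀ k, applyAll P k = bmap (fun Q => (Q.1 + P.1, Q.2 + P.2)) k
  | 0 => rfl
  | k + 1 => by ext b; simp only [applyAll, bmap, applyAll_eq P k]; rfl

theorem hadamardAll_eq : ∀ k, hadamardAll k = bmap (fun Q => (Q.2, Q.1)) k
  | 0 => rfl
  | k + 1 => by ext b; simp only [hadamardAll, bmap, hadamardAll_eq k]; rfl

/-- The state of a marked block. -/
def mstate {k : ℕ} (B : MBlk k) : Pauli := state k B.errors

theorem errors_mmap (f : Pauli → Pauli) : ∀ (k : ℕ) (B : MBlk k),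
    (mmap f k B).errors = bmap f k B.errors
  | 0, _ => rfl
  | k + 1, B => funext fun i => errors_mmap f k (B.2 i)

/-- A block without marks. -/
def unmarked : {k : ℕ} → Blk k → MBlk k
  | 0, b => b
  | _ + 1, b => (none, fun i => unmarked (b i))

theorem errors_unmarked : ∀ {k : ℕ} (b : Blk k), (unmarked b).errors = b
  | 0, _ => rfl
  | _ + 1, b => funext fun i => errors_unmarked (b i)

instance (k : ℕ) : Nonempty (MBlk k) := ⟨unmarked (noError k)⟩

/-- An involution of the Pauli operators that is compatible with decoding. -/
structure IsSym (f : Pauli → Pauli) : Prop where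
  invol : ∀ P, f (f P) = P
  decode : ∀ s : Fin 7 → Pauli, decode (fun i => f (s i)) = f (decode s)
  pnear : ∀ g (s : Fin 7 → Pauli), PNear g s → PNear g fun i => f (s i)

theorem isSym_swap : IsSym fun Q => (Q.2, Q.1) :=
  ⟨fun _ => rfl, fun _ => rfl, fun _ _ h => ⟨h.2, h.1⟩⟩

theorem decodeBits_add_const (x : Fin 7 → ZMod 2) (t : ZMod 2) :
    decodeBits (fun i => x i + t) = decodeBits x + t := by
  have := decodeBits_add_of_near_none (x := x) (near_none_const t)
  rwa [decodeBits_const] at this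

theorem isSym_shift (P : Pauli) : IsSym fun Q => (Q.1 + P.1, Q.2 + P.2) := by
  refine ⟨fun Q => ?_, fun s => ?_, fun g s h => ⟨?_, ?_⟩⟩
  · simp [add_assoc, two_eq_zero_zmod]
  · simp only [SteaneFT.decode, decodeBits_add_const]
  · exact (h.1.add ((near_none_const P.1).of_none g)).1
  · exact (h.2.add ((near_none_const P.2).of_none g)).1

variable {f : Pauli → Pauli}

theorem IsSym.mmap_mmap (hf : IsSym f) : ∀ (k : ℕ) (B : MBlk k), mmap f k (mmap f k B) = B
  | 0, B => hf.invol B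
  | k + 1, B => Prod.ext rfl (funext fun i => hf.mmap_mmap k (B.2 i))

theorem IsSym.state_bmap (hf : IsSym f) : ∀ (k : ℕ) (b : Blk k),
    state k (bmap f k b) = f (state k b)
  | 0, _ => rfl
  | k + 1, b => by
    simp only [state, bmap, hf.state_bmap k]
    exact hf.decode _

theorem IsSym.mstate_mmap (hf : IsSym f) {k : ℕ} (B : MBlk k) :
    mstate (mmap f k B) = f (mstate B) := by
  rw [mstate, errors_mmap, hf.state_bmap]; rfl

/-- A symmetry, as a permutation of the marked blocks. -/
def IsSym.equiv (hf : IsSym f) (k : ℕ) : MBlk k ≃ MBlk k :=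
  ⟨mmap f k, mmap f k, hf.mmap_mmap k, hf.mmap_mmap k⟩

end Symmetries

/-! ### Closure properties of wellness -/

section Wellness

variable {k : ℕ} {b : ℕ → ℝ}

theorem tsum_ite_eq_integral {X : Type} (m : X → ℝ≥0∞) (p : X → Prop) [DecidablePred p] :
    (∑' x, if p x then m x else 0) = integral m fun x => ind (p x) := by
  refine tsum_congr fun x => ?_
  by_cases h : p x <;> simp [ind, h]

theorem controlled_iff {W : (MBlk k → ℝ≥0∞) → Prop} {m : MBlk (k + 1) → ℝ≥0∞} :
    Controlled W m ↔ (∀ B : MBlk (k + 1), m B ≠ 0 → PNear B.1 fun i => mstate (B.2 i)) ∧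
      ∀ (g : Option (Fin 7)) (v : Fin 7 → MBlk k) i, g ≠ some i →
        W fun c => m (g, Function.update v i c) := by
  simp only [Controlled, pnear_iff]
  exact and_congr Iff.rfl ⟨fun h g v i hi => h (g, v) i hi, fun h B i hi => h B.1 B.2 i hi⟩

theorem well_succ_iff {m : MBlk (k + 1) → ℝ≥0∞} :
    Well b (k + 1) m ↔ Controlled (Well b k) m ∧ ∀ s : Pauli,
      integral m (fun B => ind (mstate B = s ∧ B.1 ≠ none)) ≤
        ENNReal.ofReal (b (k + 1)) * integral m fun B => ind (mstate B = s) := by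
  classical
  simp only [← tsum_ite_eq_integral]
  rw [Well]
  simp only [mstate]
  refine and_congr Iff.rfl (forall_congr' fun s => ?_)
  refine iff_of_eq (congrArg₂ _ (tsum_congr fun B => ?_) (congrArg _ (tsum_congr fun B => ?_)))
  · congr
  · congr

theorem integral_mix {X ι : Type} (c : ι → ℝ≥0∞) (m : ι → X → ℝ≥0∞) (h : X → ℝ≥0∞) :
    integral (fun x => integral c fun i => m i x) h = integral c fun i => integral (m i) h := by
  simp only [integral, ← ENNReal.tsum_mul_left, ← ENNReal.tsum_mul_right]
  rw [ENNReal.tsum_comm]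
  exact tsum_congr fun x => tsum_congr fun y => by ring

theorem isCone_controlled {W : (MBlk k → ℝ≥0∞) → Prop} (hW : IsCone W) :
    IsCone (Controlled W) := by
  intro ι c m hm
  have hm := fun i hi => controlled_iff.1 (hm i hi)
  rw [controlled_iff]
  constructor
  · intro B hB
    obtain ⟨i, hi, hB⟩ := integral_ne_zero.1 hB
    exact (hm i hi).1 B hB
  · exact fun g v i hgi => hW c _ fun j hj => (hm j hj).2 g v i hgi

/-- Both requirements of `Well`, controlled subblocks and the inequality for each state, are
inherited by mixtures. For the inequality it is essential that it is homogeneous, that is, stated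
without normalisation. -/
theorem isCone_well : ∀ k, IsCone (Well b k)
  | 0 => fun _ _ _ _ => trivial
  | k + 1 => by
    intro ι c m hm
    have hm := fun i hi => well_succ_iff.1 (hm i hi)
    rw [well_succ_iff]
    refine ⟨isCone_controlled (isCone_well k) c m fun i hi => (hm i hi).1, fun s => ?_⟩
    rw [integral_mix, integral_mix, ← integral_const_mul]
    exact integral_mono fun i hi => (hm i hi).2 s

theorem mmap_update (f : Pauli → Pauli) (g : Option (Fin 7)) (v : Fin 7 → MBlk k) (i : Fin 7)
    (c : MBlk k) : mmap f (k + 1) (g, Function.update v i c) =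
      (g, Function.update (fun j => mmap f k (v j)) i (mmap f k c)) := by
  refine congrArg (Prod.mk g) (funext fun j => ?_)
  change mmap f k (Function.update v i c j) = _
  by_cases h : j = i
  · subst h; simp
  · simp [h]

theorem mstate_update (g : Option (Fin 7)) (v : Fin 7 → MBlk k) (i : Fin 7) (c : MBlk k) :
    mstate (k := k + 1) (g, Function.update v i c) =
      decode (Function.update (fun j => mstate (v j)) i (mstate c)) := by
  change decode (fun j => mstate (Function.update v i c j)) = _
  congr 1
  ext1 j
  by_cases h : j = i
  · subst h; simp
  · simp [h]

/-- With the other subblocks fixed, the state of the block is a function of the state of the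
remaining subblock, so the reweighting is again of the kind allowed by `hW`. -/
theorem Controlled.restrict {W : (MBlk k → ℝ≥0∞) → Prop}
    (hW : ∀ (m : MBlk k → ℝ≥0∞) (g : Pauli → ℝ≥0∞), W m → W fun B => g (mstate B) * m B)
    {m : MBlk (k + 1) → ℝ≥0∞} (hm : Controlled W m) (g : Pauli → ℝ≥0∞) :
    Controlled W fun B => g (mstate B) * m B := by
  rw [controlled_iff] at hm ⊢
  refine ⟨fun B hB => hm.1 B (right_ne_zero_of_mul hB), fun γ v i hi => ?_⟩
  simp only [mstate_update]
  exact hW _ (fun s => g (decode (Function.update (fun j => mstate (v j)) i s))) (hm.2 γ v i hi)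

/-- The bound on marks is imposed for every state separately, and the weight is constant on blocks
with a given state; it scales both sides of the inequality. -/
theorem Well.restrict : ∀ {k : ℕ} (m : MBlk k → ℝ≥0∞) (g : Pauli → ℝ≥0∞), Well b k m →
    Well b k fun B => g (mstate B) * m B
  | 0, _, _, _ => trivial
  | k + 1, m, g, hm => by
    rw [well_succ_iff] at hm ⊢
    refine ⟨hm.1.restrict Well.restrict g, fun s => ?_⟩
    have key : ∀ p : MBlk (k + 1) → Prop, (integral (fun B => g (mstate B) * m B) fun B =>
        ind (mstate B = s ∧ p B)) = g s * integral m fun B => ind (mstate B = s ∧ p B) := by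
      intro p
      rw [← integral_const_mul]
      refine tsum_congr fun B => ?_
      by_cases h : mstate B = s
      · simp only [h]; ring
      · simp [ind, h]
    have key' := key fun _ => True
    simp only [and_true] at key'
    rw [key, key', mul_left_comm]
    gcongr
    exact hm.2 s

/-- A symmetry fixes the marks and permutes the states, so the inequality for the state `s` becomes
the one for `f s`. -/
theorem Well.comp_mmap {f : Pauli → Pauli} (hf : IsSym f) : ∀ {k : ℕ} {m : MBlk k → ℝ≥0∞},
    Well b k m → Well b k fun B => m (mmap f k B)
  | 0, _, _ => trivial
  | k + 1, m, hm => by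
    rw [well_succ_iff, controlled_iff] at hm ⊢
    refine ⟨⟨fun B hB => ?_, fun g v i hi => ?_⟩, fun s => ?_⟩
    · have h1 := hf.pnear _ _ (hm.1.1 _ hB)
      have h2 : (fun i => f (mstate ((mmap f (k + 1) B).2 i))) =
          fun i => mstate (B.2 i) := by
        ext1 i
        change f (mstate (mmap f k (B.2 i))) = _
        rw [hf.mstate_mmap, hf.invol]
      rw [h2] at h1
      exact h1
    · have := Well.comp_mmap hf (hm.1.2 g (fun j => mmap f k (v j)) i hi)
      convert this using 2 with c
      exact congrArg m (mmap_update f g v i c)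
    · have key : ∀ h : MBlk (k + 1) → ℝ≥0∞,
          integral (fun B => m (mmap f (k + 1) B)) h =
            integral m fun B => h (mmap f (k + 1) B) := by
        intro h
        refine Eq.trans ?_ (integral_equiv (hf.equiv (k + 1)) m fun B => h (mmap f (k + 1) B))
        refine integral_congr fun B _ => ?_
        change h B = h (mmap f (k + 1) (mmap f (k + 1) B))
        rw [hf.mmap_mmap]
      rw [key, key]
      have h1 : ∀ B : MBlk (k + 1), mstate (mmap f (k + 1) B) = s ↔ mstate B = f s := by
        intro B
        rw [hf.mstate_mmap]
        exact ⟨fun h => by rw [← h, hf.invol], fun h => by rw [h, hf.invol]⟩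
      simp only [h1]
      exact hm.2 (f s)

/-- Wellness is preserved if a random Pauli operator is applied transversely and the distribution is
reweighted, both depending only on the state of the block and on other information. -/
theorem Well.pushforward {Ω I : Type} (e : I × MBlk k ≃ Ω) {m : Ω → ℝ≥0∞}
    (hm : ∀ i, Well b k fun c => m (e (i, c))) {φ : Ω → ℝ≥0∞} {φ' : I → Pauli → ℝ≥0∞}
    (hφ : ∀ i c, φ (e (i, c)) = φ' i (mstate c)) {y : Ω → MBlk k} {P : I → Pauli → Pauli}
    (hy : ∀ i c, y (e (i, c)) = mmap (fun Q => (Q.1 + (P i (mstate c)).1, Q.2 + (P i (mstate c)).2))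
      k c) :
    Well b k fun c => integral m fun ω => φ ω * ind (c = y ω) := by
  -- Disintegrate over the state. Once the other information `i` and the state are fixed, the Pauli
  -- operator and the weight are constants, and each piece is a restriction followed by a
  -- translation; the pieces are summed by the cone property.
  have h : Well b k fun c => integral (fun _ : I × Pauli => 1) fun z =>
      φ' z.1 z.2 * (fun c => (fun c => ind (mstate c = z.2) * m (e (z.1, c)))
        (mmap (fun Q => (Q.1 + (P z.1 z.2).1, Q.2 + (P z.1 z.2).2)) k c)) c := by
    refine isCone_well k _ _ fun z _ => IsCone.smul (isCone_well k) ?_ _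
    exact Well.comp_mmap (isSym_shift _) (Well.restrict _ (fun s => ind (s = z.2)) (hm z.1))
  convert h using 2 with c
  rw [← integral_equiv e, integral_prod, integral_prod]
  refine tsum_congr fun i => ?_
  simp only [integral, one_mul]
  have hpt : ∀ x : MBlk k, m (e (i, x)) * (φ (e (i, x)) * ind (c = y (e (i, x)))) =
      ∑' s, m (e (i, x)) * (φ' i s * (ind (mstate x = s) *
        ind (x = mmap (fun Q => (Q.1 + (P i s).1, Q.2 + (P i s).2)) k c))) := by
    intro x
    rw [tsum_eq_single (mstate x)]
    · rw [hφ, hy, ind_of rfl, one_mul]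
      congr 2
      generalize mstate x = s
      refine ind_congr ⟨fun h => ?_, fun h => ?_⟩
      · rw [h, (isSym_shift _).mmap_mmap]
      · rw [h, (isSym_shift _).mmap_mmap]
    · intro s hs
      simp [ind, hs.symm]
  simp only [hpt]
  rw [ENNReal.tsum_comm]
  refine tsum_congr fun s => ?_
  rw [tsum_eq_single (mmap (fun Q => (Q.1 + (P i s).1, Q.2 + (P i s).2)) k c)]
  · rw [ind_of rfl]; ring
  · intro x hx
    simp [ind, hx]

/-- A controlled distribution without marks is well. -/
theorem Controlled.well_of_unmarked {m : MBlk (k + 1) → ℝ≥0∞} (hm : Controlled (Well b k) m)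
    (h : ∀ B : MBlk (k + 1), m B ≠ 0 → B.1 = none) : Well b (k + 1) m := by
  rw [well_succ_iff]
  refine ⟨hm, fun s => ?_⟩
  have : (integral m fun B : MBlk (k + 1) => ind (mstate B = s ∧ B.1 ≠ none)) = 0 := by
    by_contra h0
    obtain ⟨B, hB, h1⟩ := integral_ne_zero.1 h0
    exact (ind_ne_zero.1 h1).2 (h B hB)
  rw [this]
  exact zero_le

end Wellness
end SteaneFT

namespace SteaneFT
open scoped ENNReal

/-! ### Flagged kernels that extend a given operation -/

section Lifts

variable {X Y Z X' Y' X₀ Y₀ Z₀ X₀' Y₀' Δ : Type}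

/-- The kernel `K` is an extension of the operation `op`. -/
def Lifts (eX : X → X₀) (eY : Y → Y₀) (op : X₀ → PMF Y₀) (K : X → PMF (Y × Bool)) : Prop :=
  ∀ x, (K x).map (fun r => eY r.1) = op (eX x)

/-- The operation `op` can be extended to a flagged kernel with guarantees. -/
def StepSim (eX : X → X₀) (eY : Y → Y₀) (op : X₀ → PMF Y₀) (W : (X → ℝ≥0∞) → Prop)
    (W' : (Y → ℝ≥0∞) → Prop) (rel : X → Y → Prop) (q : ℝ≥0∞) : Prop :=
  ∃ K : X → PMF (Y × Bool), Lifts eX eY op K ∧ Step W W' rel q K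

/-- The operation `op` can be extended to a fault-tolerant kernel. -/
def FTSim (eX : X → X₀) (eY : Y → Y₀) (op : X₀ → PMF Y₀) (W : (Option Δ × X → ℝ≥0∞) → Prop)
    (W' : (Option Δ × Y → ℝ≥0∞) → Prop) (rel : Option Δ × X → Option Δ × Y → Prop)
    (α e₁ e₂ es : ℝ≥0∞) : Prop :=
  ∃ K : Option Δ × X → PMF ((Option Δ × Y) × Bool),
    Lifts (fun p => eX p.2) (fun p => eY p.2) op K ∧ FT W W' rel α e₁ e₂ es K

/-- The distribution `p` can be extended to a source. -/
def SourceSim (eX : X → X₀) (p : PMF X₀) (W : (Option Δ × X → ℝ≥0∞) → Prop)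
    (Φ : Option Δ × X → Prop) (α a es : ℝ≥0∞) : Prop :=
  ∃ R : PMF ((Option Δ × X) × Bool), R.map (fun r => eX r.1.2) = p ∧ Source W Φ α a es R

/-- An extension of `op` without guarantees. -/
noncomputable def fallback (eX : X → X₀) {eY : Y → Y₀} (hY : Function.Surjective eY)
    (op : X₀ → PMF Y₀) (x : X) : PMF Y :=
  (op (eX x)).map (Function.surjInv hY)

theorem fallback_map (eX : X → X₀) {eY : Y → Y₀} (hY : Function.Surjective eY)
    (op : X₀ → PMF Y₀) (x : X) : (fallback eX hY op x).map eY = op (eX x) := by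
  rw [fallback, PMF.map_comp, show eY ∘ Function.surjInv hY = id from
    funext (Function.surjInv_eq hY), PMF.map_id]

/-- After a failure, `fallback` still performs the actual operation with an arbitrary choice of
marks, so the distribution of errors is exact for failed runs as well. -/
theorem Lifts.seqK {eX : X → X₀} {eY : Y → Y₀} {eZ : Z → Z₀} {op₁ : X₀ → PMF Y₀}
    {op₂ : Y₀ → PMF Z₀} {K₁ : X → PMF (Y × Bool)} {K₂ : Y → PMF (Z × Bool)}
    (h₁ : Lifts eX eY op₁ K₁) (h₂ : Lifts eY eZ op₂ K₂) (hZ : Function.Surjective eZ) :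
    Lifts eX eZ (fun x => (op₁ x).bind op₂) (seqK K₁ K₂ (fallback eY hZ op₂)) := by
  intro x
  change _ = (op₁ (eX x)).bind op₂
  rw [SteaneFT.seqK, PMF.map_bind, ← h₁ x, PMF.bind_map]
  congr 1
  ext1 r
  cases hr : r.2
  · have := fallback_map eY hZ op₂ r.1
    simp only [Function.comp_apply, Bool.false_eq_true, if_false, PMF.map_comp]
    exact this
  · exact h₂ r.1

theorem Lifts.const_true {eX : X → X₀} {eY : Y → Y₀} {op : X₀ → PMF Y₀} {K : X → PMF Y}
    (h : ∀ x, (K x).map eY = op (eX x)) :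
    Lifts eX eY op fun x => (K x).map fun y => (y, true) := by
  intro x
  rw [← h x, PMF.map_comp]
  rfl

theorem StepSim.mono {eX : X → X₀} {eY : Y → Y₀} {op : X₀ → PMF Y₀} {W V : (X → ℝ≥0∞) → Prop}
    {W' V' : (Y → ℝ≥0∞) → Prop} {rel rel' : X → Y → Prop} {q q' : ℝ≥0∞}
    (h : StepSim eX eY op W W' rel q) (hV : ∀ m, V m → W m) (hW : ∀ m, W' m → V' m)
    (hrel : ∀ x y, rel x y → rel' x y) (hq : q ≤ q') : StepSim eX eY op V V' rel' q' := by
  obtain ⟨K, hK, h⟩ := h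
  exact ⟨K, hK, h.mono hV hW hrel hq⟩

theorem StepSim.comp {eX : X → X₀} {eY : Y → Y₀} {eZ : Z → Z₀} {op₁ : X₀ → PMF Y₀}
    {op₂ : Y₀ → PMF Z₀} {W₁ : (X → ℝ≥0∞) → Prop} {W₂ : (Y → ℝ≥0∞) → Prop}
    {W₃ : (Z → ℝ≥0∞) → Prop} {r₁ : X → Y → Prop} {r₂ : Y → Z → Prop} {q₁ q₂ : ℝ≥0∞}
    (h₁ : StepSim eX eY op₁ W₁ W₂ r₁ q₁) (h₂ : StepSim eY eZ op₂ W₂ W₃ r₂ q₂)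
    (hZ : Function.Surjective eZ) :
    StepSim eX eZ (fun x => (op₁ x).bind op₂) W₁ W₃ (fun x z => ∃ y, r₁ x y ∧ r₂ y z) (q₁ + q₂) := by
  obtain ⟨K₁, l₁, h₁⟩ := h₁
  obtain ⟨K₂, l₂, h₂⟩ := h₂
  exact ⟨_, l₁.seqK l₂ hZ, h₁.comp h₂ _⟩

theorem FTSim.mono {eX : X → X₀} {eY : Y → Y₀} {op : X₀ → PMF Y₀}
    {W V : (Option Δ × X → ℝ≥0∞) → Prop} {W' V' : (Option Δ × Y → ℝ≥0∞) → Prop}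
    {rel rel' : Option Δ × X → Option Δ × Y → Prop} {α e₁ e₂ es : ℝ≥0∞}
    (h : FTSim eX eY op W W' rel α e₁ e₂ es) (hV : ∀ m, V m → W m) (hW : ∀ m, W' m → V' m)
    (hrel : ∀ x y, rel x y → rel' x y) : FTSim eX eY op V V' rel' α e₁ e₂ es := by
  obtain ⟨K, hK, h⟩ := h
  exact ⟨K, hK, h.mono hV hW hrel⟩

theorem surjective_comp_snd {eY : Y → Y₀} (hY : Function.Surjective eY) :
    Function.Surjective fun p : Option Δ × Y => eY p.2 := fun y => by
  obtain ⟨z, hz⟩ := hY y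
  exact ⟨(none, z), hz⟩

theorem FTSim.comp {eX : X → X₀} {eY : Y → Y₀} {eZ : Z → Z₀} {op₁ : X₀ → PMF Y₀}
    {op₂ : Y₀ → PMF Z₀} {W₁ : (Option Δ × X → ℝ≥0∞) → Prop} {W₂ : (Option Δ × Y → ℝ≥0∞) → Prop}
    {W₃ : (Option Δ × Z → ℝ≥0∞) → Prop} {r₁ : Option Δ × X → Option Δ × Y → Prop}
    {r₂ : Option Δ × Y → Option Δ × Z → Prop} {α e₁ e₂ es α' e₁' e₂' es' : ℝ≥0∞}
    (h₁ : FTSim eX eY op₁ W₁ W₂ r₁ α e₁ e₂ es)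
    (h₂ : FTSim eY eZ op₂ W₂ W₃ r₂ α' e₁' e₂' es') (hZ : Function.Surjective eZ) :
    FTSim eX eZ (fun x => (op₁ x).bind op₂) W₁ W₃ (fun p s => ∃ t, r₁ p t ∧ r₂ t s) (α + α')
      (e₁ + e₁') (e₂ + e₂' + e₁ * e₁') (es + es') := by
  obtain ⟨K₁, l₁, h₁⟩ := h₁
  obtain ⟨K₂, l₂, h₂⟩ := h₂
  exact ⟨_, l₁.seqK l₂ (surjective_comp_snd hZ), h₁.comp h₂ _⟩

theorem FTSim.strictOf {eX : X → X₀} {eY : Y → Y₀} {op : X₀ → PMF Y₀}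
    {W : (Option Δ × X → ℝ≥0∞) → Prop} {W' : (Option Δ × Y → ℝ≥0∞) → Prop}
    {rel : Option Δ × X → Option Δ × Y → Prop} {α e₁ e₂ es : ℝ≥0∞}
    (h : FTSim eX eY op W W' rel α e₁ e₂ es) {V : (X → ℝ≥0∞) → Prop} {V' : (Y → ℝ≥0∞) → Prop}
    (hV : ∀ (m : X → ℝ≥0∞) (m' : Option Δ × X → ℝ≥0∞), V m → (∀ x, m' (none, x) = m x) →
      (∀ γ x, m' (some γ, x) = 0) → W m')
    (hV' : ∀ m, W' m → V' fun y => m (none, y)) :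
    StepSim eX eY op V V' (fun x y => rel (none, x) (none, y)) es := by
  obtain ⟨K, l, h⟩ := h
  refine ⟨SteaneFT.strictOf K, fun x => ?_, h.strictOf (fun m hm => hV m _ hm (by simp) (by simp)) hV'⟩
  rw [SteaneFT.strictOf, PMF.map_comp]
  exact l (none, x)

theorem SourceSim.comp {eX : X → X₀} {eY : Y → Y₀} {p : PMF X₀} {op : X₀ → PMF Y₀}
    {W : (Option Δ × X → ℝ≥0∞) → Prop} {W' : (Option Δ × Y → ℝ≥0∞) → Prop}
    {Φ : Option Δ × X → Prop} {rel : Option Δ × X → Option Δ × Y → Prop}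
    {α a es α' e₁ e₂ es' : ℝ≥0∞} (hR : SourceSim eX p W Φ α a es)
    (hK : FTSim eX eY op W W' rel α' e₁ e₂ es') (hY : Function.Surjective eY) :
    SourceSim eY (p.bind op) W' (fun s => ∃ p, Φ p ∧ rel p s) (α + α' + e₂ + e₁ * a) (a + e₁)
      (es + es') := by
  obtain ⟨R, hR, h₁⟩ := hR
  obtain ⟨K, l, h₂⟩ := hK
  refine ⟨seqS R K (fallback (fun p : Option Δ × X => eX p.2) (surjective_comp_snd hY) op), ?_, h₁.comp h₂ _⟩
  have hl : Lifts (fun _ : Unit => ()) (fun p : Option Δ × X => eX p.2) (fun _ => p) fun _ => R :=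
    fun _ => hR
  exact hl.seqK l (surjective_comp_snd hY) ()

theorem SourceSim.mono {eX : X → X₀} {p : PMF X₀} {W W' : (Option Δ × X → ℝ≥0∞) → Prop}
    {Φ Φ' : Option Δ × X → Prop} {α a es α' a' es' : ℝ≥0∞} (h : SourceSim eX p W Φ α a es)
    (hW : ∀ m, W m → W' m) (hΦ : ∀ p, Φ p → Φ' p) (hα : α ≤ α') (ha : a ≤ a') (hes : es ≤ es') :
    SourceSim eX p W' Φ' α' a' es' := by
  obtain ⟨R, hR, h⟩ := h
  exact ⟨R, hR, h.mono hW hΦ hα ha hes⟩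

theorem bind_map_pair {A B A' B' : Type} (p : PMF A) (q : PMF B) (f : A → A') (g : B → B') :
    (p.bind fun a => q.map fun b => (f a, g b)) =
      (p.map f).bind fun a => (q.map g).map fun b => (a, b) := by
  rw [PMF.bind_map]
  congr 1
  ext1 a
  simp only [Function.comp_apply, PMF.map_comp]
  rfl

theorem StepSim.prod {eX : X → X₀} {eY : Y → Y₀} {eX' : X' → X₀'} {eY' : Y' → Y₀'}
    {op : X₀ → PMF Y₀} {op' : X₀' → PMF Y₀'} {W : (X → ℝ≥0∞) → Prop} {W' : (X' → ℝ≥0∞) → Prop}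
    {V : (Y → ℝ≥0∞) → Prop} {V' : (Y' → ℝ≥0∞) → Prop} {r₁ : X → Y → Prop} {r₂ : X' → Y' → Prop}
    {q₁ q₂ : ℝ≥0∞} (h₁ : StepSim eX eY op W V r₁ q₁) (h₂ : StepSim eX' eY' op' W' V' r₂ q₂)
    (hV : IsCone V) (hV' : IsCone V') :
    StepSim (fun p : X × X' => (eX p.1, eX' p.2)) (fun p : Y × Y' => (eY p.1, eY' p.2))
      (fun p => (op p.1).bind fun y => (op' p.2).map fun y' => (y, y')) (Both W W') (Both V V')
      (fun p s => r₁ p.1 s.1 ∧ r₂ p.2 s.2) (q₁ + q₂) := by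
  obtain ⟨K₁, l₁, h₁⟩ := h₁
  obtain ⟨K₂, l₂, h₂⟩ := h₂
  refine ⟨parK K₁ K₂, fun p => ?_, h₁.prod h₂ hV hV'⟩
  simp only [← l₁ p.1, ← l₂ p.2, parK, PMF.map_bind, PMF.map_comp]
  exact (bind_map_pair (K₁ p.1) (K₂ p.2) (fun r => eY r.1) fun r => eY' r.1).trans
    (by simp only [PMF.map_comp])

theorem StepSim.strict {n : ℕ} [Nonempty X] {eX : X → X₀} {eY : Y → Y₀} {op : Fin n → X₀ → PMF Y₀}
    {W : Fin n → (X → ℝ≥0∞) → Prop} {W' : Fin n → (Y → ℝ≥0∞) → Prop} {rel : Fin n → X → Y → Prop}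
    {q : ℝ≥0∞} (h : ∀ i, StepSim eX eY (op i) (W i) (W' i) (rel i) q)
    (hW' : ∀ i, IsCone (W' i)) :
    StepSim (fun v : Fin n → X => fun i => eX (v i)) (fun v : Fin n → Y => fun i => eY (v i))
      (fun v => transverse n fun i => op i (v i)) (Joint W) (Joint W')
      (fun v w => ∀ i, rel i (v i) (w i)) (n * q) := by
  choose K l h using h
  refine ⟨strictK K, fun v => ?_, Step.strict h hW'⟩
  rw [strictK, PMF.map_comp, transK]
  change (transverse n _).map (fun (z : Fin n → Y × Bool) i => eY (z i).1) = _
  refine (transverse_map n _ fun _ (r : Y × Bool) => eY r.1).trans (congrArg _ ?_)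
  ext1 i
  exact l i (v i)

theorem FTSim.transverse [Nonempty X] {eX : X → X₀} {eY : Y → Y₀} {op : Fin 7 → X₀ → PMF Y₀}
    (single : Fin 7 → Δ) {W : Option Δ → Fin 7 → (X → ℝ≥0∞) → Prop}
    {W' : Option Δ → Fin 7 → (Y → ℝ≥0∞) → Prop} {rel : Option Δ → Fin 7 → X → Y → Prop} {q : ℝ≥0∞}
    (h : ∀ γ i, StepSim eX eY (op i) (W γ i) (W' γ i) (rel γ i) q)
    (hW' : ∀ γ i, IsCone (W' γ i))
    (hs : ∀ j i m, (i ≠ j → W' none i m) → W' (some (single j)) i m) :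
    FTSim (fun v : Fin 7 → X => fun i => eX (v i)) (fun v : Fin 7 → Y => fun i => eY (v i))
      (fun v => transverse 7 fun i => op i (v i)) (StatusJoint W) (StatusJoint W')
      (statusRel single rel) 0 (7 * q) (21 * q ^ 2) (7 * q) := by
  choose K l h using h
  refine ⟨statusK single K, fun p => ?_, FT.transverse h hW' hs⟩
  rw [statusK, PMF.map_comp, transK]
  change (SteaneFT.transverse 7 _).map (fun (z : Fin 7 → Y × Bool) i => eY (z i).1) = _
  refine (transverse_map 7 _ fun _ (r : Y × Bool) => eY r.1).trans (congrArg _ ?_)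
  ext1 i
  exact l p.1 i (p.2 i)

theorem FTSim.attach {eX : X → X₀} {eX' : X' → X₀'} {p : PMF (Fin 7 → X₀')}
    {W : Option Δ → Fin 7 → (X → ℝ≥0∞) → Prop}
    {V : Option Δ → Fin 7 → (X' → ℝ≥0∞) → Prop} {Φ : Option Δ × (Fin 7 → X') → Prop}
    {α a es : ℝ≥0∞}
    (hR : SourceSim (fun v : Fin 7 → X' => fun i => eX' (v i)) p (StatusJoint V) Φ α a es)
    (hW : ∀ γ i, IsCone (W γ i)) (hV : ∀ γ i, IsCone (V γ i))
    (hW0 : ∀ γ i m, W none i m → W γ i m) (hV0 : ∀ γ i m, V none i m → V γ i m) :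
    FTSim (fun v : Fin 7 → X => fun i => eX (v i))
      (fun v : Fin 7 → X × X' => fun i => (eX (v i).1, eX' (v i).2))
      (fun d => p.map fun a i => (d i, a i)) (StatusJoint W)
      (StatusJoint fun γ i => Both (W γ i) (V γ i))
      (fun p s => (∃ γ, (p.1 = none ∨ γ = none) ∧ s.1 = p.1.or γ ∧ Φ (γ, fun i => (s.2 i).2)) ∧
        ∀ i, (s.2 i).1 = p.2 i)
      α a 0 es := by
  obtain ⟨R, hp, hR⟩ := hR
  refine ⟨attachK R, fun d => ?_, FT.attach hR hW hV hW0 hV0⟩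
  simp only [attachK, PMF.map_comp, ← hp]
  rfl

/-- A deterministic operation that does not change the status. -/
theorem FTSim.of_map {eX : X → X₀} {eY : Y → Y₀} {f : X → Y} {f₀ : X₀ → Y₀}
    {W : (Option Δ × X → ℝ≥0∞) → Prop} {W' : (Option Δ × Y → ℝ≥0∞) → Prop}
    (hf : ∀ x, eY (f x) = f₀ (eX x))
    (h : ∀ m, W m → W' fun s => integral (fun x => m (s.1, x)) fun x => ind (s.2 = f x)) :
    FTSim eX eY (fun x => PMF.pure (f₀ x)) W W' (fun p s => s = (p.1, f p.2)) 0 0 0 0 := by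
  have hK : ∀ (p : Option Δ × X) (s : Option Δ × Y),
      PMF.pure (((p.1, f p.2), true) : (Option Δ × Y) × Bool) (s, true) ≠ 0 → s = (p.1, f p.2) := by
    intro p s hs
    by_contra h
    simp [h] at hs
  have hfail : ∀ m : Option Δ × X → ℝ≥0∞, failMass m
      (fun p => PMF.pure (((p.1, f p.2), true) : (Option Δ × Y) × Bool)) = 0 := by
    intro m
    simp [failMass, failProb, integral_pure, ind]
    simp [integral]
  have hmarked : ∀ m : Option Δ × X → ℝ≥0∞, markedMass (okPart m
      fun p => PMF.pure (((p.1, f p.2), true) : (Option Δ × Y) × Bool)) = markedMass m := by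
    intro m
    rw [markedMass, integral_okPart]
    simp [integral_pure, ind_of]
    rfl
  refine ⟨fun p => PMF.pure ((p.1, f p.2), true), fun p => ?_, ?_, ?_, ?_, ?_, ?_, ?_⟩
  · rw [PMF.pure_map]
    exact congrArg PMF.pure (hf p.2)
  · intro p s hs _
    rw [hK p s hs]
  · intro m hm _
    convert h m hm using 2 with s
    rw [okPart, push, integral_prod, tsum_eq_single s.1]
    · refine integral_congr fun x _ => ?_
      rw [PMF.pure_apply, ind]
      congr 1
      simp [Prod.ext_iff]
    · intro γ hγ
      rw [integral, ENNReal.tsum_eq_zero]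
      intro x
      simp [Prod.ext_iff, hγ.symm]
  · intro m _ _ p s _ hs
    exact hK p s hs
  · intro m _ _; rw [hmarked]; simp
  · intro m _ _; rw [hfail]; simp
  · intro m _ _; rw [hmarked, hfail]; simp

end Lifts
end SteaneFT

namespace SteaneFT
open scoped ENNReal

/-! ### Extraction and correction of one kind of error -/

section Half

variable {k : ℕ} {b : ℕ → ℝ}

theorem errors_surjective (k : ℕ) : Function.Surjective (MBlk.errors : MBlk k → Blk k) :=
  fun x => ⟨unmarked x, errors_unmarked x⟩

/-- The errors of a pair of blocks. -/
def pairErrors (p : MBlk k × MBlk k) : Blk k × Blk k := (p.1.errors, p.2.errors)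

theorem pairErrors_surjective : Function.Surjective (pairErrors : MBlk k × MBlk k → _) :=
  fun x => ⟨(unmarked x.1, unmarked x.2), Prod.ext (errors_unmarked _) (errors_unmarked _)⟩

/-- The errors of seven blocks. -/
def cfgErrors (v : Fin 7 → MBlk k) : Blk (k + 1) := fun i => (v i).errors

theorem cfgErrors_surjective : Function.Surjective (cfgErrors : (Fin 7 → MBlk k) → _) :=
  fun x => ⟨fun i => unmarked (x i), funext fun _ => errors_unmarked _⟩

/-- The errors of seven pairs of blocks. -/
def pairsErrors (v : Fin 7 → MBlk k × MBlk k) : Fin 7 → Blk k × Blk k := fun i => pairErrors (v i)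

theorem pairsErrors_surjective : Function.Surjective (pairsErrors : (Fin 7 → MBlk k × MBlk k) → _) :=
  fun x => ⟨fun i => (unmarked (x i).1, unmarked (x i).2),
    funext fun _ => Prod.ext (errors_unmarked _) (errors_unmarked _)⟩

/-- Serves the marked subblock: the operation is carried out there, nothing is promised about its
output, and no failure is declared. -/
theorem StepSim.trivial {X Y X₀ Y₀ : Type} {eX : X → X₀} {eY : Y → Y₀}
    (hY : Function.Surjective eY) (op : X₀ → PMF Y₀) (q : ℝ≥0∞) :
    StepSim eX eY op (fun _ => True) (fun _ => True) (fun _ _ => True) q := by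
  refine ⟨_, Lifts.const_true (fallback_map eX hY op), fun _ _ _ => True.intro, fun m _ _ => ?_,
    fun _ _ _ _ _ _ _ => True.intro⟩
  have : failMass m (fun x => (fallback eX hY op x).map fun y => (y, true)) = 0 := by
    simp only [failMass, failProb_map]
    simp [ind, integral]
  rw [this]
  exact zero_le

/-- The set of positions of a possible mark. -/
def markSet (γ : Option (Fin 7)) : Set (Fin 7) := {i | γ = some i}

/-- Jointly well blocks, except for the marked one. -/
def WellOff (b : ℕ → ℝ) (k : ℕ) : (Option (Fin 7) × (Fin 7 → MBlk k) → ℝ≥0∞) → Prop :=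
  StatusJoint fun γ => Off (markSet γ) (Well b k)

/-- Jointly well pairs of blocks, except for the marked one. -/
def PairWellOff (b : ℕ → ℝ) (k : ℕ) : (Option (Fin 7) × (Fin 7 → MBlk k × MBlk k) → ℝ≥0∞) → Prop :=
  StatusJoint fun γ => Off (markSet γ) (Both (Well b k) (Well b k))

/-- Transverse CNOT gates; a pair with a marked block remains marked. -/
theorem FTSim.transverse_pairs {op : Fin 7 → Blk k × Blk k → PMF (Blk k × Blk k)}
    {rel : MBlk k × MBlk k → MBlk k × MBlk k → Prop} {C : ℝ≥0∞}
    (h : ∀ i, StepSim pairErrors pairErrors (op i) (Both (Well b k) (Well b k))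
      (Both (Well b k) (Well b k)) rel C) :
    FTSim pairsErrors pairsErrors (fun v => SteaneFT.transverse 7 fun i => op i (v i)) (PairWellOff b k)
      (PairWellOff b k) (fun p s => (p.1 = none ∨ s.1 = p.1) ∧
        ∀ i, s.1 ≠ some i → rel (p.2 i) (s.2 i)) 0 (7 * C) (21 * C ^ 2) (7 * C) := by
  have hcone : IsCone (Both (Well b k) (Well b k)) := (isCone_well k).both (isCone_well k)
  have h' : ∀ (γ : Option (Fin 7)) i, StepSim pairErrors pairErrors (op i)
      (Off (markSet γ) (Both (Well b k) (Well b k)) i)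
      (Off (markSet γ) (Both (Well b k) (Well b k)) i) (fun x y => i ∉ markSet γ → rel x y) C := by
    intro γ i
    by_cases hi : i ∈ markSet γ
    · exact (StepSim.trivial pairErrors_surjective (op i) C).mono (fun _ _ => True.intro)
        (fun _ _ h => absurd hi h) (fun _ _ _ h => absurd hi h) le_rfl
    · exact (h i).mono (fun _ hm => hm hi) (fun _ hm _ => hm) (fun _ _ h _ => h) le_rfl
  refine (FTSim.transverse (id : Fin 7 → Fin 7) h' (fun γ i => hcone.off _ i) ?_).mono
    (fun _ h => h) (fun _ h => h) ?_
  · intro j i m h hi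
    refine h ?_ (by simp [markSet])
    rintro rfl
    exact hi rfl
  · rintro p s (⟨h, h'⟩ | ⟨h0, j, h, h'⟩)
    · exact ⟨Or.inr h, fun i hi => h' i fun hi' => hi (h.trans hi')⟩
    · exact ⟨Or.inl h0, fun i hi => h' i (fun hij => hi (by rw [h, hij]; rfl)) (by simp [markSet])⟩

/-- The X component (`σ = false`) or the Z component (`σ = true`) of a Pauli operator. -/
def component (σ : Bool) (P : Pauli) : ZMod 2 := if σ then P.2 else P.1

/-- The Pauli operator with the given X component (`σ = false`) or Z component (`σ = true`). -/
def singlePauli (σ : Bool) (t : ZMod 2) : Pauli := if σ then (0, t) else (t, 0)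

theorem component_add_singlePauli (σ : Bool) (P : Pauli) (t : ZMod 2) :
    component σ (P.1 + (singlePauli σ t).1, P.2 + (singlePauli σ t).2) = component σ P + t ∧
      component (!σ) (P.1 + (singlePauli σ t).1, P.2 + (singlePauli σ t).2) = component (!σ) P := by
  cases σ <;> simp [component, singlePauli]

theorem pnear_iff_component {g : Option (Fin 7)} {s : Fin 7 → Pauli} :
    PNear g s ↔ ∀ σ, Near g fun i => component σ (s i) := by
  simp [PNear, Bool.forall_bool, component]

theorem component_decode (σ : Bool) (s : Fin 7 → Pauli) :
    component σ (decode s) = decodeBits fun i => component σ (s i) := by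
  cases σ <;> rfl

theorem forall_bool_of {p : Bool → Prop} (σ : Bool) (h : p σ) (h' : p (!σ)) (τ : Bool) : p τ := by
  cases σ <;> cases τ <;> assumption

theorem pauli_ext {P Q : Pauli} (h : ∀ σ, component σ P = component σ Q) : P = Q :=
  Prod.ext (h false) (h true)

/-- Syndrome extraction by an interaction of a block with an ancilla, and correction. -/
noncomputable def halfOp (σ : Bool) (anc : PMF (Blk (k + 1)))
    (op : Fin 7 → Blk k × Blk k → PMF (Blk k × Blk k)) (d : Blk (k + 1)) : PMF (Blk (k + 1)) :=
  ((anc.map fun a i => (d i, a i)).bind fun v => transverse 7 fun i => op i (v i)).bind fun r =>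
    PMF.pure fun i => applyAll (singlePauli σ (relBits (fun j => component σ (state k (r j).2)) i)) k (r i).1

/-- The action on the states of the interaction of a data block with an ancilla, which copies the
`σ`-component of the data to the ancilla. -/
def copyRel (σ : Bool) (p p' : MBlk k × MBlk k) : Prop :=
  component σ (mstate p'.1) = component σ (mstate p.1) ∧
  component (!σ) (mstate p'.1) = component (!σ) (mstate p.1) + component (!σ) (mstate p.2) ∧
  component σ (mstate p'.2) = component σ (mstate p.2) + component σ (mstate p.1)

/-- The states of the seven blocks. -/
def states (v : Fin 7 → MBlk k) : Fin 7 → Pauli := fun i => mstate (v i)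

/-- The action of `halfOp` on the states outside of the mark. -/
def halfRel (σ : Bool) (p s : Option (Fin 7) × (Fin 7 → MBlk k)) : Prop :=
  (p.1 = none ∨ s.1 = p.1) ∧ ∃ (y : Fin 7 → Pauli) (z : Fin 7 → ZMod 2),
    PNear s.1 y ∧ decode y = 0 ∧ ∀ i, s.1 ≠ some i →
      z i = component σ (y i) + component σ (states p.2 i) ∧
      component σ (states s.2 i) = component σ (states p.2 i) + relBits z i ∧
      component (!σ) (states s.2 i) = component (!σ) (states p.2 i) + component (!σ) (y i)

/-- The correction of the data blocks, depending on the states of the ancilla blocks. -/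
def fixData (σ : Bool) (v : Fin 7 → MBlk k × MBlk k) (i : Fin 7) : MBlk k :=
  mmap (fun Q => (Q.1 + (singlePauli σ (relBits (fun j => component σ (mstate (v j).2)) i)).1,
    Q.2 + (singlePauli σ (relBits (fun j => component σ (mstate (v j).2)) i)).2)) k (v i).1

theorem component_mstate_fixData (σ : Bool) (v : Fin 7 → MBlk k × MBlk k) (i : Fin 7) :
    component σ (mstate (fixData σ v i)) =
      component σ (mstate (v i).1) + relBits (fun j => component σ (mstate (v j).2)) i ∧
    component (!σ) (mstate (fixData σ v i)) = component (!σ) (mstate (v i).1) := by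
  rw [fixData, (isSym_shift _).mstate_mmap]
  exact component_add_singlePauli _ _ _

/-- Wellness of a data block is preserved if Pauli operators are applied transversely to the data
blocks and the distribution is reweighted, if the Pauli operators and the weights depend on this
block only through its state, and the ancilla blocks are discarded. -/
theorem well_pushforward_pairs {m : (Fin 7 → MBlk k × MBlk k) → ℝ≥0∞} {i : Fin 7}
    (hm : ∀ v, Both (Well b k) (Well b k) fun x => m (Function.update v i x)) (w : Fin 7 → MBlk k)
    {φ : (Fin 7 → MBlk k × MBlk k) → ℝ≥0∞} {P : (Fin 7 → MBlk k × MBlk k) → Fin 7 → Pauli}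
    (hP : ∀ v c c' x, mstate c = mstate c' →
      φ (Function.update v i (c, x)) = φ (Function.update v i (c', x)) ∧
        P (Function.update v i (c, x)) = P (Function.update v i (c', x))) :
    Well b k fun c => integral m fun v => φ v * ind (Function.update w i c =
      fun j => mmap (fun Q => (Q.1 + (P v j).1, Q.2 + (P v j).2)) k (v j).1) := by
  classical
  let e : ((({j // j ≠ i} → MBlk k × MBlk k) × MBlk k) × MBlk k) ≃ (Fin 7 → MBlk k × MBlk k) :=
    { toFun := fun p => Function.update (extend i p.1.1) i (p.2, p.1.2)
      invFun := fun v => ((fun j => v j, (v i).2), (v i).1)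
      left_inv := fun p => by
        refine Prod.ext (Prod.ext (funext fun j => ?_) ?_) ?_
        · simp [extend, j.2]
        · simp
        · simp
      right_inv := fun v => by
        ext1 j
        by_cases h : j = i
        · subst h; simp
        · simp [extend, h] }
  have he : ∀ p c, e (p, c) = Function.update (extend i p.1) i (c, p.2) := fun p c => rfl
  -- A representative block for each state, which turns functions that see a block only through its
  -- state into functions of the state.
  let pick : Pauli → MBlk k := fun s =>
    if h : ∃ c : MBlk k, mstate c = s then h.choose else unmarked (noError k)
  have hpick : ∀ c : MBlk k, mstate (pick (mstate c)) = mstate c := by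
    intro c
    have h : ∃ c' : MBlk k, mstate c' = mstate c := ⟨c, rfl⟩
    simp only [pick, dif_pos h]
    exact h.choose_spec
  have hdep : ∀ p c, φ (e (p, c)) = φ (e (p, pick (mstate c))) ∧
      P (e (p, c)) = P (e (p, pick (mstate c))) := fun p c => hP _ _ _ _ (hpick c).symm
  have hother : ∀ p c c' j, j ≠ i → e (p, c) j = e (p, c') j := by
    intro p c c' j hj
    simp [he, hj]
  have := Well.pushforward (b := b) e (m := m) (fun p => (hm (extend i p.1)).1 p.2)
    (φ := fun v => φ v * ind (∀ j, j ≠ i →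
      w j = mmap (fun Q => (Q.1 + (P v j).1, Q.2 + (P v j).2)) k (v j).1))
    (φ' := fun p s => φ (e (p, pick s)) * ind (∀ j, j ≠ i →
      w j = mmap (fun Q => (Q.1 + (P (e (p, pick s)) j).1, Q.2 + (P (e (p, pick s)) j).2)) k
        (e (p, pick s) j).1))
    (fun p c => by
      rw [(hdep p c).1, (hdep p c).2]
      congr 1
      refine ind_congr (forall_congr' fun j => forall_congr' fun hj => ?_)
      rw [hother p c (pick (mstate c)) j hj])
    (y := fun v => mmap (fun Q => (Q.1 + (P v i).1, Q.2 + (P v i).2)) k (v i).1)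
    (P := fun p s => P (e (p, pick s)) i)
    (fun p c => by rw [(hdep p c).2]; simp [he])
  convert this using 2 with c
  refine integral_congr fun v _ => ?_
  rw [mul_assoc, ← ind_and]
  congr 1
  refine ind_congr ?_
  rw [funext_iff]
  constructor
  · intro h
    exact ⟨fun j hj => by simpa [hj] using h j, by simpa using h i⟩
  · rintro ⟨h1, h2⟩ j
    by_cases hj : j = i
    · subst hj; simpa using h2
    · simpa [hj] using h1 j hj

/-- The Pauli operators are computed from the ancilla blocks alone; conditionally on these they are
constants. -/
theorem well_fixData (σ : Bool) {m : (Fin 7 → MBlk k × MBlk k) → ℝ≥0∞} {i : Fin 7}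
    (hm : ∀ v, Both (Well b k) (Well b k) fun x => m (Function.update v i x)) (w : Fin 7 → MBlk k) :
    Well b k fun c => integral m fun v => ind (Function.update w i c = fixData σ v) := by
  have := well_pushforward_pairs hm w (φ := fun _ => 1)
    (P := fun v i => singlePauli σ (relBits (fun j => component σ (mstate (v j).2)) i)) ?_
  · simp only [one_mul] at this
    exact this
  · intro v c c' x _
    refine ⟨rfl, ?_⟩
    have : ∀ c : MBlk k, (fun j => component σ (mstate (Function.update v i (c, x) j).2)) =
        fun j => component σ (mstate (Function.update (fun j => (v j).2) i x j)) := by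
      intro c
      ext1 j
      by_cases h : j = i
      · subst h; simp
      · simp [h]
    simp only [this]

/-- Attach the ancilla, interact transversely, and correct deterministically. The last stage is free
of faults, so the bounds come from the first two: the second-order term consists of two faulty
interactions, or of a marked ancilla and a faulty interaction. -/
theorem FTSim.half (σ : Bool) {anc : PMF (Blk (k + 1))}
    {op : Fin 7 → Blk k × Blk k → PMF (Blk k × Blk k)} {A a es C : ℝ≥0∞}
    (hanc : SourceSim cfgErrors anc (WellOff b k)
      (fun p => PNear p.1 (states p.2) ∧ decode (states p.2) = 0) A a es)
    (hop : ∀ i, StepSim pairErrors pairErrors (op i) (Both (Well b k) (Well b k))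
      (Both (Well b k) (Well b k)) (copyRel σ) C) :
    FTSim cfgErrors cfgErrors (halfOp σ anc op) (WellOff b k) (WellOff b k) (halfRel σ)
      A (a + 7 * C) (21 * C ^ 2 + a * (7 * C)) (es + 7 * C) := by
  have hW : ∀ (γ : Option (Fin 7)) i, IsCone (Off (markSet γ) (Well b k) i) := fun γ i =>
    (isCone_well k).off _ i
  have hW0 : ∀ (γ : Option (Fin 7)) i m, Off (markSet none) (Well b k) i m →
      Off (markSet γ) (Well b k) i m := fun γ i m h _ => h (by simp [markSet])
  have h1 := (FTSim.attach (X := MBlk k) (eX := MBlk.errors) (eX' := MBlk.errors) hanc hW hW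
    hW0 hW0).mono (V := WellOff b k) (V' := PairWellOff b k) (fun _ h => h)
    (fun m h γ i v hi => ⟨fun x' => (h γ i v).1 x' hi, fun x => (h γ i v).2 x hi⟩) (fun _ _ h => h)
  have h2 := FTSim.transverse_pairs hop
  have h3 : FTSim (Δ := Fin 7) pairsErrors cfgErrors (fun r => PMF.pure fun i =>
      applyAll (singlePauli σ (relBits (fun j => component σ (state k (r j).2)) i)) k (r i).1)
      (PairWellOff b k) (WellOff b k) (fun p s => s = (p.1, fixData σ p.2)) 0 0 0 0 := by
    refine FTSim.of_map (f₀ := fun (r : Fin 7 → Blk k × Blk k) i =>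
      applyAll (singlePauli σ (relBits (fun j => component σ (state k (r j).2)) i)) k (r i).1)
      (fun v => funext fun i => ?_) fun m hm γ i w hi => well_fixData (m := fun v => m (γ, v)) σ (fun v => hm γ i v hi) w
    rw [applyAll_eq]
    exact errors_mmap _ _ _
  have h := (h1.comp h2 pairsErrors_surjective).comp h3 cfgErrors_surjective
  simp only [add_zero, zero_add, mul_zero] at h
  refine h.mono (fun _ h => h) (fun _ h => h) ?_
  rintro ⟨γ, d⟩ ⟨γ', d'⟩ ⟨⟨γ'', v'⟩, ⟨⟨γ₁, v⟩, ⟨⟨γ₂, hγ, rfl, hy, hy0⟩, hd⟩, hγ', hrel⟩, hs⟩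
  dsimp only at *
  rw [Prod.ext_iff] at hs
  obtain ⟨h₁, h₂⟩ := hs
  dsimp only at h₁ h₂
  subst h₁ h₂
  -- The witnesses are the states of the ancilla before the interaction and its measured component
  -- afterwards.
  refine ⟨?_, states fun i => (v i).2, fun j => component σ (mstate (v' j).2), ?_, hy0, fun i hi => ?_⟩
  · rcases hγ with h | h
    · exact Or.inl h
    · subst h
      simpa using hγ'
  · rcases hγ' with h' | h'
    · rw [Option.or_eq_none_iff] at h'
      rw [h'.2] at hy
      exact hy.of_none _
    · rw [h']
      rcases hγ with h | h
      · simpa [h] using hy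
      · rw [h] at hy
        exact hy.of_none _
  · obtain ⟨h1, h2, h3⟩ := hrel i hi
    rw [hd i] at h1 h2 h3
    obtain ⟨h4, h5⟩ := component_mstate_fixData σ v' i
    exact ⟨h3, by rw [states, h4, h1]; rfl, by rw [states, h5, h2]; rfl⟩

/-- If the data errors are confined to the final mark, so is the measured syndrome, and the
correction touches at most the marked subblock. The ancilla feeds back only errors that are confined
to the mark and decode to zero. -/
theorem halfRel.state {σ : Bool} {p s : Option (Fin 7) × (Fin 7 → MBlk k)} (h : halfRel σ p s)
    (hp : PNear p.1 (states p.2)) :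
    PNear s.1 (states s.2) ∧ decode (states s.2) = decode (states p.2) := by
  obtain ⟨h0, y, z, hy, hy0, h⟩ := h
  have hp : PNear s.1 (states p.2) := by
    rcases h0 with h0 | h0
    · rw [h0] at hp; exact hp.of_none _
    · rwa [h0]
  rw [pnear_iff_component] at hp hy
  have hz : Near s.1 z := (((hy σ).add (hp σ)).1.congr fun i hi => (h i hi).1).1
  have h1 := (hp σ).congr (y := fun i => component σ (states s.2 i)) fun i hi => by
    rw [(h i hi).2.1, hz i hi, add_zero]
  have h2 := ((hp !σ).add (hy !σ)).1.congr (y := fun i => component (!σ) (states s.2 i)) fun i hi =>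
    (h i hi).2.2
  have h3 := ((hp !σ).add (hy !σ)).2
  rw [← component_decode (!σ) y, hy0] at h3
  rw [pnear_iff_component]
  refine ⟨forall_bool_of σ h1.1 h2.1, pauli_ext (forall_bool_of σ ?_ ?_)⟩
  · rw [component_decode, component_decode]; exact h1.2
  · rw [component_decode, component_decode, h2.2, h3]
    cases σ <;> simp [component]

/-- Without faults the measured string is the `σ`-component of the data plus a codeword, so the
relative error of even an arbitrary input is found exactly and removed. The other component receives
only a codeword that decodes to zero. -/
theorem halfRel.state_none {σ : Bool} {d d' : Fin 7 → MBlk k} (h : halfRel σ (none, d) (none, d')) :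
    decode (states d') = decode (states d) ∧ Near none (fun i => component σ (states d' i)) ∧
      (Near none (fun i => component (!σ) (states d i)) →
        Near none fun i => component (!σ) (states d' i)) := by
  obtain ⟨-, y, z, hy, hy0, h⟩ := h
  replace h := fun i => h i (by simp)
  rw [pnear_iff_component] at hy
  have hz : z = (fun i => component σ (states d i)) + fun i => component σ (y i) :=
    funext fun i => by rw [(h i).1]; exact add_comm _ _
  have h1 : (fun i => component σ (states d' i)) =
      (fun i => component σ (states d i)) + relBits fun i => component σ (states d i) := by
    ext1 i
    rw [(h i).2.1, hz, relBits_add_of_near_none (hy σ)]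
    rfl
  have h2 : (fun i => component (!σ) (states d' i)) =
      (fun i => component (!σ) (states d i)) + fun i => component (!σ) (y i) := funext fun i => (h i).2.2
  have h3 : decodeBits (fun i => component (!σ) (y i)) = 0 := by
    rw [← component_decode, hy0]
    cases σ <;> simp [component]
  refine ⟨pauli_ext (forall_bool_of σ ?_ ?_), ?_, fun hd => ?_⟩
  · rw [component_decode, component_decode, h1]
    exact (near_add_relBits _).2
  · rw [component_decode, component_decode, h2, decodeBits_add_of_near_none (hy _), h3, add_zero]
  · rw [h1]; exact (near_add_relBits _).1
  · rw [h2]; exact (hd.add (hy _)).1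

end Half
end SteaneFT

namespace SteaneFT
open scoped ENNReal

/-! ### One round of error correction -/

section Generic

variable {I X Y X₀ Y₀ Δ : Type}

theorem IsCone.zero {W : (X → ℝ≥0∞) → Prop} (hW : IsCone W) : W fun _ => 0 := by
  have := hW (fun _ : Empty => 0) (fun _ _ => 0) fun i => i.elim
  simpa [integral] using this

theorem IsCone.tsum {W : (X → ℝ≥0∞) → Prop} (hW : IsCone W) {m : I → X → ℝ≥0∞}
    (hm : ∀ i, W (m i)) : W fun x => ∑' i, m i x := by
  have := hW (fun _ => 1) m fun i _ => hm i
  simpa [integral] using this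

theorem okPart_branch (m : I × X → ℝ≥0∞) (K : I → X → PMF (Y × Bool)) :
    okPart m (fun p => K p.1 p.2) = fun y => ∑' i, okPart (fun x => m (i, x)) (K i) y := by
  ext y
  exact integral_prod _ _

theorem failMass_branch (m : I × X → ℝ≥0∞) (K : I → X → PMF (Y × Bool)) :
    failMass m (fun p => K p.1 p.2) = ∑' i, failMass (fun x => m (i, x)) (K i) :=
  integral_prod _ _

theorem mass_slice_ne_top {m : I × X → ℝ≥0∞} (hf : mass m ≠ ⊤) (i : I) :
    mass (fun x => m (i, x)) ≠ ⊤ :=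
  mass_comp_ne_top (Prod.mk_right_injective i) hf

/-- A kernel that depends on a classical variable. -/
theorem Step.branch {W : I → (X → ℝ≥0∞) → Prop} {W' : (Y → ℝ≥0∞) → Prop} {rel : I → X → Y → Prop}
    {q : ℝ≥0∞} {K : I → X → PMF (Y × Bool)} (h : ∀ i, Step (W i) W' (rel i) q (K i))
    (hW' : IsCone W') :
    Step (fun m : I × X → ℝ≥0∞ => ∀ i, W i fun x => m (i, x)) W' (fun p => rel p.1 p.2) q
      fun p => K p.1 p.2 where
  ok m hm hf := by
    rw [okPart_branch]
    exact hW'.tsum fun i => (h i).ok _ (hm i) (mass_slice_ne_top hf i)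
  fail m hm hf := by
    rw [failMass_branch, mass_prod, ← ENNReal.tsum_mul_left]
    exact ENNReal.tsum_le_tsum fun i => (h i).fail _ (hm i) (mass_slice_ne_top hf i)
  supp m hm hf p y hx hy := (h p.1).supp _ (hm p.1) (mass_slice_ne_top hf p.1) p.2 y hx hy

theorem StepSim.branch {eX : X → X₀} {eY : Y → Y₀} {op : X₀ → PMF Y₀}
    {W : I → (X → ℝ≥0∞) → Prop} {W' : (Y → ℝ≥0∞) → Prop} {rel : I → X → Y → Prop} {q : ℝ≥0∞}
    (h : ∀ i, StepSim eX eY op (W i) W' (rel i) q) (hW' : IsCone W') :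
    StepSim (fun p : I × X => eX p.2) eY op (fun m => ∀ i, W i fun x => m (i, x)) W'
      (fun p => rel p.1 p.2) q := by
  choose K l h using h
  exact ⟨fun p => K p.1 p.2, fun p => l p.1 p.2, Step.branch h hW'⟩

theorem StepSim.withSupport {eX : X → X₀} {eY : Y → Y₀} {op : X₀ → PMF Y₀}
    {W : (X → ℝ≥0∞) → Prop} {W' : (Y → ℝ≥0∞) → Prop} {rel : X → Y → Prop} {q : ℝ≥0∞}
    (h : StepSim eX eY op W W' rel q) :
    StepSim eX eY op W (fun m => W' m ∧ ∀ y, m y ≠ 0 → ∃ x, rel x y) rel q := by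
  obtain ⟨K, l, h⟩ := h
  refine ⟨K, l, fun m hm hf => ⟨h.ok m hm hf, fun y hy => ?_⟩, h.fail, h.supp⟩
  obtain ⟨x, hx, hy⟩ := okPart_ne_zero.1 hy
  exact ⟨x, h.supp m hm hf x y hx hy⟩

theorem StepSim.embed {eX : X → X₀} {eY : Y → Y₀} {op : X₀ → PMF Y₀}
    {W : (X → ℝ≥0∞) → Prop} {W' : (Y → ℝ≥0∞) → Prop} {rel : X → Y → Prop} {q : ℝ≥0∞}
    (h : StepSim eX eY op W W' rel q) {V' : (Option Δ × Y → ℝ≥0∞) → Prop}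
    (hV' : ∀ (m : Y → ℝ≥0∞) (m' : Option Δ × Y → ℝ≥0∞), W' m → (∀ y, m' (none, y) = m y) →
      (∀ γ y, m' (some γ, y) = 0) → V' m') :
    StepSim eX (fun p : Option Δ × Y => eY p.2) op W V' (fun x s => s.1 = none ∧ rel x s.2) q := by
  obtain ⟨K, l, h⟩ := h
  have hK : ∀ x (s : Option Δ × Y), (K x).map (fun r => ((none, r.1), r.2)) (s, true) ≠ 0 →
      s.1 = none ∧ K x (s.2, true) ≠ 0 := by
    rintro x ⟨g, w⟩ hB
    rw [map_apply_eq_integral] at hB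
    obtain ⟨⟨w', f⟩, h1, h2⟩ := integral_ne_zero.1 hB
    simp only [ind_ne_zero, Prod.mk.injEq] at h2
    obtain ⟨⟨rfl, rfl⟩, rfl⟩ := h2
    exact ⟨rfl, h1⟩
  refine ⟨fun x => (K x).map fun r => ((none, r.1), r.2), fun x => ?_,
    fun m hm hf => hV' _ _ (h.ok m hm hf) (fun w => ?_) (fun γ w => ?_), fun m hm hf => ?_,
    fun m hm hf x s hx hs => ?_⟩
  · rw [← l x, PMF.map_comp]
    rfl
  · rw [okPart_map, okPart, apply_eq_integral (push m K)]
    refine integral_congr fun r _ => ind_congr ?_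
    simp [Prod.ext_iff]
  · by_contra hB
    obtain ⟨x, hx, hB⟩ := okPart_ne_zero.1 hB
    exact absurd (hK x _ hB).1 (by simp)
  · refine le_trans (le_of_eq ?_) (h.fail m hm hf)
    exact integral_congr fun v _ => failProb_map _ _
  · obtain ⟨h1, h2⟩ := hK x s hs
    exact ⟨h1, h.supp m hm hf x s.2 hx h2⟩

/-- A flagged kernel whose output carries a new mark with probability at most `r`. -/
structure MarkStep (W : (X → ℝ≥0∞) → Prop) (W' : (Option Δ × Y → ℝ≥0∞) → Prop)
    (rel : X → Option Δ × Y → Prop) (q r : ℝ≥0∞) (K : X → PMF ((Option Δ × Y) × Bool)) : Prop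
    extends Step W W' rel q K where
  marked : ∀ m, W m → mass m ≠ ⊤ → markedMass (okPart m K) ≤ r * mass m

open Classical in
theorem FT.onUnmarked {W : (Option Δ × X → ℝ≥0∞) → Prop} {W' : (Option Δ × Y → ℝ≥0∞) → Prop}
    {rel : Option Δ × X → Option Δ × Y → Prop} {α e₁ e₂ es : ℝ≥0∞}
    {K : Option Δ × X → PMF ((Option Δ × Y) × Bool)} (h : FT W W' rel α e₁ e₂ es K)
    {V : (X → ℝ≥0∞) → Prop} (hV : ∀ m, V m → W fun p => if p.1 = none then m p.2 else 0) :
    MarkStep V W' (fun x => rel (none, x)) (α + e₂) e₁ fun x => K (none, x) := by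
  have hint : ∀ (m : X → ℝ≥0∞) (g : Option Δ × X → ℝ≥0∞),
      integral (fun p : Option Δ × X => if p.1 = none then m p.2 else 0) g =
        integral m fun x => g (none, x) := by
    intro m g
    rw [integral_prod, tsum_eq_single none]
    · simp
    · intro γ hγ; simp [hγ, integral]
  have hmass : ∀ m : X → ℝ≥0∞,
      mass (fun p : Option Δ × X => if p.1 = none then m p.2 else 0) = mass m := by
    intro m
    rw [← integral_one, hint, integral_one]
  have hu : ∀ m : X → ℝ≥0∞,
      unmarkedMass (fun p : Option Δ × X => if p.1 = none then m p.2 else 0) = mass m := by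
    intro m
    rw [unmarkedMass, hint]; simp [ind, integral_one]
  have hk : ∀ m : X → ℝ≥0∞,
      markedMass (fun p : Option Δ × X => if p.1 = none then m p.2 else 0) = 0 := by
    intro m
    rw [markedMass, hint]; simp [ind, integral]
  have hok : ∀ m : X → ℝ≥0∞, okPart m (fun x => K (none, x)) =
      okPart (fun p : Option Δ × X => if p.1 = none then m p.2 else 0) K := by
    intro m
    ext s
    rw [okPart, okPart, push, push, hint]
  refine ⟨⟨fun m hm hf => ?_, fun m hm hf => ?_, fun m hm hf x s hx hs => ?_⟩, fun m hm hf => ?_⟩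
  · rw [hok]
    exact h.ok _ (hV m hm) (by rwa [hmass])
  · have := h.fail _ (hV m hm) (by rwa [hmass])
    rw [hmass, hu, hk, mul_zero, add_zero, ← add_mul, failMass, hint] at this
    exact this
  · exact h.supp _ (hV m hm) (by rwa [hmass]) _ _ (by simpa using hx) hs
  · have := h.marked _ (hV m hm) (by rwa [hmass])
    rw [hu, hk, zero_add] at this
    rwa [hok]

end Generic

section Round

variable {k : ℕ} {b : ℕ → ℝ}

/-- Transverse error correction; a marked block remains marked. -/
theorem FTSim.transverse_correct {corr : Fin 7 → Blk k → PMF (Blk k)} {B : ℝ≥0∞}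
    (h : ∀ i, StepSim MBlk.errors MBlk.errors (corr i) (Well b k) (Well b k)
      (fun x y => mstate y = mstate x) B) :
    FTSim cfgErrors cfgErrors (fun v => SteaneFT.transverse 7 fun i => corr i (v i)) (WellOff b k)
      (WellOff b k) (fun p s => (p.1 = none ∨ s.1 = p.1) ∧
        ∀ i, s.1 ≠ some i → mstate (s.2 i) = mstate (p.2 i)) 0 (7 * B) (21 * B ^ 2) (7 * B) := by
  have hcone : IsCone (Well b k) := isCone_well k
  have h' : ∀ (γ : Option (Fin 7)) i, StepSim MBlk.errors MBlk.errors (corr i)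
      (Off (markSet γ) (Well b k) i) (Off (markSet γ) (Well b k) i)
      (fun x y => i ∉ markSet γ → mstate y = mstate x) B := by
    intro γ i
    by_cases hi : i ∈ markSet γ
    · exact (StepSim.trivial (errors_surjective k) (corr i) B).mono (fun _ _ => True.intro)
        (fun _ _ h => absurd hi h) (fun _ _ _ h => absurd hi h) le_rfl
    · exact (h i).mono (fun _ hm => hm hi) (fun _ hm _ => hm) (fun _ _ h _ => h) le_rfl
  refine (FTSim.transverse (id : Fin 7 → Fin 7) h' (fun γ i => hcone.off _ i) ?_).mono
    (fun _ h => h) (fun _ h => h) ?_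
  · intro j i m h hi
    refine h ?_ (by simp [markSet])
    rintro rfl
    exact hi rfl
  · rintro p s (⟨h, h'⟩ | ⟨h0, j, h, h'⟩)
    · exact ⟨Or.inr h, fun i hi => h' i fun hi' => hi (h.trans hi')⟩
    · exact ⟨Or.inl h0, fun i hi => h' i (fun hij => hi (by rw [h, hij]; rfl)) (by simp [markSet])⟩

/-- One round of error correction, with the given components. -/
noncomputable def roundOp (corr : Fin 7 → Blk k → PMF (Blk k)) (anc₁ : PMF (Blk (k + 1)))
    (op₁ : Fin 7 → Blk k × Blk k → PMF (Blk k × Blk k)) (anc₂ : PMF (Blk (k + 1)))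
    (op₂ : Fin 7 → Blk k × Blk k → PMF (Blk k × Blk k)) (d : Blk (k + 1)) : PMF (Blk (k + 1)) :=
  ((transverse 7 fun i => corr i (d i)).bind (halfOp false anc₁ op₁)).bind (halfOp true anc₂ op₂)

/-- The guarantees for the components of a round of error correction. -/
structure RoundParts (b : ℕ → ℝ) (k : ℕ) (A a B C : ℝ≥0∞) (corr : Fin 7 → Blk k → PMF (Blk k))
    (anc₁ : PMF (Blk (k + 1))) (op₁ : Fin 7 → Blk k × Blk k → PMF (Blk k × Blk k))
    (anc₂ : PMF (Blk (k + 1))) (op₂ : Fin 7 → Blk k × Blk k → PMF (Blk k × Blk k)) : Prop where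
  well : ∀ i, StepSim MBlk.errors MBlk.errors (corr i) (Well b k) (Well b k)
    (fun x y => mstate y = mstate x) B
  any : ∀ i, StepSim MBlk.errors MBlk.errors (corr i) (fun _ => True) (Well b k)
    (fun _ _ => True) B
  anc₁ : SourceSim cfgErrors anc₁ (WellOff b k)
    (fun p => PNear p.1 (states p.2) ∧ decode (states p.2) = 0) A a (A + a)
  op₁ : ∀ i, StepSim pairErrors pairErrors (op₁ i) (Both (Well b k) (Well b k))
    (Both (Well b k) (Well b k)) (copyRel false) C
  anc₂ : SourceSim cfgErrors anc₂ (WellOff b k)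
    (fun p => PNear p.1 (states p.2) ∧ decode (states p.2) = 0) A a (A + a)
  op₂ : ∀ i, StepSim pairErrors pairErrors (op₂ i) (Both (Well b k) (Well b k))
    (Both (Well b k) (Well b k)) (copyRel true) C

/-- The probability of a fault in a round. -/
noncomputable def roundE₁ (a B C : ℝ≥0∞) : ℝ≥0∞ := 7 * B + 2 * (a + 7 * C)

/-- The probability of two faults in a round. -/
noncomputable def roundE₂ (a B C : ℝ≥0∞) : ℝ≥0∞ :=
  21 * B ^ 2 + 2 * (21 * C ^ 2 + a * (7 * C)) + 7 * B * (a + 7 * C) +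
    (7 * B + (a + 7 * C)) * (a + 7 * C)

variable {A a B C : ℝ≥0∞} {corr : Fin 7 → Blk k → PMF (Blk k)} {anc₁ anc₂ : PMF (Blk (k + 1))}
  {op₁ op₂ : Fin 7 → Blk k × Blk k → PMF (Blk k × Blk k)}

/-- A round has three stages, with first-order bounds `7 * B` and twice `a + 7 * C`; `roundE₂`
collects the second-order terms of the stages and the products between different stages. The bound
`es` is of no use here, since faultless rounds are treated separately. -/
theorem RoundParts.ftSim (h : RoundParts b k A a B C corr anc₁ op₁ anc₂ op₂) :
    ∃ es, FTSim cfgErrors cfgErrors (roundOp corr anc₁ op₁ anc₂ op₂) (WellOff b k) (WellOff b k)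
      (fun p s => PNear p.1 (states p.2) →
        PNear s.1 (states s.2) ∧ decode (states s.2) = decode (states p.2))
      (2 * A) (roundE₁ a B C) (roundE₂ a B C) es := by
  have h1 := ((FTSim.transverse_correct h.well).comp (FTSim.half false h.anc₁ h.op₁)
    cfgErrors_surjective).comp (FTSim.half true h.anc₂ h.op₂) cfgErrors_surjective
  refine ⟨7 * B + (A + a + 7 * C) + (A + a + 7 * C), ?_⟩
  have e1 : 0 + A + A = 2 * A := by ring
  have e2 : 7 * B + (a + 7 * C) + (a + 7 * C) = roundE₁ a B C := by rw [roundE₁]; ring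
  have e3 : 21 * B ^ 2 + (21 * C ^ 2 + a * (7 * C)) + 7 * B * (a + 7 * C) +
      (21 * C ^ 2 + a * (7 * C)) + (7 * B + (a + 7 * C)) * (a + 7 * C) = roundE₂ a B C := by
    rw [roundE₂]; ring
  rw [e1, e2, e3] at h1
  refine h1.mono (fun _ h => h) (fun _ h => h) ?_
  rintro p s ⟨t, ⟨r, ⟨h1, h2⟩, h3⟩, h4⟩ hp
  have hr : PNear r.1 (states p.2) := by
    rcases h1 with h1 | h1
    · rw [h1] at hp; exact hp.of_none _
    · rwa [h1]
  have hr := hr.congr (s' := states r.2) h2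
  have ht := h3.state hr.1
  have hs := h4.state ht.1
  exact ⟨hs.1, by rw [hs.2, ht.2, hr.2]⟩

theorem wellOff_of_joint {m : (Fin 7 → MBlk k) → ℝ≥0∞}
    {m' : Option (Fin 7) × (Fin 7 → MBlk k) → ℝ≥0∞} (hm : Joint (fun _ => Well b k) m)
    (h : ∀ x, m' (none, x) = m x) (h' : ∀ γ x, m' (some γ, x) = 0) : WellOff b k m' := by
  rintro (_ | γ) i v hi
  · simp only [h]
    exact hm i v
  · simp only [h']
    exact (isCone_well k).zero

theorem WellOff.joint {m : Option (Fin 7) × (Fin 7 → MBlk k) → ℝ≥0∞} (hm : WellOff b k m) :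
    Joint (fun _ => Well b k) fun v => m (none, v) :=
  fun i v => hm none i v (by simp [markSet])

/-- On the subblocks in `G` the corrections are only asked to produce well output, which they do for
any input; elsewhere they also preserve the states. All seven subblocks are well afterwards, and the
two faultless extractions remove all relative errors. Taking for `G` the position of a mark handles
a controlled input, and taking the whole set handles an arbitrary one. -/
theorem RoundParts.strict (h : RoundParts b k A a B C corr anc₁ op₁ anc₂ op₂) (G : Set (Fin 7)) :
    StepSim cfgErrors cfgErrors (roundOp corr anc₁ op₁ anc₂ op₂)
      (Joint (Off G (Well b k))) (Joint fun _ => Well b k)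
      (fun v w => PNear none (states w) ∧ ∀ g, markSet g = G → PNear g (states v) →
        decode (states w) = decode (states v)) (2 * A + roundE₁ a B C) := by
  have hcorr : ∀ i, StepSim MBlk.errors MBlk.errors (corr i) (Off G (Well b k) i) (Well b k)
      (fun x y => i ∉ G → mstate y = mstate x) B := by
    intro i
    by_cases hi : i ∈ G
    · exact (h.any i).mono (fun _ _ => True.intro) (fun _ h => h) (fun _ _ _ h => absurd hi h) le_rfl
    · exact (h.well i).mono (fun _ hm => hm hi) (fun _ hm => hm) (fun _ _ h _ => h) le_rfl
  have h0 := StepSim.strict hcorr fun _ => isCone_well k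
  have h1 := (FTSim.half false h.anc₁ h.op₁).strictOf (V := Joint fun _ => Well b k)
    (V' := Joint fun _ => Well b k) (fun m m' hm => wellOff_of_joint hm) fun _ => WellOff.joint
  have h2 := (FTSim.half true h.anc₂ h.op₂).strictOf (V := Joint fun _ => Well b k)
    (V' := Joint fun _ => Well b k) (fun m m' hm => wellOff_of_joint hm) fun _ => WellOff.joint
  refine ((h0.comp h1 cfgErrors_surjective).comp h2 cfgErrors_surjective).mono (fun _ h => h)
    (fun _ h => h) ?_ (le_of_eq ?_)
  · rintro v w ⟨y, ⟨x, h0, h1⟩, h2⟩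
    have h1 := h1.state_none
    have h2 := h2.state_none
    -- The second half clears the Z component, and it does not reintroduce the X relative error that
    -- was cleared by the first half.
    refine ⟨pnear_iff_component.2 (forall_bool_of true h2.2.1 (h2.2.2 h1.2.1)), ?_⟩
    rintro g rfl hv
    rw [h2.1, h1.1]
    exact (hv.congr (s' := states x) h0).2
  · rw [roundE₁]; push_cast; ring

/-- A controlled distribution without marks. -/
def Clean (b : ℕ → ℝ) (k : ℕ) (m : MBlk (k + 1) → ℝ≥0∞) : Prop :=
  Controlled (Well b k) m ∧ ∀ B : MBlk (k + 1), m B ≠ 0 → B.1 = none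

theorem Clean.well {m : MBlk (k + 1) → ℝ≥0∞} (h : Clean b k m) : Well b (k + 1) m :=
  h.1.well_of_unmarked h.2

theorem isCone_clean : IsCone (Clean b k) := fun _ c m hm =>
  ⟨isCone_controlled (isCone_well k) c m fun i hi => (hm i hi).1, fun B hB => by
    obtain ⟨i, hi, hB⟩ := integral_ne_zero.1 hB
    exact (hm i hi).2 B hB⟩

theorem controlled_iff_wellOff {m : MBlk (k + 1) → ℝ≥0∞} :
    Controlled (Well b k) m ↔
      (∀ B : MBlk (k + 1), m B ≠ 0 → PNear B.1 (states B.2)) ∧ WellOff b k m := by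
  rw [controlled_iff]
  exact and_congr Iff.rfl ⟨fun h g i v hi => h g v i hi, fun h g v i hi => h g i v hi⟩

/-- A run without faults, as an operation on a marked block. -/
theorem RoundParts.strict_clean (h : RoundParts b k A a B C corr anc₁ op₁ anc₂ op₂)
    (G : Set (Fin 7)) :
    StepSim cfgErrors (MBlk.errors (k := k + 1)) (roundOp corr anc₁ op₁ anc₂ op₂)
      (Joint (Off G (Well b k))) (Clean b k)
      (fun v w => ∀ g, markSet g = G → PNear g (states v) → mstate w = decode (states v))
      (2 * A + roundE₁ a B C) := by
  refine ((h.strict G).withSupport.embed (V' := Clean b k) ?_).mono (fun _ h => h) (fun _ h => h)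
    (fun _ _ h => h.2.2) le_rfl
  rintro m m' ⟨hm, hs⟩ h1 h2
  have h0 : ∀ s : Option (Fin 7) × (Fin 7 → MBlk k), m' s ≠ 0 → s.1 = none ∧ m s.2 ≠ 0 := by
    rintro ⟨_ | γ, y⟩ hy
    · exact ⟨rfl, by rwa [← h1]⟩
    · exact absurd (h2 γ y) hy
  refine ⟨controlled_iff_wellOff.2 ⟨fun B hB => ?_, wellOff_of_joint hm h1 h2⟩,
    fun B hB => (h0 B hB).1⟩
  rw [(h0 B hB).1]
  obtain ⟨x, hx⟩ := hs _ (h0 B hB).2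
  exact hx.1

theorem integral_tsum {X I : Type} (m : I → X → ℝ≥0∞) (h : X → ℝ≥0∞) :
    integral (fun x => ∑' i, m i x) h = ∑' i, integral (m i) h := by
  simp only [integral, ← ENNReal.tsum_mul_right]
  exact ENNReal.tsum_comm

theorem markedMass_eq_sum {X : Type} (m : Option (Fin 7) × X → ℝ≥0∞) :
    markedMass m = ∑ j, mass fun x => m (some j, x) := by
  simp [markedMass_eq, tsum_fintype, Fintype.sum_option, ind]

theorem markedMass_eq_zero {X Δ : Type} {m : Option Δ × X → ℝ≥0∞} (h : ∀ p, m p ≠ 0 → p.1 = none) :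
    markedMass m = 0 := by
  by_contra h0
  obtain ⟨p, hp, h1⟩ := integral_ne_zero.1 h0
  exact ind_ne_zero.1 h1 (h p hp)

/-- A mark, together with seven marked blocks. -/
abbrev MConf (k : ℕ) : Type := Option (Fin 7) × (Fin 7 → MBlk k)

/-- The guarantees of a round of error correction for a controlled block. -/
structure RoundSpec (b : ℕ → ℝ) (k : ℕ) (α e₁ e₂ : ℝ≥0∞)
    (K : MConf k → PMF (MConf k × Bool)) : Prop where
  ok : ∀ m : MConf k → ℝ≥0∞, Controlled (Well b k) m → mass m ≠ ⊤ → Controlled (Well b k) (okPart m K)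
  supp : ∀ m : MConf k → ℝ≥0∞, Controlled (Well b k) m → mass m ≠ ⊤ → ∀ x y, m x ≠ 0 → K x (y, true) ≠ 0 →
    decode (states y.2) = decode (states x.2)
  marked : ∀ m : MConf k → ℝ≥0∞, Controlled (Well b k) m → mass m ≠ ⊤ →
    markedMass (okPart m K) ≤
      e₁ * unmarkedMass m
  fail : ∀ m : MConf k → ℝ≥0∞, Controlled (Well b k) m → mass m ≠ ⊤ →
    failMass m K ≤ α * mass m + e₂ * unmarkedMass m +
      e₁ * markedMass m

/-- The distributions of seven blocks that are controlled if `γ` is the mark. -/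
def Given (b : ℕ → ℝ) (k : ℕ) (γ : Option (Fin 7)) (m : (Fin 7 → MBlk k) → ℝ≥0∞) : Prop :=
  Joint (Off (markSet γ) (Well b k)) m ∧ ∀ v, m v ≠ 0 → PNear γ (states v)

theorem controlled_iff_given {m : MBlk (k + 1) → ℝ≥0∞} :
    Controlled (Well b k) m ↔ ∀ γ, Given b k γ fun v => m (γ, v) := by
  rw [controlled_iff_wellOff]
  exact ⟨fun h γ => ⟨h.2 γ, fun v hv => h.1 (γ, v) hv⟩, fun h => ⟨fun B hB => (h B.1).2 B.2 hB,
    fun γ => (h γ).1⟩⟩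

theorem RoundParts.round_unmarked (h : RoundParts b k A a B C corr anc₁ op₁ anc₂ op₂) :
    ∃ K : (Fin 7 → MBlk k) → PMF (MConf k × Bool),
      Lifts cfgErrors (fun p => cfgErrors p.2) (roundOp corr anc₁ op₁ anc₂ op₂) K ∧
      MarkStep (Given b k none) (Controlled (Well b k))
        (fun v s => PNear none (states v) → decode (states s.2) = decode (states v))
        (2 * A + roundE₂ a B C) (roundE₁ a B C) K := by
  classical
  obtain ⟨es, K, l, h⟩ := h.ftSim
  have h' := h.onUnmarked (V := Given b k none) fun m hm =>
    wellOff_of_joint (m := m) (fun i v => hm.1 i v (by simp [markSet])) (by simp) (by simp)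
  refine ⟨_, fun v => l (none, v), ⟨fun m hm hf => ?_, h'.fail, fun m hm hf v s hv hs hp =>
    (h'.supp m hm hf v s hv hs hp).2⟩, h'.marked⟩
  refine controlled_iff_wellOff.2 ⟨fun B hB => ?_, h'.ok m hm hf⟩
  obtain ⟨v, hv, hB⟩ := okPart_ne_zero.1 hB
  exact (h'.supp m hm hf v B hv hB (hm.2 v hv)).1

/-- The analysis is chosen according to the incoming mark. An unmarked input may acquire one mark; a
marked input requires a faultless round, which removes the mark. Hence output marks are charged to
the unmarked part of the input only, instead of accumulating from round to round. -/
theorem RoundParts.round (h : RoundParts b k A a B C corr anc₁ op₁ anc₂ op₂) :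
    ∃ K : MConf k → PMF (MConf k × Bool),
      Lifts (fun p => cfgErrors p.2) (fun p => cfgErrors p.2) (roundOp corr anc₁ op₁ anc₂ op₂) K ∧
      RoundSpec b k (2 * A) (roundE₁ a B C) (roundE₂ a B C) K := by
  obtain ⟨K, l, hK⟩ := h.round_unmarked
  have h' := fun j => h.strict_clean (markSet (some j))
  choose K' l' hK' using h'
  let F : Option (Fin 7) → (Fin 7 → MBlk k) → PMF (MConf k × Bool) := fun γ =>
    match γ with
    | none => K
    | some j => K' j
  have hst : ∀ γ, Step (Given b k γ) (Controlled (Well b k))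
      (fun v (w : MConf k) => PNear γ (states v) → decode (states w.2) = decode (states v)) ⊤ (F γ) := by
    rintro (_ | j)
    · exact hK.toStep.mono (fun _ h => h) (fun _ h => h) (fun _ _ h => h) le_top
    · exact (hK' j).mono (fun _ h => h.1) (fun _ h => h.1) (fun _ _ h => h _ rfl) le_top
  have hall := Step.branch hst (isCone_controlled (isCone_well k))
  refine ⟨fun p : MConf k => F p.1 p.2, ?_, ?_, ?_, ?_, ?_⟩
  · rintro ⟨_ | j, v⟩
    · exact l v
    · exact l' j v
  · exact fun m hm hf => hall.ok m (controlled_iff_given.1 hm) hf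
  · exact fun m hm hf x y hx hy => hall.supp m (controlled_iff_given.1 hm) hf x y hx hy
      ((controlled_iff_given.1 hm x.1).2 _ hx)
  · intro m hm hf
    have hm := controlled_iff_given.1 hm
    have hs := mass_slice_ne_top hf
    refine (le_of_eq ?_).trans (hK.marked _ (hm none) (hs none)) |>.trans (le_of_eq ?_)
    -- Inputs that carried a mark come out without one, so only the slice `none` contributes.
    · rw [okPart_branch, markedMass, integral_tsum, tsum_eq_single none]
      · rfl
      · rintro (_ | j) hγ
        · exact absurd rfl hγ
        · exact markedMass_eq_zero ((hK' j).ok _ (hm (some j)).1 (hs (some j))).2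
    · rw [unmarkedMass_eq]
  · intro m hm hf
    have hm := controlled_iff_given.1 hm
    have hs := mass_slice_ne_top hf
    rw [failMass_branch, tsum_fintype, Fintype.sum_option]
    rw [← unmarkedMass_add_markedMass m, unmarkedMass_eq,
      markedMass_eq_sum]
    refine (add_le_add (hK.fail _ (hm none) (hs none)) (Finset.sum_le_sum fun j _ =>
      (hK' j).fail _ (hm (some j)).1 (hs (some j)))).trans (le_of_eq ?_)
    rw [← Finset.mul_sum]
    ring

end Round
end SteaneFT

namespace SteaneFT
open scoped ENNReal

/-! ### Error correction -/

section Retry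

variable {X Y Z : Type}

/-- Apply `K₂` after a success of `K₁`, and `K₃` after a failure. -/
noncomputable def retryK (K₁ : X → PMF (Y × Bool)) (K₂ K₃ : Y → PMF (Z × Bool)) (x : X) :
    PMF (Z × Bool) :=
  (K₁ x).bind fun r => if r.2 then K₂ r.1 else K₃ r.1

theorem integral_retryK (m : X → ℝ≥0∞) (K₁ : X → PMF (Y × Bool)) (K₂ K₃ : Y → PMF (Z × Bool))
    (h : Z × Bool → ℝ≥0∞) :
    (integral m fun x => integral (retryK K₁ K₂ K₃ x) h) =
      (integral (okPart m K₁) fun y => integral (K₂ y) h) +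
        integral (fun y => push m K₁ (y, false)) fun y => integral (K₃ y) h := by
  simp only [retryK, integral_bind]
  rw [← integral_push, integral, tsum_flag]
  simp only [if_true, Bool.false_eq_true, if_false]
  rfl

theorem okPart_retryK (m : X → ℝ≥0∞) (K₁ : X → PMF (Y × Bool)) (K₂ K₃ : Y → PMF (Z × Bool)) :
    okPart m (retryK K₁ K₂ K₃) = fun z => okPart (okPart m K₁) K₂ z +
      okPart (fun y => push m K₁ (y, false)) K₃ z := by
  ext z
  simp only [okPart, push]
  have h : ∀ p : PMF (Z × Bool), p (z, true) = integral p fun r => ind ((z, true) = r) := fun p =>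
    apply_eq_integral p _
  simp only [h]
  exact integral_retryK m K₁ K₂ K₃ _

theorem failMass_retryK (m : X → ℝ≥0∞) (K₁ : X → PMF (Y × Bool)) (K₂ K₃ : Y → PMF (Z × Bool)) :
    failMass m (retryK K₁ K₂ K₃) = failMass (okPart m K₁) K₂ +
      failMass (fun y => push m K₁ (y, false)) K₃ :=
  integral_retryK m K₁ K₂ K₃ _

theorem mass_push_false (m : X → ℝ≥0∞) (K : X → PMF (Y × Bool)) :
    (mass fun y => push m K (y, false)) = failMass m K := by
  simp only [failMass, failProb]
  rw [← integral_push, integral, tsum_flag]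
  simp [ind, mass]

theorem StepSim.mono_of_support {X₀ Y₀ : Type} {eX : X → X₀} {eY : Y → Y₀} {op : X₀ → PMF Y₀}
    {W V : (X → ℝ≥0∞) → Prop} {W' : (Y → ℝ≥0∞) → Prop} {rel rel' : X → Y → Prop} {q : ℝ≥0∞}
    (h : StepSim eX eY op W W' rel q) (hV : ∀ m, V m → W m)
    (hrel : ∀ m, V m → ∀ x y, m x ≠ 0 → rel x y → rel' x y) : StepSim eX eY op V W' rel' q := by
  obtain ⟨K, l, h⟩ := h
  exact ⟨K, l, fun m hm => h.ok m (hV m hm), fun m hm => h.fail m (hV m hm),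
    fun m hm hf x y hx hy => hrel m hm x y hx (h.supp m (hV m hm) hf x y hx hy)⟩

end Retry

/-! ### Two rounds of error correction -/

section Correction

variable {k : ℕ} {b : ℕ → ℝ} {A a B C α e₁ e₂ : ℝ≥0∞}

theorem mass_eq_sum_state (m : MConf k → ℝ≥0∞) (h : MConf k → ℝ≥0∞) :
    integral m h = ∑ s, integral m fun x => ind (decode (states x.2) = s) * h x := by
  rw [← integral_finset_sum]
  refine integral_congr fun x _ => ?_
  rw [← Finset.sum_mul, Finset.sum_eq_single (decode (states x.2))]
  · rw [ind_of rfl, one_mul]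
  · intro s _ hs; exact ind_of_not hs.symm
  · simp

/-- Sum the conditional bounds over the four states. -/
theorem Well.markedMass_le {m : MConf k → ℝ≥0∞} (hm : Well b (k + 1) m) :
    markedMass m ≤ ENNReal.ofReal (b (k + 1)) * mass m := by
  rw [← integral_one m, markedMass, mass_eq_sum_state, mass_eq_sum_state m fun _ => 1,
    Finset.mul_sum]
  refine Finset.sum_le_sum fun s _ => ?_
  simp only [← ind_and, mul_one]
  exact (well_succ_iff.1 hm).2 s

/-- This bounds the probability of a mark conditional on success. Adding `c * failMass m K`, which
is finite, to both sides makes the right side `c` times the input mass. On the unmarked part of the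
input the left side is at most `e₁ + c * (α + e₂)`, and on the marked part at most `c * (α + e₁)`;
both coefficients are at most `c`. -/
theorem RoundSpec.marked_le {K : MConf k → PMF (MConf k × Bool)} (h : RoundSpec b k α e₁ e₂ K)
    {c : ℝ≥0∞} (hc : e₁ + c * (α + e₂) ≤ c) (hc' : c ≠ ⊤) (h1 : α + e₁ ≤ 1)
    {m : MConf k → ℝ≥0∞} (hm : Controlled (Well b k) m) (hf : mass m ≠ ⊤) :
    markedMass (okPart m K) ≤ c * mass (okPart m K) := by
  have hfail : c * failMass m K ≠ ⊤ :=
    ENNReal.mul_ne_top hc' (ne_top_of_le_ne_top hf (failMass_le_mass m K))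
  rw [← ENNReal.add_le_add_iff_right hfail, ← mul_add, mass_okPart_add_failMass,
    ← unmarkedMass_add_markedMass m]
  refine (add_le_add (h.marked m hm hf) (mul_le_mul_right (h.fail m hm hf) c)).trans ?_
  rw [← unmarkedMass_add_markedMass m]
  calc e₁ * unmarkedMass m + c * (α * (unmarkedMass m + markedMass m) + e₂ * unmarkedMass m +
        e₁ * markedMass m)
      = (e₁ + c * (α + e₂)) * unmarkedMass m + c * ((α + e₁) * markedMass m) := by ring
    _ ≤ c * unmarkedMass m + c * (1 * markedMass m) := by gcongr
    _ = _ := by ring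

/-- Successful rounds preserve the state. Restricting the output to a state is thus the same as
running the round on the input restricted to this state, which is still controlled, and
`RoundSpec.marked_le` applies to it. -/
theorem RoundSpec.well {K : MConf k → PMF (MConf k × Bool)} (h : RoundSpec b k α e₁ e₂ K)
    (hc : e₁ + ENNReal.ofReal (b (k + 1)) * (α + e₂) ≤ ENNReal.ofReal (b (k + 1)))
    (h1 : α + e₁ ≤ 1) {m : MConf k → ℝ≥0∞} (hm : Controlled (Well b k) m) (hf : mass m ≠ ⊤) :
    Well b (k + 1) (okPart m K) := by
  refine well_succ_iff.2 ⟨h.ok m hm hf, fun s => ?_⟩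
  have hr : Controlled (Well b k) fun x : MConf k => ind (decode (states x.2) = s) * m x :=
    hm.restrict Well.restrict fun t => ind (t = s)
  have hrf : (mass fun x : MConf k => ind (decode (states x.2) = s) * m x) ≠ ⊤ := by
    refine ne_top_of_le_ne_top hf (ENNReal.tsum_le_tsum fun x => ?_)
    exact mul_le_of_le_one_left' (ind_le_one _)
  have hok : okPart (fun x : MConf k => ind (decode (states x.2) = s) * m x) K =
      fun y => ind (decode (states y.2) = s) * okPart m K y := by
    ext y
    simp only [okPart, push]
    rw [← integral_const_mul]
    refine tsum_congr fun x => ?_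
    by_cases hx : m x = 0
    · simp [hx]
    by_cases hy : K x (y, true) = 0
    · simp [hy]
    rw [h.supp m hm hf x y hx hy]
    ring
  have := h.marked_le hc ENNReal.ofReal_ne_top h1 hr hrf
  rw [hok, ← integral_one, markedMass] at this
  have hi : ∀ p : MConf k → Prop, (integral (fun y => ind (decode (states y.2) = s) * okPart m K y)
      fun y => ind (p y)) = integral (okPart m K) fun y => ind (decode (states y.2) = s ∧ p y) := by
    intro p
    refine tsum_congr fun y => ?_
    simp only [ind_and]; ring
  have hi' := hi fun _ => True
  simp only [ind_of, and_true] at hi'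
  rw [hi, hi'] at this
  exact this

variable {corr corr' : Fin 7 → Blk k → PMF (Blk k)} {anc₁ anc₂ anc₁' anc₂' : PMF (Blk (k + 1))}
  {op₁ op₂ op₁' op₂' : Fin 7 → Blk k × Blk k → PMF (Blk k × Blk k)}

/-- The errors of a marked configuration. -/
def confErrors (p : MConf k) : Blk (k + 1) := cfgErrors p.2

theorem confErrors_surjective : Function.Surjective (confErrors (k := k)) :=
  surjective_comp_snd cfgErrors_surjective

theorem RoundParts.strict_controlled (h : RoundParts b k A a B C corr anc₁ op₁ anc₂ op₂) :
    StepSim confErrors confErrors (roundOp corr anc₁ op₁ anc₂ op₂) (Controlled (Well b k))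
      (Clean b k) (fun x y => decode (states y.2) = decode (states x.2))
      (2 * A + roundE₁ a B C) :=
  (StepSim.branch (fun γ => h.strict_clean (markSet γ)) isCone_clean).mono_of_support
    (fun _ hm γ => (controlled_iff_given.1 hm γ).1) fun _ hm x _ hx hxy =>
      hxy x.1 rfl ((controlled_iff_given.1 hm x.1).2 _ hx)

/-- With `G` the whole set of positions, the hypothesis on the input is void. -/
theorem RoundParts.strict_any (h : RoundParts b k A a B C corr anc₁ op₁ anc₂ op₂) :
    StepSim confErrors confErrors (roundOp corr anc₁ op₁ anc₂ op₂) (fun _ => True)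
      (Clean b k) (fun _ _ => True) (2 * A + roundE₁ a B C) :=
  (StepSim.branch (I := Option (Fin 7)) (fun _ => h.strict_clean Set.univ) isCone_clean).mono
    (fun _ _ _ _ _ hi => absurd (Set.mem_univ _) hi) (fun _ h => h) (fun _ _ _ => True.intro) le_rfl

section TwoRounds

variable (h : RoundParts b k A a B C corr anc₁ op₁ anc₂ op₂)
  (h' : RoundParts b k A a B C corr' anc₁' op₁' anc₂' op₂')

include h h'

/-- Any fault in either round is charged as a failure. This first-order bound is affordable because
the input is allowed to have an uncontrolled subblock with certainty. -/
theorem RoundParts.correction_butOne :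
    StepSim confErrors confErrors (fun d => (roundOp corr anc₁ op₁ anc₂ op₂ d).bind
      (roundOp corr' anc₁' op₁' anc₂' op₂')) (Controlled (Well b k)) (Well b (k + 1))
      (fun x y => decode (states y.2) = decode (states x.2))
      (2 * (2 * A + roundE₁ a B C)) :=
  (h.strict_controlled.comp (h'.strict_controlled.mono (fun _ h => h.1) (fun _ h => h)
    (fun _ _ h => h) le_rfl) confErrors_surjective).mono (fun _ h => h) (fun _ h => h.well)
      (fun _ _ ⟨_, h₁, h₂⟩ => h₂.trans h₁) (two_mul _).ge

variable (hc : roundE₁ a B C + ENNReal.ofReal (b (k + 1)) * (2 * A + roundE₂ a B C) ≤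
    ENNReal.ofReal (b (k + 1))) (h1 : 2 * A + roundE₁ a B C ≤ 1)

include hc h1

/-- Apart from failing ancillas, a failure has two faults in one round, one fault in each round, or
an incoming mark and a fault in the first round. A mark that enters the second round was created in
the first, hence `roundE₁ ^ 2` and no further term with `b`. The second round makes the output well.
-/
theorem RoundParts.correction_well :
    StepSim confErrors confErrors (fun d => (roundOp corr anc₁ op₁ anc₂ op₂ d).bind
      (roundOp corr' anc₁' op₁' anc₂' op₂')) (Well b (k + 1)) (Well b (k + 1))
      (fun x y => decode (states y.2) = decode (states x.2))
      (2 * (2 * A) + 2 * roundE₂ a B C + roundE₁ a B C ^ 2 +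
        ENNReal.ofReal (b (k + 1)) * roundE₁ a B C) := by
  obtain ⟨K, l, hK⟩ := h.round
  obtain ⟨K', l', hK'⟩ := h'.round
  refine ⟨_, l.seqK l' confErrors_surjective, fun m hm hf => ?_, fun m hm hf => ?_,
    fun m hm hf x z hx hz => ?_⟩
  · rw [okPart_seqK]
    exact hK'.well hc h1 (hK.ok m (well_succ_iff.1 hm).1 hf) (mass_okPart_ne_top hf _)
  · have hm' := (well_succ_iff.1 hm).1
    rw [failMass_seqK]
    refine (add_le_add (hK.fail m hm' hf)
      (hK'.fail _ (hK.ok m hm' hf) (mass_okPart_ne_top hf _))).trans ?_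
    have hu := unmarkedMass_le m
    have hw := hm.markedMass_le
    have hok := mass_okPart_le m K
    have hu' := (unmarkedMass_le (okPart m K)).trans hok
    have hw' := (hK.marked m hm' hf).trans (mul_le_mul_right hu _)
    calc _ ≤ 2 * A * mass m + roundE₂ a B C * mass m +
          roundE₁ a B C * (ENNReal.ofReal (b (k + 1)) * mass m) +
          (2 * A * mass m + roundE₂ a B C * mass m + roundE₁ a B C * (roundE₁ a B C * mass m)) := by
            gcongr
            exacts [hok, hu', hw']
      _ = _ := by ring
  · have hm' := (well_succ_iff.1 hm).1
    obtain ⟨y, hy, hz⟩ := seqK_true_ne_zero hz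
    exact (hK'.supp _ (hK.ok m hm' hf) (mass_okPart_ne_top hf _) y z
      (okPart_ne_zero.2 ⟨x, hx, hy⟩) hz).trans (hK.supp m hm' hf x y hx hy)

/-- If the first round is faultless, its output is unmarked, and the second round may then have one
fault. Otherwise the second round has to be faultless. The guarantee of the second round holds for
every input measure, in particular for what the failed first round left, so the two probabilities
multiply. -/
theorem RoundParts.correction_any :
    StepSim confErrors confErrors (fun d => (roundOp corr anc₁ op₁ anc₂ op₂ d).bind
      (roundOp corr' anc₁' op₁' anc₂' op₂')) (fun _ => True) (Well b (k + 1)) (fun _ _ => True)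
      (2 * A + roundE₂ a B C + (2 * A + roundE₁ a B C) ^ 2) := by
  obtain ⟨K₁, l₁, h₁⟩ := h.strict_any
  obtain ⟨K₂, l₂, h₂⟩ := h'.round
  obtain ⟨K₃, l₃, h₃⟩ := h'.strict_any
  have hfalse : ∀ m : MConf k → ℝ≥0∞, mass m ≠ ⊤ → (mass fun y => push m K₁ (y, false)) ≠ ⊤ := by
    intro m hf
    rw [mass_push_false]
    exact ne_top_of_le_ne_top hf (failMass_le_mass _ _)
  refine ⟨retryK K₁ K₂ K₃, fun x => ?_, fun m _ hf => ?_, fun m _ hf => ?_,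
    fun _ _ _ _ _ _ _ => True.intro⟩
  · change _ = (roundOp corr anc₁ op₁ anc₂ op₂ (confErrors x)).bind _
    rw [← l₁ x, retryK, PMF.map_bind, PMF.bind_map]
    congr 1
    ext1 r
    cases hr : r.2
    · exact l₃ r.1
    · exact l₂ r.1
  · rw [okPart_retryK]
    exact (isCone_well (k + 1)).add
      (h₂.well hc h1 (h₁.ok m True.intro hf).1 (mass_okPart_ne_top hf _))
      (h₃.ok _ True.intro (hfalse m hf)).well
  · rw [failMass_retryK]
    have hcl := h₁.ok m True.intro hf
    refine (add_le_add (h₂.fail _ hcl.1 (mass_okPart_ne_top hf _))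
      (h₃.fail _ True.intro (hfalse m hf))).trans ?_
    rw [mass_push_false, markedMass_eq_zero (m := okPart m K₁) hcl.2]
    have hok := mass_okPart_le m K₁
    have hu' := (unmarkedMass_le (okPart m K₁)).trans hok
    have hfail := h₁.fail m True.intro hf
    calc _ ≤ 2 * A * mass m + roundE₂ a B C * mass m + roundE₁ a B C * 0 +
          (2 * A + roundE₁ a B C) * ((2 * A + roundE₁ a B C) * mass m) := by gcongr
      _ = _ := by ring

end TwoRounds

end Correction
end SteaneFT

namespace SteaneFT
open scoped ENNReal

/-! ### The gadgets -/

section Gadget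

variable {k : ℕ} {b : ℕ → ℝ} {A a B C : ℝ≥0∞}

theorem map_involutive_apply {X : Type} {f : X → X} (hf : ∀ x, f (f x) = x) (p : PMF X) (x : X) :
    p.map f x = p (f x) := by
  rw [map_apply_eq_integral, apply_eq_integral p]
  exact integral_congr fun y _ => ind_congr ⟨fun h => by rw [h, hf], fun h => by rw [← h, hf]⟩

theorem StepSim.map_sym {X X₀ : Type} {eX : X → X₀} {op : X₀ → PMF (Blk k)}
    {W : (X → ℝ≥0∞) → Prop} {rel : X → MBlk k → Prop} {q : ℝ≥0∞} {f : Pauli → Pauli}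
    (hf : IsSym f) (h : StepSim eX MBlk.errors op W (Well b k) rel q) :
    StepSim eX MBlk.errors (fun x => (op x).map (bmap f k)) W (Well b k)
      (fun x y => rel x (mmap f k y)) q := by
  obtain ⟨K, l, h⟩ := h
  have hK : ∀ x y, (K x).map (fun r => (mmap f k r.1, r.2)) (y, true) = K x (mmap f k y, true) :=
    fun x y => map_involutive_apply (fun r => Prod.ext (hf.mmap_mmap k r.1) rfl) _ _
  refine ⟨fun x => (K x).map fun r => (mmap f k r.1, r.2), fun x => ?_, fun m hm hfin => ?_,
    fun m hm hfin => ?_, fun m hm hfin x y hx hy => ?_⟩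
  · change _ = (op (eX x)).map _
    rw [← l x, PMF.map_comp, PMF.map_comp]
    congr 1
    ext1 r
    exact errors_mmap f k r.1
  · have h1 : okPart m (fun x => (K x).map fun r => (mmap f k r.1, r.2)) =
        fun y => okPart m K (mmap f k y) := by
      ext y
      exact tsum_congr fun x => congrArg (m x * ·) (hK x y)
    rw [h1]
    exact (h.ok m hm hfin).comp_mmap hf
  · refine le_trans (le_of_eq ?_) (h.fail m hm hfin)
    exact integral_congr fun x _ => failProb_map _ _
  · rw [hK] at hy
    exact h.supp m hm hfin x _ hx hy

theorem SourceSim.map_sym {p : PMF (Blk (k + 1))} {es : ℝ≥0∞} {f : Pauli → Pauli}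
    (hf : IsSym f) (hf0 : f 0 = 0) (h : SourceSim cfgErrors p (WellOff b k)
      (fun p => PNear p.1 (states p.2) ∧ decode (states p.2) = 0) A a es) :
    SourceSim cfgErrors (p.map (bmap f (k + 1))) (WellOff b k)
      (fun p => PNear p.1 (states p.2) ∧ decode (states p.2) = 0) A a es := by
  obtain ⟨R, hR, h⟩ := h
  let F : MConf k → MConf k := fun c => (c.1, fun i => mmap f k (c.2 i))
  have hF : ∀ c, F (F c) = c := fun c => Prod.ext rfl (funext fun i => hf.mmap_mmap k (c.2 i))
  have hst : ∀ c, states (F c).2 = fun i => f (states c.2 i) := fun c =>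
    funext fun i => hf.mstate_mmap _
  have hap : ∀ c, R.map (fun r => (F r.1, r.2)) (c, true) = R (F c, true) :=
    fun c => map_involutive_apply (fun r => Prod.ext (hF r.1) rfl) _ _
  have hfail : failProb (R.map fun r => (F r.1, r.2)) = failProb R := failProb_map _ _
  have hmark : markedMass (fun c => R (F c, true)) = markedMass fun c => R (c, true) :=
    integral_equiv (⟨F, F, hF, hF⟩ : MConf k ≃ MConf k) (fun c => R (c, true)) fun c =>
      ind (c.1 ≠ none)
  refine ⟨R.map fun r => (F r.1, r.2), ?_, ?_, fun c hc => ?_, ?_, ?_, ?_⟩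
  · rw [← hR, PMF.map_comp, PMF.map_comp]
    congr 1
    ext1 r
    exact errors_mmap f (k + 1) r.1
  · simp only [hap]
    intro γ i v hi
    have := (h.ok γ i (fun j => mmap f k (v j)) hi).comp_mmap hf
    convert this using 2 with c
    exact congrArg (fun c => R (c, true)) (mmap_update f γ v i c)
  · rw [hap] at hc
    obtain ⟨h1, h2⟩ := h.supp _ hc
    have h3 : states c.2 = fun i => f (states (F c).2 i) := by
      rw [← hst, hF]
    rw [h3]
    refine ⟨hf.pnear _ _ h1, ?_⟩
    rw [hf.decode, h2, hf0]
  · rw [hfail]; exact h.fail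
  · simp only [hap]; rw [hmark]; exact h.marked
  · simp only [hap]; rw [hmark, hfail]; exact h.strict

/-- The action of a CNOT gate on the states. -/
def cnotRel (x y : MBlk k × MBlk k) : Prop :=
  (mstate y.1, mstate y.2) = cnotState (mstate x.1) (mstate x.2)

/-- The guarantees for the operations of one level. -/
structure GadgetSpec (P : Noise → Prop) (b : ℕ → ℝ) (k : ℕ) (G : Gadgets k) (A B C : ℝ≥0∞) :
    Prop where
  zero : ∀ ν, P ν → StepSim (fun _ : Unit => ()) MBlk.errors (fun _ => G.zero ν) (fun _ => True)
    (Well b k) (fun _ x => mstate x = 0) A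
  well : ∀ ν, P ν → StepSim MBlk.errors MBlk.errors (G.correct ν) (Well b k) (Well b k)
    (fun x y => mstate y = mstate x) B
  any : ∀ ν, P ν → StepSim MBlk.errors MBlk.errors (G.correct ν) (fun _ => True) (Well b k)
    (fun _ _ => True) B
  cnot : ∀ ν, P ν → StepSim pairErrors pairErrors (fun x => G.cnot ν x.1 x.2)
    (Both (Well b k) (Well b k)) (Both (Well b k) (Well b k)) cnotRel C

/-- The guarantees for the preparation of verified ancillas. -/
def AncillaSpec (P : Noise → Prop) (b : ℕ → ℝ) (k : ℕ) (zero : Noise → PMF (Blk (k + 1)))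
    (A a : ℝ≥0∞) : Prop :=
  ∀ ν, P ν → SourceSim cfgErrors (zero ν) (WellOff b k)
    (fun p => PNear p.1 (states p.2) ∧ decode (states p.2) = 0) A a (A + a)

theorem halfOp_eq (σ : Bool) (anc : PMF (Blk (k + 1)))
    (op : Fin 7 → Blk k × Blk k → PMF (Blk k × Blk k)) :
    halfOp σ anc op = fun d => anc.bind fun a => (transverse 7 fun i => op i (d i, a i)).bind fun r =>
      PMF.pure fun i =>
        applyAll (singlePauli σ (relBits (fun j => component σ (state k (r j).2)) i)) k (r i).1 := by
  ext1 d
  simp only [halfOp, PMF.bind_bind, PMF.bind_map]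
  rfl

/-- The data block is the control when X errors are copied to the ancilla and the target when Z
errors are. After a swap of the pair both extractions have the same form, with the data first. -/
theorem copyRel_of_cnotRel {x y : MBlk k × MBlk k} (h : cnotRel x y) :
    copyRel false x y ∧ copyRel true x.swap y.swap := by
  obtain ⟨h1, h2⟩ := Prod.ext_iff.1 h
  simp only [cnotState] at h1 h2
  simp [copyRel, component, h1, h2]

theorem StepSim.swap_pair {op : Blk k × Blk k → PMF (Blk k × Blk k)}
    (h : StepSim pairErrors pairErrors op (Both (Well b k) (Well b k)) (Both (Well b k) (Well b k))
      cnotRel C) :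
    StepSim pairErrors pairErrors (fun x : Blk k × Blk k => (op x.swap).map Prod.swap)
      (Both (Well b k) (Well b k)) (Both (Well b k) (Well b k)) (copyRel true) C := by
  obtain ⟨K, l, h⟩ := h
  have hK : ∀ x y, (K x).map (fun r => (r.1.swap, r.2)) (y, true) = K x (y.swap, true) :=
    fun x y => map_involutive_apply (fun r => rfl) _ _
  have hs : ∀ m : MBlk k × MBlk k → ℝ≥0∞, Both (Well b k) (Well b k) m →
      Both (Well b k) (Well b k) fun x => m x.swap := fun m hm => ⟨hm.2, hm.1⟩
  have hi : ∀ m h : MBlk k × MBlk k → ℝ≥0∞,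
      integral m (fun x => h x.swap) = integral (fun x => m x.swap) h := fun m h =>
    (integral_equiv (Equiv.prodComm (MBlk k) (MBlk k)) m fun x => h x.swap).symm
  have hmass : ∀ m : MBlk k × MBlk k → ℝ≥0∞, (mass fun x : MBlk k × MBlk k => m x.swap) = mass m := fun m =>
    mass_equiv (Equiv.prodComm (MBlk k) (MBlk k)) m
  refine ⟨fun x => (K x.swap).map fun r => (r.1.swap, r.2), fun x => ?_, fun m hm hf => ?_,
    fun m hm hf => ?_, fun m hm hf x y hx hy => ?_⟩
  · change _ = (op (pairErrors x.swap)).map _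
    rw [← l x.swap, PMF.map_comp, PMF.map_comp]
    rfl
  · have h1 : okPart m (fun x => (K x.swap).map fun r => (r.1.swap, r.2)) =
        fun y => okPart (fun x => m x.swap) K y.swap := by
      ext y
      simp only [okPart, push, hK]
      exact hi m fun x => K x (y.swap, true)
    rw [h1]
    exact hs _ (h.ok _ (hs m hm) (by rwa [hmass]))
  · rw [← hmass m]
    refine le_trans (le_of_eq ?_) (h.fail _ (hs m hm) (by rwa [hmass]))
    rw [failMass, failMass, ← hi]
    exact integral_congr fun x _ => failProb_map _ _
  · rw [hK] at hy
    have := h.supp _ (hs m hm) (by rwa [hmass]) x.swap y.swap hx hy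
    exact (copyRel_of_cnotRel this).2

/-- Associativity of `bind`, up to the swaps that put the data first in the second extraction. -/
theorem correctionRound_eq (G : Gadgets k) (zero : Noise → PMF (Blk (k + 1))) (ν : Noise) :
    correctionRound G zero ν =
      roundOp (fun i => G.correct ((ν.sub 0).sub i)) (plusOf zero (ν.sub 1))
        (fun i x => G.cnot ((ν.sub 2).sub i) x.1 x.2) (zero (ν.sub 3))
        (fun i x => (G.cnot ((ν.sub 4).sub i) x.swap.1 x.swap.2).map Prod.swap) := by
  ext1 d
  have h : ∀ v w : Blk (k + 1),
      (transverse 7 fun i => (G.cnot ((ν.sub 4).sub i) (w i) (v i)).map Prod.swap) =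
        (transverse 7 fun i => G.cnot ((ν.sub 4).sub i) (w i) (v i)).map fun r i => (r i).swap :=
    fun v w => (transverse_map 7 _ fun _ => Prod.swap).symm
  simp only [roundOp, halfOp_eq, PMF.bind_map, Function.comp_def, Prod.swap_prod_mk, h]
  refine Eq.trans ?_ (PMF.bind_bind _ _ _).symm
  refine congrArg (PMF.bind _) (funext fun v => ?_)
  refine Eq.trans ?_ (PMF.bind_bind _ _ _).symm
  refine congrArg (PMF.bind _) (funext fun a => ?_)
  refine Eq.trans (PMF.bind_bind _ _ _) (Eq.trans ?_ (PMF.bind_bind _ _ _).symm)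
  refine congrArg (PMF.bind _) (funext fun r => ?_)
  refine Eq.trans (PMF.pure_bind _ _) (Eq.trans ?_ (PMF.pure_bind _ _).symm)
  refine congrArg (PMF.bind _) (funext fun z => ?_)
  refine Eq.trans (PMF.bind_bind _ _ _) ?_
  refine congrArg (PMF.bind _) (funext fun r => ?_)
  exact PMF.pure_bind _ _

theorem GadgetSpec.round {P : Noise → Prop} (hP : ∀ ν i, P ν → P (ν.sub i)) {G : Gadgets k}
    (h : GadgetSpec P b k G A B C) {zero : Noise → PMF (Blk (k + 1))} {A' a' : ℝ≥0∞}
    (hz : AncillaSpec P b k zero A' a') {ν : Noise} (hν : P ν) :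
    RoundParts b k A' a' B C (fun i => G.correct ((ν.sub 0).sub i)) (plusOf zero (ν.sub 1))
      (fun i x => G.cnot ((ν.sub 2).sub i) x.1 x.2) (zero (ν.sub 3))
      (fun i x => (G.cnot ((ν.sub 4).sub i) x.swap.1 x.swap.2).map Prod.swap) where
  well i := h.well _ (hP _ _ (hP _ _ hν))
  any i := h.any _ (hP _ _ (hP _ _ hν))
  anc₁ := by
    rw [plusOf, hadamardAll_eq]
    exact SourceSim.map_sym isSym_swap rfl (hz _ (hP _ _ hν))
  op₁ i := (h.cnot _ (hP _ _ (hP _ _ hν))).mono (fun _ h => h) (fun _ h => h)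
    (fun _ _ h => (copyRel_of_cnotRel h).1) le_rfl
  anc₂ := hz _ (hP _ _ hν)
  op₂ i := (h.cnot _ (hP _ _ (hP _ _ hν))).swap_pair

section Correction

variable {P : Noise → Prop} (hP : ∀ ν i, P ν → P (ν.sub i)) {G : Gadgets k}
  (h : GadgetSpec P b k G A B C) {zero : Noise → PMF (Blk (k + 1))} {A' a' : ℝ≥0∞}
  (hz : AncillaSpec P b k zero A' a') {ν : Noise} (hν : P ν)

include hP h hz hν

theorem GadgetSpec.correction_butOne :
    StepSim (MBlk.errors (k := k + 1)) (MBlk.errors (k := k + 1)) (correction G zero ν)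
      (Controlled (Well b k)) (Well b (k + 1)) (fun x y => mstate y = mstate x)
      (2 * (2 * A' + roundE₁ a' B C)) := by
  have := (h.round hP hz (hP ν 0 hν)).correction_butOne (h.round hP hz (hP ν 1 hν))
  simp only [← correctionRound_eq] at this
  exact this

variable (hc : roundE₁ a' B C + ENNReal.ofReal (b (k + 1)) * (2 * A' + roundE₂ a' B C) ≤
  ENNReal.ofReal (b (k + 1))) (h1 : 2 * A' + roundE₁ a' B C ≤ 1)

include hc h1

theorem GadgetSpec.correction_well :
    StepSim (MBlk.errors (k := k + 1)) (MBlk.errors (k := k + 1)) (correction G zero ν)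
      (Well b (k + 1)) (Well b (k + 1)) (fun x y => mstate y = mstate x)
      (2 * (2 * A') + 2 * roundE₂ a' B C + roundE₁ a' B C ^ 2 +
        ENNReal.ofReal (b (k + 1)) * roundE₁ a' B C) := by
  have := (h.round hP hz (hP ν 0 hν)).correction_well (h.round hP hz (hP ν 1 hν)) hc h1
  simp only [← correctionRound_eq] at this
  exact this

theorem GadgetSpec.correction_any :
    StepSim (MBlk.errors (k := k + 1)) (MBlk.errors (k := k + 1)) (correction G zero ν)
      (fun _ => True) (Well b (k + 1)) (fun _ _ => True)
      (2 * A' + roundE₂ a' B C + (2 * A' + roundE₁ a' B C) ^ 2) := by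
  have := (h.round hP hz (hP ν 0 hν)).correction_any (h.round hP hz (hP ν 1 hν)) hc h1
  simp only [← correctionRound_eq] at this
  exact this

end Correction

end Gadget
end SteaneFT

namespace SteaneFT
open scoped ENNReal

/-! ### The encoded CNOT gate -/

section Comap

variable {X Y Z X₀ Y₀ Z₀ : Type}

theorem integral_pushforward (m : Z → ℝ≥0∞) (f : Z → X) (h : X → ℝ≥0∞) :
    integral (fun x => integral m fun z => ind (x = f z)) h = integral m fun z => h (f z) := by
  rw [integral_mix]
  refine integral_congr fun z _ => ?_
  rw [integral, tsum_eq_single (f z)]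
  · rw [ind_of rfl, one_mul]
  · intro x hx
    rw [ind_of_not hx, zero_mul]

theorem StepSim.comap {eX : X → X₀} {eY : Y → Y₀} {eZ : Z → Z₀} {op : X₀ → PMF Y₀}
    {W : (X → ℝ≥0∞) → Prop} {W' : (Y → ℝ≥0∞) → Prop} {rel : X → Y → Prop} {q : ℝ≥0∞}
    (h : StepSim eX eY op W W' rel q) {V : (Z → ℝ≥0∞) → Prop} {f : Z → X} {f₀ : Z₀ → X₀}
    (hf : ∀ z, eX (f z) = f₀ (eZ z))
    (hV : ∀ m, V m → W fun x => integral m fun z => ind (x = f z)) :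
    StepSim eZ eY (fun z => op (f₀ z)) V W' (fun z y => rel (f z) y) q := by
  obtain ⟨K, l, h⟩ := h
  have hmass : ∀ m : Z → ℝ≥0∞, (mass fun x => integral m fun z => ind (x = f z)) = mass m := by
    intro m
    rw [← integral_one, integral_pushforward, integral_one]
  refine ⟨fun z => K (f z), fun z => ?_, fun m hm hfin => ?_, fun m hm hfin => ?_,
    fun m hm hfin z y hz hy => ?_⟩
  · rw [l (f z), hf]
  · have e : okPart m (fun z => K (f z)) = okPart (fun x => integral m fun z => ind (x = f z)) K :=
      funext fun y => (integral_pushforward m f fun x => K x (y, true)).symm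
    rw [e]
    exact h.ok _ (hV m hm) (by rwa [hmass])
  · have := h.fail _ (hV m hm) (by rwa [hmass])
    rw [hmass, failMass, integral_pushforward] at this
    exact this
  · refine h.supp _ (hV m hm) (by rwa [hmass]) (f z) y ?_ hy
    exact integral_ne_zero.2 ⟨z, hz, ind_ne_zero.2 rfl⟩

end Comap

section CNOT

variable {k : ℕ} {b : ℕ → ℝ} {A B B' C c : ℝ≥0∞}

/-- The first components of seven pairs, with a mark, and the second components. -/
def unzipConf (γ : Option (Fin 7)) (z : Fin 7 → MBlk k × MBlk k) : MConf k × MConf k :=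
  ((γ, fun i => (z i).1), (γ, fun i => (z i).2))

/-- The distributions of seven pairs for which both components are controlled if `γ` is the mark. -/
def PairGiven (b : ℕ → ℝ) (k : ℕ) (γ : Option (Fin 7)) (m : (Fin 7 → MBlk k × MBlk k) → ℝ≥0∞) :
    Prop :=
  Joint (Off (markSet γ) (Both (Well b k) (Well b k))) m ∧
    ∀ z, m z ≠ 0 → PNear γ (states fun i => (z i).1) ∧ PNear γ (states fun i => (z i).2)

theorem eq_unzipConf_iff {γ : Option (Fin 7)} {p q : MConf k} {z : Fin 7 → MBlk k × MBlk k} :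
    (p, q) = unzipConf γ z ↔ (p.1 = γ ∧ q.1 = γ) ∧ z = fun i => (p.2 i, q.2 i) := by
  obtain ⟨g, v⟩ := p
  obtain ⟨g', v'⟩ := q
  simp only [unzipConf, funext_iff, Prod.ext_iff]
  exact ⟨fun h => ⟨⟨h.1.1, h.2.1⟩, fun i => ⟨(h.1.2 i).symm, (h.2.2 i).symm⟩⟩,
    fun h => ⟨⟨h.1.1, fun i => (h.2 i).1.symm⟩, h.1.2, fun i => (h.2 i).2.symm⟩⟩

theorem push_unzipConf (γ : Option (Fin 7)) (m : (Fin 7 → MBlk k × MBlk k) → ℝ≥0∞) (p q : MConf k) :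
    (integral m fun z => ind ((p, q) = unzipConf γ z)) =
      ind (p.1 = γ ∧ q.1 = γ) * m fun i => (p.2 i, q.2 i) := by
  simp only [eq_unzipConf_iff, ind_and (p.1 = γ ∧ q.1 = γ)]
  rw [integral_const_mul, apply_eq_integral m]
  congr 1
  exact integral_congr fun z _ => ind_congr eq_comm

theorem zip_update (v w : Fin 7 → MBlk k) (i : Fin 7) (x : MBlk k) :
    (fun j => (Function.update v i x j, w j)) =
        Function.update (fun j => (v j, w j)) i (x, w i) ∧
      (fun j => (w j, Function.update v i x j)) =
        Function.update (fun j => (w j, v j)) i (w i, x) := by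
  constructor <;>
  · ext1 j
    by_cases h : j = i
    · subst h; simp
    · simp [h]

/-- Both halves receive the mark `γ`, so the slices at any other mark vanish; at `γ` the condition
on one half is a slice of the joint condition on the pairs. -/
theorem PairGiven.both_controlled {γ : Option (Fin 7)} {m : (Fin 7 → MBlk k × MBlk k) → ℝ≥0∞}
    (hm : PairGiven b k γ m) :
    Both (X := MConf k) (X' := MConf k) (Controlled (Well b k)) (Controlled (Well b k))
      fun x => integral m fun z => ind (x = unzipConf γ z) := by
  constructor
  · intro q
    simp only [push_unzipConf]
    refine controlled_iff_wellOff.2 ⟨fun p hp => ?_, fun g i v hi => ?_⟩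
    · rw [(ind_ne_zero.1 (left_ne_zero_of_mul hp)).1]
      exact (hm.2 _ (right_ne_zero_of_mul hp)).1
    · by_cases hg : g = γ ∧ q.1 = γ
      · simp only [ind_of hg, one_mul, (zip_update _ _ _ _).1]
        exact (hm.1 i _ (by rwa [← hg.1])).1 _
      · simp only [ind_of_not hg, zero_mul]
        exact (isCone_well k).zero
  · intro p
    simp only [push_unzipConf]
    refine controlled_iff_wellOff.2 ⟨fun q hq => ?_, fun g i v hi => ?_⟩
    · rw [(ind_ne_zero.1 (left_ne_zero_of_mul hq)).2]
      exact (hm.2 _ (right_ne_zero_of_mul hq)).2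
    · by_cases hg : p.1 = γ ∧ g = γ
      · simp only [ind_of hg, one_mul, (zip_update _ _ _ _).2]
        exact (hm.1 i _ (by rwa [← hg.2])).2 _
      · simp only [ind_of_not hg, zero_mul]
        exact (isCone_well k).zero

theorem PairGiven.both_well {m : (Fin 7 → MBlk k × MBlk k) → ℝ≥0∞} (hm : PairGiven b k none m) :
    Both (X := MConf k) (X' := MConf k) (Well b (k + 1)) (Well b (k + 1))
      fun x => integral m fun z => ind (x = unzipConf none z) := by
  have h := hm.both_controlled
  refine ⟨fun q => (h.1 q).well_of_unmarked fun p hp => ?_,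
    fun p => (h.2 p).well_of_unmarked fun q hq => ?_⟩
  · exact (ind_ne_zero.1 (left_ne_zero_of_mul ((push_unzipConf none m p q).symm.trans_ne hp))).1
  · exact (ind_ne_zero.1 (left_ne_zero_of_mul ((push_unzipConf none m p q).symm.trans_ne hq))).2

/-- Merge the marks of two blocks; if both are marked, this is a failure. -/
noncomputable def mergeK (x : MConf k × MConf k) :
    PMF ((Option (Fin 7) × (Fin 7 → MBlk k × MBlk k)) × Bool) :=
  PMF.pure ((x.1.1.or x.2.1, fun i => (x.1.2 i, x.2.2 i)), !(x.1.1.isSome && x.2.1.isSome))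

theorem mergeK_true {x : MConf k × MConf k} {s : Option (Fin 7) × (Fin 7 → MBlk k × MBlk k)}
    (h : mergeK x (s, true) ≠ 0) : (x.1.1 = none ∨ x.1.1 = s.1) ∧ (x.2.1 = none ∨ x.2.1 = s.1) ∧
      s.2 = fun i => (x.1.2 i, x.2.2 i) := by
  replace h : (s, true) = ((x.1.1.or x.2.1, fun i => (x.1.2 i, x.2.2 i)),
      !(x.1.1.isSome && x.2.1.isSome)) := by
    by_contra h'
    exact h (by rw [mergeK, PMF.pure_apply]; exact if_neg h')
  simp only [Prod.ext_iff] at h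
  obtain ⟨⟨h1, h2⟩, h3⟩ := h
  refine ⟨?_, ?_, h2⟩
  · rw [h1]; cases x.1.1 <;> simp
  · rw [h1]
    cases hx : x.1.1
    · simp
    · cases hy : x.2.1
      · simp
      · simp [hx, hy] at h3

theorem okPart_mergeK (m : MConf k × MConf k → ℝ≥0∞) (γ : Option (Fin 7))
    (z : Fin 7 → MBlk k × MBlk k) :
    okPart m mergeK (γ, z) = integral (fun g : Option (Fin 7) × Option (Fin 7) =>
      ind (γ = g.1.or g.2 ∧ ¬(g.1.isSome ∧ g.2.isSome))) fun g =>
        m ((g.1, fun i => (z i).1), (g.2, fun i => (z i).2)) := by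
  let e : (Option (Fin 7) × Option (Fin 7)) × ((Fin 7 → MBlk k) × (Fin 7 → MBlk k)) ≃
      MConf k × MConf k :=
    ⟨fun p => ((p.1.1, p.2.1), (p.1.2, p.2.2)), fun p => ((p.1.1, p.2.1), (p.1.2, p.2.2)),
      fun _ => rfl, fun _ => rfl⟩
  rw [okPart, push, ← integral_equiv e, integral_prod]
  refine tsum_congr fun g => ?_
  rw [integral, tsum_eq_single (fun i => (z i).1, fun i => (z i).2), mul_comm]
  · congr 1
    simp only [mergeK, PMF.pure_apply, e, ind]
    congr 1
    obtain ⟨_ | _, _ | _⟩ := g <;> simp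
  · rintro v hv
    rw [mul_eq_zero]
    right
    by_contra h
    have := (mergeK_true h).2.2
    simp only at this
    exact hv (by simp [this, e])

/-- A position outside the merged mark is outside the marks of both blocks. For each pair of marks
that merge to `γ`, both components are therefore well there, and the pairs of marks are summed by
the cone property. -/
theorem pairWellOff_mergeK {m : MConf k × MConf k → ℝ≥0∞}
    (hm : Both (X := MConf k) (X' := MConf k) (Controlled (Well b k)) (Controlled (Well b k)) m) :
    PairWellOff b k (okPart m mergeK) := by
  intro γ i v hi
  simp only [okPart_mergeK]
  refine ((isCone_well k).both (isCone_well k)) _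
    (fun (g : Option (Fin 7) × Option (Fin 7)) x => m ((g.1, fun j => (Function.update v i x j).1),
      (g.2, fun j => (Function.update v i x j).2))) fun g hg => ?_
  obtain ⟨hg, hg'⟩ := ind_ne_zero.1 hg
  have hfst : ∀ x : MBlk k × MBlk k, (fun j => (Function.update v i x j).1) =
      Function.update (fun j => (v j).1) i x.1 := by
    intro x; ext1 j; by_cases h : j = i
    · subst h; simp
    · simp [h]
  have hsnd : ∀ x : MBlk k × MBlk k, (fun j => (Function.update v i x j).2) =
      Function.update (fun j => (v j).2) i x.2 := by
    intro x; ext1 j; by_cases h : j = i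
    · subst h; simp
    · simp [h]
  simp only [hfst, hsnd]
  have h1 : i ∉ markSet g.1 := by
    intro h; apply hi; rw [hg]; rw [markSet, Set.mem_ofPred_eq] at h ⊢; rw [h]; rfl
  have h2 : i ∉ markSet g.2 := by
    intro h
    rw [markSet, Set.mem_ofPred_eq] at h
    apply hi
    rw [hg, markSet, Set.mem_ofPred_eq, h]
    cases h' : g.1
    · rfl
    · simp [h, h'] at hg'
  exact ⟨fun y => (controlled_iff_wellOff.1 (hm.1 (g.2, Function.update (fun j => (v j).2) i y))).2 _ i
      (fun j => (v j).1) h1,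
    fun y => (controlled_iff_wellOff.1 (hm.2 (g.1, Function.update (fun j => (v j).1) i y))).2 _ i
      (fun j => (v j).2) h2⟩

theorem integral_prod' {X Y : Type} (m h : X × Y → ℝ≥0∞) :
    integral m h = ∑' y, integral (fun x => m (x, y)) fun x => h (x, y) := by
  rw [← integral_equiv (Equiv.prodComm Y X), integral_prod]
  rfl

section Marks

variable {m : MConf k × MConf k → ℝ≥0∞}
  (hm : Both (X := MConf k) (X' := MConf k) (Well b (k + 1)) (Well b (k + 1)) m)

include hm

theorem integral_marked_fst_le : (integral m fun x => ind (x.1.1 ≠ none)) ≤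
    ENNReal.ofReal (b (k + 1)) * mass m := by
  rw [← integral_one m, integral_prod', integral_prod' m, ← ENNReal.tsum_mul_left]
  refine ENNReal.tsum_le_tsum fun y => ?_
  rw [integral_one]
  exact (hm.1 y).markedMass_le

theorem integral_marked_snd_le : (integral m fun x => ind (x.2.1 ≠ none)) ≤
    ENNReal.ofReal (b (k + 1)) * mass m := by
  rw [← integral_one m, integral_prod, integral_prod m, ← ENNReal.tsum_mul_left]
  refine ENNReal.tsum_le_tsum fun y => ?_
  rw [integral_one]
  exact (hm.2 y).markedMass_le

/-- The blocks may be correlated. The factor `b (k + 1)` occurs twice because the wellness of the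
first block is conditional on all of the second, including its mark. -/
theorem integral_marked_both_le : (integral m fun x => ind (x.1.1 ≠ none) * ind (x.2.1 ≠ none)) ≤
    ENNReal.ofReal (b (k + 1)) ^ 2 * mass m := by
  have h := mul_le_mul_right (integral_marked_snd_le hm) (ENNReal.ofReal (b (k + 1)))
  rw [← mul_assoc, ← sq] at h
  refine le_trans ?_ h
  rw [integral_prod', integral_prod', ← ENNReal.tsum_mul_left]
  refine ENNReal.tsum_le_tsum fun y => ?_
  by_cases hy : y.1 = none
  · simp [hy, ind, integral]
  · simp only [ind_of hy, mul_one, integral_one]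
    exact (hm.1 y).markedMass_le

theorem markedMass_mergeK_le :
    markedMass (okPart m mergeK) ≤ 2 * ENNReal.ofReal (b (k + 1)) * mass m := by
  rw [two_mul, add_mul]
  refine le_trans ?_ (add_le_add (integral_marked_fst_le hm) (integral_marked_snd_le hm))
  rw [markedMass, integral_okPart, ← integral_add]
  refine integral_mono fun x _ => ?_
  rw [mergeK, integral_pure]
  refine (mul_le_of_le_one_left' (ind_le_one _)).trans ?_
  cases h1 : x.1.1 <;> cases h2 : x.2.1 <;> simp [ind]

theorem failMass_mergeK_le :
    failMass m mergeK ≤ ENNReal.ofReal (b (k + 1)) ^ 2 * mass m := by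
  refine le_trans ?_ (integral_marked_both_le hm)
  refine integral_mono fun x _ => ?_
  rw [failProb, mergeK, integral_pure]
  cases h1 : x.1.1 <;> cases h2 : x.2.1 <;> simp [ind]

end Marks

/-- Two corrections after transverse CNOT gates. -/
theorem StepSim.correct_pair {corr₁ corr₂ : Blk (k + 1) → PMF (Blk (k + 1))}
    {W : (MConf k → ℝ≥0∞) → Prop} {q : ℝ≥0∞} {γ : Option (Fin 7)}
    (h₁ : StepSim confErrors confErrors corr₁ W (Well b (k + 1))
      (fun x y => decode (states y.2) = decode (states x.2)) q)
    (h₂ : StepSim confErrors confErrors corr₂ W (Well b (k + 1))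
      (fun x y => decode (states y.2) = decode (states x.2)) q)
    (hW : ∀ m, PairGiven b k γ m → Both W W fun x => integral m fun z => ind (x = unzipConf γ z)) :
    StepSim pairsErrors (fun x : MConf k × MConf k => (confErrors x.1, confErrors x.2))
      (fun z => (corr₁ fun i => (z i).1).bind fun c => (corr₂ fun i => (z i).2).map fun t => (c, t))
      (PairGiven b k γ) (Both (X := MConf k) (X' := MConf k) (Well b (k + 1)) (Well b (k + 1)))
      (fun z y => decode (states y.1.2) = decode (states fun i => (z i).1) ∧
        decode (states y.2.2) = decode (states fun i => (z i).2)) (2 * q) :=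
  ((h₁.prod h₂ (isCone_well (k + 1)) (isCone_well (k + 1))).comap (f := unzipConf γ)
    (f₀ := fun z : Fin 7 → Blk k × Blk k => (fun i => (z i).1, fun i => (z i).2))
    (eZ := pairsErrors) (fun _ => rfl) hW).mono (fun _ h => h) (fun _ h => h) (fun _ _ h => h)
      (two_mul q).ge

/-- Merge of the marks and transverse CNOT gates, and then corrections that depend on the mark. -/
theorem StepSim.cnot {op : Fin 7 → Blk k × Blk k → PMF (Blk k × Blk k)}
    {corr₁ corr₂ : Blk (k + 1) → PMF (Blk (k + 1))} {B B' C : ℝ≥0∞}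
    (hop : ∀ i, StepSim pairErrors pairErrors (op i) (Both (Well b k) (Well b k))
      (Both (Well b k) (Well b k)) cnotRel C)
    (hw₁ : StepSim confErrors confErrors corr₁ (Well b (k + 1)) (Well b (k + 1))
      (fun x y => decode (states y.2) = decode (states x.2)) B)
    (hw₂ : StepSim confErrors confErrors corr₂ (Well b (k + 1)) (Well b (k + 1))
      (fun x y => decode (states y.2) = decode (states x.2)) B)
    (hb₁ : StepSim confErrors confErrors corr₁ (Controlled (Well b k)) (Well b (k + 1))
      (fun x y => decode (states y.2) = decode (states x.2)) B')
    (hb₂ : StepSim confErrors confErrors corr₂ (Controlled (Well b k)) (Well b (k + 1))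
      (fun x y => decode (states y.2) = decode (states x.2)) B') :
    StepSim (fun x : MConf k × MConf k => (confErrors x.1, confErrors x.2))
      (fun x : MConf k × MConf k => (confErrors x.1, confErrors x.2))
      (fun x => (transverse 7 fun i => op i (x.1 i, x.2 i)).bind fun z =>
        (corr₁ fun i => (z i).1).bind fun c => (corr₂ fun i => (z i).2).map fun t => (c, t))
      (Both (X := MConf k) (X' := MConf k) (Well b (k + 1)) (Well b (k + 1)))
      (Both (X := MConf k) (X' := MConf k) (Well b (k + 1)) (Well b (k + 1)))
      (fun x y => (decode (states y.1.2), decode (states y.2.2)) =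
        cnotState (decode (states x.1.2)) (decode (states x.2.2)))
      (2 * B + 2 * B' * (2 * ENNReal.ofReal (b (k + 1)) + 7 * C) + 21 * C ^ 2 +
        7 * C * (2 * ENNReal.ofReal (b (k + 1))) + ENNReal.ofReal (b (k + 1)) ^ 2) := by
  obtain ⟨K₂, l₂, h₂⟩ := FTSim.transverse_pairs hop
  obtain ⟨F₀, lF₀, hF₀⟩ := StepSim.correct_pair (γ := none) hw₁ hw₂ fun m hm => hm.both_well
  choose F lF hF using fun j : Fin 7 =>
    StepSim.correct_pair (γ := some j) hb₁ hb₂ fun m hm => hm.both_controlled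
  -- Without a mark both blocks are well before the corrections, which then fail with probability
  -- `B`. With a mark they have a common uncontrolled position and are only controlled, at the price
  -- `B'`.
  let K₃ : Option (Fin 7) → (Fin 7 → MBlk k × MBlk k) → PMF ((MConf k × MConf k) × Bool) := fun γ =>
    match γ with
    | none => F₀
    | some j => F j
  have hK₃ : ∀ γ, Step (PairGiven b k γ)
      (Both (X := MConf k) (X' := MConf k) (Well b (k + 1)) (Well b (k + 1)))
      (fun z y => decode (states y.1.2) = decode (states fun i => (z i).1) ∧
        decode (states y.2.2) = decode (states fun i => (z i).2)) ⊤ (K₃ γ) := by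
    rintro (_ | j)
    · exact hF₀.mono (fun _ h => h) (fun _ h => h) (fun _ _ h => h) le_top
    · exact (hF j).mono (fun _ h => h) (fun _ h => h) (fun _ _ h => h) le_top
  have hcone : IsCone (Both (X := MConf k) (X' := MConf k) (Well b (k + 1)) (Well b (k + 1))) :=
    (isCone_well (k + 1)).both (isCone_well (k + 1))
  have h₃ := Step.branch hK₃ hcone
  have l₁ : Lifts (fun x : MConf k × MConf k => (confErrors x.1, confErrors x.2))
      (fun s : Option (Fin 7) × (Fin 7 → MBlk k × MBlk k) => pairsErrors s.2)
      (fun x => PMF.pure fun i => (x.1 i, x.2 i)) mergeK := fun x => PMF.pure_map _ _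
  have l₃ : Lifts (fun s : Option (Fin 7) × (Fin 7 → MBlk k × MBlk k) => pairsErrors s.2)
      (fun x : MConf k × MConf k => (confErrors x.1, confErrors x.2))
      (fun z => (corr₁ fun i => (z i).1).bind fun c => (corr₂ fun i => (z i).2).map fun t => (c, t))
      (fun s => K₃ s.1 s.2) := by
    rintro ⟨_ | j, z⟩
    · exact lF₀ z
    · exact lF j z
  have hsurj : Function.Surjective
      (fun x : MConf k × MConf k => (confErrors x.1, confErrors x.2)) :=
    confErrors_surjective.prodMap confErrors_surjective
  have l := (l₁.seqK l₂ (surjective_comp_snd pairsErrors_surjective)).seqK l₃ hsurj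
  -- the guarantees for the intermediate distributions
  have key : ∀ m : MConf k × MConf k → ℝ≥0∞,
      Both (X := MConf k) (X' := MConf k) (Well b (k + 1)) (Well b (k + 1)) m → mass m ≠ ⊤ →
      PairWellOff b k (okPart m mergeK) ∧ mass (okPart m mergeK) ≠ ⊤ ∧
      (∀ x s t, m x ≠ 0 → mergeK x (s, true) ≠ 0 → K₂ s (t, true) ≠ 0 →
        (PNear t.1 (states fun i => (t.2 i).1) ∧ PNear t.1 (states fun i => (t.2 i).2)) ∧
        (decode (states fun i => (t.2 i).1), decode (states fun i => (t.2 i).2)) =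
          cnotState (decode (states x.1.2)) (decode (states x.2.2))) ∧
      ∀ γ, PairGiven b k γ fun z => okPart (okPart m mergeK) K₂ (γ, z) := by
    intro m hm hf
    have hmc : Both (X := MConf k) (X' := MConf k) (Controlled (Well b k)) (Controlled (Well b k)) m :=
      ⟨fun y => (well_succ_iff.1 (hm.1 y)).1, fun y => (well_succ_iff.1 (hm.2 y)).1⟩
    have hw := pairWellOff_mergeK hmc
    have hf1 := mass_okPart_ne_top hf mergeK
    have hrel : ∀ x s t, m x ≠ 0 → mergeK x (s, true) ≠ 0 → K₂ s (t, true) ≠ 0 →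
        (PNear t.1 (states fun i => (t.2 i).1) ∧ PNear t.1 (states fun i => (t.2 i).2)) ∧
        (decode (states fun i => (t.2 i).1), decode (states fun i => (t.2 i).2)) =
          cnotState (decode (states x.1.2)) (decode (states x.2.2)) := by
      rintro ⟨⟨g₁, v₁⟩, ⟨g₂, v₂⟩⟩ ⟨γ, z⟩ t hx hs ht
      have hrel := h₂.supp _ hw hf1 (γ, z) t (okPart_ne_zero.2 ⟨_, hx, hs⟩) ht
      obtain ⟨h1, h2, h3⟩ := mergeK_true hs
      dsimp only at h1 h2 h3
      subst h3
      have hn : ∀ (g : Option (Fin 7)) (v : Fin 7 → Pauli), (g = none ∨ g = γ) → PNear g v →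
          PNear t.1 v := by
        rintro g v (rfl | rfl) h
        · exact h.of_none _
        · rcases hrel.1 with h' | h'
          · dsimp only at h'; rw [h'] at h; exact h.of_none _
          · rw [h']; exact h
      have hp1 := hn _ _ h1 ((controlled_iff_wellOff.1 (hmc.1 _)).1 _ hx)
      have hp2 := hn _ _ h2 ((controlled_iff_wellOff.1 (hmc.2 _)).1 _ hx)
      obtain ⟨⟨h4, h5⟩, h6⟩ := hp1.cnot hp2
      have h7 := h4.congr (s' := states fun i => (t.2 i).1) fun i hi =>
        (Prod.ext_iff.1 (hrel.2 i hi)).1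
      have h8 := h5.congr (s' := states fun i => (t.2 i).2) fun i hi =>
        (Prod.ext_iff.1 (hrel.2 i hi)).2
      exact ⟨⟨h7.1, h8.1⟩, by rw [h7.2, h8.2, h6]⟩
    refine ⟨hw, hf1, hrel, fun γ => ⟨(h₂.ok _ hw hf1) γ, fun z hz => ?_⟩⟩
    obtain ⟨s, hs, hz⟩ := okPart_ne_zero.1 hz
    obtain ⟨x, hx, hs⟩ := okPart_ne_zero.1 hs
    exact (hrel x s _ hx hs hz).1
  refine ⟨_, fun x => (l x).trans ?_, fun m hm hf => ?_, fun m hm hf => ?_,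
    fun m hm hf x y hx hy => ?_⟩
  · simp only [PMF.pure_bind]
  · obtain ⟨hw, hf1, hrel, hg⟩ := key m hm hf
    rw [okPart_seqK, okPart_seqK]
    exact h₃.ok _ hg (mass_okPart_ne_top hf1 _)
  · obtain ⟨hw, hf1, hrel, hg⟩ := key m hm hf
    have hf2 := mass_okPart_ne_top hf1 K₂
    have hs := mass_slice_ne_top hf2
    have e1 := failMass_mergeK_le hm
    have e2 := h₂.fail _ hw hf1
    have e3 : failMass (okPart (okPart m mergeK) K₂) (fun s => K₃ s.1 s.2) ≤
        2 * B * unmarkedMass (okPart (okPart m mergeK) K₂) +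
          2 * B' * markedMass (okPart (okPart m mergeK) K₂) := by
      rw [failMass_branch, tsum_fintype, Fintype.sum_option, unmarkedMass_eq, markedMass_eq_sum,
        Finset.mul_sum]
      exact add_le_add (hF₀.fail _ (hg none) (hs none)) (Finset.sum_le_sum fun j _ =>
        (hF j).fail _ (hg (some j)) (hs (some j)))
    have e4 := markedMass_mergeK_le hm
    have e5 : unmarkedMass (okPart m mergeK) ≤ mass m :=
      (unmarkedMass_le _).trans (mass_okPart_le _ _)
    have e6 : unmarkedMass (okPart (okPart m mergeK) K₂) ≤ mass m :=
      ((unmarkedMass_le _).trans (mass_okPart_le _ _)).trans (mass_okPart_le _ _)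
    have e7 := h₂.marked _ hw hf1
    rw [failMass_seqK, failMass_seqK, okPart_seqK]
    -- In this order: both inputs marked; two faulty gates; an incoming mark and a faulty gate;
    -- failing corrections without a mark; failing corrections with a mark, which is incoming or due
    -- to a faulty gate.
    calc _ ≤ ENNReal.ofReal (b (k + 1)) ^ 2 * mass m + (0 * mass (okPart m mergeK) +
          21 * C ^ 2 * mass m + 7 * C * (2 * ENNReal.ofReal (b (k + 1)) * mass m)) +
          (2 * B * mass m + 2 * B' * (2 * ENNReal.ofReal (b (k + 1)) * mass m + 7 * C * mass m)) := by
            refine add_le_add (add_le_add e1 (e2.trans ?_)) (e3.trans ?_)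
            · gcongr
            · gcongr
              exact e7.trans (by gcongr)
      _ = _ := by ring
  · obtain ⟨hw, hf1, hrel, hg⟩ := key m hm hf
    obtain ⟨t, ht, hy⟩ := seqK_true_ne_zero hy
    obtain ⟨s, hs, ht⟩ := seqK_true_ne_zero ht
    have hr := h₃.supp _ hg (mass_okPart_ne_top hf1 _) t y
      (okPart_ne_zero.2 ⟨s, okPart_ne_zero.2 ⟨x, hx, hs⟩, ht⟩) hy
    rw [hr.1, hr.2]
    exact (hrel x s t hx hs ht).2

end CNOT
end SteaneFT

namespace SteaneFT
open scoped ENNReal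

section Gadget

variable {k : ℕ} {b : ℕ → ℝ} {A B B' C : ℝ≥0∞}

/-- Transverse CNOT gates followed by corrections. -/
noncomputable def cnotOp (G : Gadgets k) (corr : Noise → Blk (k + 1) → PMF (Blk (k + 1)))
    (ν : Noise) (c t : Blk (k + 1)) : PMF (Blk (k + 1) × Blk (k + 1)) := do
  let r ← transverseCNOT G (ν.sub 0) c t
  let c' ← corr (ν.sub 1) r.1
  let t' ← corr (ν.sub 2) r.2
  pure (c', t')

theorem GadgetSpec.cnot_succ {P : Noise → Prop} (hP : ∀ ν i, P ν → P (ν.sub i)) {G : Gadgets k}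
    (h : GadgetSpec P b k G A B C) {corr : Noise → Blk (k + 1) → PMF (Blk (k + 1))} {Bn B' : ℝ≥0∞}
    (hw : ∀ ν, P ν → StepSim (MBlk.errors (k := k + 1)) (MBlk.errors (k := k + 1)) (corr ν)
      (Well b (k + 1)) (Well b (k + 1)) (fun x y => mstate y = mstate x) Bn)
    (hb : ∀ ν, P ν → StepSim (MBlk.errors (k := k + 1)) (MBlk.errors (k := k + 1)) (corr ν)
      (Controlled (Well b k)) (Well b (k + 1)) (fun x y => mstate y = mstate x) B')
    {ν : Noise} (hν : P ν) :
    StepSim (pairErrors (k := k + 1)) (pairErrors (k := k + 1)) (fun x => cnotOp G corr ν x.1 x.2)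
      (Both (Well b (k + 1)) (Well b (k + 1))) (Both (Well b (k + 1)) (Well b (k + 1))) cnotRel
      (2 * Bn + 2 * B' * (2 * ENNReal.ofReal (b (k + 1)) + 7 * C) + 21 * C ^ 2 +
        7 * C * (2 * ENNReal.ofReal (b (k + 1))) + ENNReal.ofReal (b (k + 1)) ^ 2) := by
  have h1 := StepSim.cnot (corr₁ := corr (ν.sub 1)) (corr₂ := corr (ν.sub 2))
    (fun i : Fin 7 => h.cnot ((ν.sub 0).sub i) (hP _ _ (hP _ _ hν)))
    (hw _ (hP _ _ hν)) (hw _ (hP _ _ hν)) (hb _ (hP _ _ hν)) (hb _ (hP _ _ hν))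
  have e : (fun x : Blk (k + 1) × Blk (k + 1) => cnotOp G corr ν x.1 x.2) = fun x =>
      (transverse 7 fun i => G.cnot ((ν.sub 0).sub i) (x.1 i) (x.2 i)).bind fun z =>
        (corr (ν.sub 1) fun i => (z i).1).bind fun c =>
          (corr (ν.sub 2) fun i => (z i).2).map fun t => (c, t) :=
    funext fun x => PMF.bind_map _ _ _
  rw [e]
  exact h1

end Gadget

/-! ### Preparation of ancillas -/

section Pair

variable {X X₀ : Type} {n : ℕ}

theorem integral_pair [Nonempty X] {c t : Fin n} (hct : c ≠ t) (m : (Fin n → X) → ℝ≥0∞) (x y : X) :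
    (integral m fun v => ind ((x, y) = (v c, v t))) =
      ∑' r : {j // j ≠ c} → X, ind (y = r ⟨t, hct.symm⟩) * m (Function.update (extend c r) c x) := by
  rw [integral_split c]
  refine tsum_congr fun r => ?_
  have h : ∀ z : X, ind ((x, y) = (Function.update (extend c r) c z c,
      Function.update (extend c r) c z t)) = ind (y = r ⟨t, hct.symm⟩) * ind (x = z) := by
    intro z
    rw [← ind_and]
    refine ind_congr ?_
    simp [extend, hct.symm, and_comm]
  simp only [h]
  rw [integral_const_mul, ← apply_eq_integral]

/-- `Joint` fixes all remaining coordinates, whereas here only the partner in the pair is fixed; the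
remaining ones are summed out, which is a mixture. -/
theorem Joint.both [Nonempty X] {W : (X → ℝ≥0∞) → Prop} (hW : IsCone W) {c t : Fin n} (hct : c ≠ t)
    {m : (Fin n → X) → ℝ≥0∞} (hm : Joint (fun _ => W) m) :
    Both W W fun p => integral m fun v => ind (p = (v c, v t)) := by
  constructor
  · intro y
    simp only [integral_pair hct]
    exact hW.tsum fun r => hW.smul (hm c _) _
  · intro x
    have : ∀ y, (integral m fun v => ind ((x, y) = (v c, v t))) =
        integral m fun v => ind ((y, x) = (v t, v c)) := fun y =>
      integral_congr fun v _ => ind_congr (by simp [Prod.ext_iff, and_comm])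
    simp only [this, integral_pair hct.symm]
    exact hW.tsum fun r => hW.smul (hm t _) _

/-- Apply a kernel to two of the components of a configuration. -/
noncomputable def atPair (c t : Fin n) (K : X × X → PMF ((X × X) × Bool)) (v : Fin n → X) :
    PMF ((Fin n → X) × Bool) :=
  (K (v c, v t)).map fun r => (Function.update (Function.update v c r.1.1) t r.1.2, r.2)

theorem atPair_true {c t : Fin n} (hct : c ≠ t) (K : X × X → PMF ((X × X) × Bool))
    (v w : Fin n → X) : atPair c t K v (w, true) =
      ind (∀ j, j ≠ c → j ≠ t → w j = v j) * K (v c, v t) ((w c, w t), true) := by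
  rw [atPair, map_apply_eq_integral, apply_eq_integral (K _), ← integral_const_mul]
  refine integral_congr fun r _ => ?_
  rw [← ind_and]
  refine ind_congr ?_
  simp only [Prod.ext_iff, funext_iff]
  constructor
  · rintro ⟨h1, h2⟩
    refine ⟨fun j hj hj' => by simpa [hj, hj'] using h1 j, ⟨?_, ?_⟩, h2⟩
    · simpa [hct] using h1 c
    · simpa using h1 t
  · rintro ⟨h1, ⟨h2, h3⟩, h4⟩
    refine ⟨fun j => ?_, h4⟩
    by_cases hj : j = t
    · subst hj; simpa using h3
    · by_cases hj' : j = c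
      · subst hj'; simpa [hj] using h2
      · simpa [hj, hj'] using h1 j hj' hj

theorem okPart_atPair {c t : Fin n} (hct : c ≠ t) (m : (Fin n → X) → ℝ≥0∞)
    (K : X × X → PMF ((X × X) × Bool)) (w : Fin n → X) :
    okPart m (atPair c t K) w = integral
      (fun p => m (Function.update (Function.update w c p.1) t p.2)) fun p =>
        K p ((w c, w t), true) := by
  have hinj : Function.Injective fun p : X × X => Function.update (Function.update w c p.1) t p.2 := by
    intro p q h
    have h1 := congrFun h c
    have h2 := congrFun h t
    simp only [Function.update_self, Function.update_of_ne hct] at h1 h2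
    exact Prod.ext h1 h2
  rw [okPart, push, integral, ← hinj.tsum_eq]
  · refine tsum_congr fun p => ?_
    rw [atPair_true hct, ind_of, one_mul]
    · simp [hct]
    · intro j hj hj'; simp [hj, hj']
  · intro v hv
    have hv := right_ne_zero_of_mul hv
    rw [atPair_true hct] at hv
    have := ind_ne_zero.1 (left_ne_zero_of_mul hv)
    refine ⟨(v c, v t), funext fun j => ?_⟩
    by_cases hj : j = t
    · subst hj; simp
    · by_cases hj' : j = c
      · subst hj'; simp [hj]
      · simpa [hj, hj'] using this j hj' hj

/-- For a coordinate of the pair, the other coordinates are frozen and the guarantee of `K` applies.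
For a spectator, the output is a mixture over the previous values of the pair. -/
theorem Step.atPair [Nonempty X] {W : (X → ℝ≥0∞) → Prop} (hW : IsCone W)
    {rel : X × X → X × X → Prop} {q : ℝ≥0∞} {K : X × X → PMF ((X × X) × Bool)}
    (h : Step (Both W W) (Both W W) rel q K) {c t : Fin n} (hct : c ≠ t) :
    Step (Joint fun _ => W) (Joint fun _ => W)
      (fun v w => rel (v c, v t) (w c, w t) ∧ ∀ j, j ≠ c → j ≠ t → w j = v j) q
      (SteaneFT.atPair c t K) := by
  have hmass : ∀ m : (Fin n → X) → ℝ≥0∞,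
      (mass fun p => integral m fun v => ind (p = (v c, v t))) = mass m := by
    intro m
    rw [← integral_one, integral_pushforward, integral_one]
  refine ⟨fun m hm hf i w => ?_, fun m hm hf => ?_, fun m hm hf v w hv hw => ?_⟩
  · simp only [okPart_atPair hct]
    have hpair : ∀ w, Both W W fun p : X × X =>
        m (Function.update (Function.update w c p.1) t p.2) := by
      intro w
      refine ⟨fun y => ?_, fun x => hm t (Function.update w c x)⟩
      simp only [Function.update_comm hct]
      exact hm c _
    have hpf : ∀ w : Fin n → X,
        (mass fun p : X × X => m (Function.update (Function.update w c p.1) t p.2)) ≠ ⊤ := by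
      intro w
      refine mass_comp_ne_top (f := fun p : X × X => Function.update (Function.update w c p.1) t p.2)
        (fun p q h => ?_) hf
      have h1 := congrFun h c
      have h2 := congrFun h t
      simp only [Function.update_self, Function.update_of_ne hct] at h1 h2
      exact Prod.ext h1 h2
    have hok := fun w => h.ok _ (hpair w) (hpf w)
    by_cases hic : i = c
    · subst hic
      have := (hok w).1 (w t)
      convert this using 2 with x
      simp [hct.symm, okPart, push]
    by_cases hit : i = t
    · subst hit
      have := (hok w).2 (w c)
      convert this using 2 with x
      simp only [Function.update_comm hct, Function.update_idem, Function.update_self,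
        Function.update_of_ne hct, okPart, push]
    · have := hW (fun p : X × X => K p ((w c, w t), true))
        (fun p x => m (Function.update (Function.update (Function.update w i x) c p.1) t p.2))
        fun p _ => ?_
      · convert this using 2 with x
        simp only [Function.update_of_ne (Ne.symm hic), Function.update_of_ne (Ne.symm hit), integral]
        exact tsum_congr fun p => mul_comm _ _
      · simp only [Function.update_comm hic, Function.update_comm hit]
        exact hm i _
  · have := h.fail _ (hm.both hW hct) (by rwa [hmass])
    rw [hmass, failMass, integral_pushforward] at this
    refine le_trans (le_of_eq ?_) this
    exact integral_congr fun v _ => failProb_map _ _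
  · rw [atPair_true hct] at hw
    refine ⟨?_, ind_ne_zero.1 (left_ne_zero_of_mul hw)⟩
    refine h.supp _ (hm.both hW hct) (by rwa [hmass]) _ _ ?_ (right_ne_zero_of_mul hw)
    exact integral_ne_zero.2 ⟨v, hv, ind_ne_zero.2 rfl⟩

end Pair

/-! ### The encoding circuit -/

section Encoding

variable {k : ℕ} {b : ℕ → ℝ} {A B C : ℝ≥0∞}

theorem cfgErrors_update (v : Fin 7 → MBlk k) (i : Fin 7) (x : MBlk k) :
    cfgErrors (Function.update v i x) = Function.update (fun j => (v j).errors) i x.errors := by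
  funext j
  rw [cfgErrors]
  by_cases h : j = i
  · subst h; simp
  · simp [h]

theorem StepSim.refl {X X₀ : Type} (eX : X → X₀) (W : (X → ℝ≥0∞) → Prop) :
    StepSim eX eX PMF.pure W W (fun x y => y = x) 0 := by
  have hok : ∀ m : X → ℝ≥0∞, okPart m (fun x => PMF.pure (x, true)) = m := by
    intro m
    ext y
    rw [okPart, push, apply_eq_integral m]
    refine integral_congr fun x _ => ?_
    rw [PMF.pure_apply, ind]
    congr 1
    simp
  refine ⟨fun x => PMF.pure (x, true), fun x => PMF.pure_map _ _, fun m hm _ => by rwa [hok],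
    fun m _ _ => ?_, fun m _ _ x y _ hy => ?_⟩
  · simp [failMass, failProb, integral_pure, ind]
    simp [integral]
  · by_contra h
    simp [h] at hy

/-- No fault tolerance is attempted inside the encoder: each faulty gate is a failure, and so the
bound is linear in the number of gates. Otherwise CNOT gates keep trivial states trivial. -/
theorem StepSim.runCNOTs {G : Gadgets k} {P : Noise → Prop} (hP : ∀ ν i, P ν → P (ν.sub i))
    (h : ∀ ν, P ν → StepSim pairErrors pairErrors (fun x => G.cnot ν x.1 x.2)
      (Both (Well b k) (Well b k)) (Both (Well b k) (Well b k)) cnotRel C) :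
    ∀ (l : List (Fin 7 × Fin 7)), (∀ e ∈ l, e.1 ≠ e.2) → ∀ ν, P ν →
      StepSim cfgErrors cfgErrors (SteaneFT.runCNOTs G l ν) (Joint fun _ => Well b k)
        (Joint fun _ => Well b k) (fun v w => states v = 0 → states w = 0) (l.length * C)
  | [], _, ν, _ => (StepSim.refl cfgErrors _).mono (fun _ h => h) (fun _ h => h)
      (fun _ _ h h' => by rw [h, h']) zero_le
  | (c, t) :: l, hl, ν, hν => by
    obtain ⟨K, lK, hK⟩ := h (ν.sub 0) (hP ν 0 hν)
    have hct : c ≠ t := hl (c, t) List.mem_cons_self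
    have h1 : StepSim cfgErrors cfgErrors (fun v : Blk (k + 1) => (G.cnot (ν.sub 0) (v c) (v t)).map
        fun r => Function.update (Function.update v c r.1) t r.2) (Joint fun _ => Well b k)
        (Joint fun _ => Well b k) (fun v w => cnotRel (v c, v t) (w c, w t) ∧
          ∀ j, j ≠ c → j ≠ t → w j = v j) C := by
      refine ⟨atPair c t K, fun v => ?_, hK.atPair (isCone_well k) hct⟩
      have := lK (v c, v t)
      change _ = (G.cnot (ν.sub 0) (v c).errors (v t).errors).map _
      simp only [pairErrors] at this
      rw [← this, atPair, PMF.map_comp]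
      refine Eq.trans (congrArg (fun f => PMF.map f (K (v c, v t))) (funext fun r => ?_))
        (PMF.map_comp _ _ _).symm
      refine (cfgErrors_update _ _ _).trans ?_
      exact congrArg (fun u => Function.update u t r.1.2.errors) (cfgErrors_update _ _ _)
    have h2 := StepSim.runCNOTs hP h l (fun e he => hl e (List.mem_cons_of_mem _ he)) (ν.sub 1)
      (hP ν 1 hν)
    have e : SteaneFT.runCNOTs G ((c, t) :: l) ν = fun v =>
        ((G.cnot (ν.sub 0) (v c) (v t)).map fun r =>
          Function.update (Function.update v c r.1) t r.2).bind
            (SteaneFT.runCNOTs G l (ν.sub 1)) :=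
      funext fun v => (PMF.bind_map _ _ _).symm
    rw [e]
    refine (h1.comp h2 cfgErrors_surjective).mono (fun _ h => h) (fun _ h => h) ?_ ?_
    · rintro v w ⟨u, ⟨h1, h2⟩, h3⟩ hv
      refine h3 (funext fun j => ?_)
      have hv : ∀ j, mstate (v j) = 0 := fun j => congrFun hv j
      have h4 : mstate (u c) = 0 ∧ mstate (u t) = 0 := by
        have := Prod.ext_iff.1 h1
        simp only [hv] at this
        exact this
      by_cases hj : j = c
      · subst hj; exact h4.1
      by_cases hj' : j = t
      · subst hj'; exact h4.2
      rw [states, h2 j hj hj']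
      exact hv j
    · rw [List.length_cons]; push_cast; rw [add_mul, one_mul, add_comm]

end Encoding
end SteaneFT

namespace SteaneFT
open scoped ENNReal

/-! ### Unverified ancillas and the CNOT gates that verify them -/

section Sources

variable {k : ℕ} {b : ℕ → ℝ} {A B C : ℝ≥0∞}

/-- Failures are reinterpreted as the status `wild`: a run with a faulty encoder is not abandoned,
since the verification can still handle it. Hence the failure bound is zero and `q` bounds the
recorded faults. -/
theorem SourceSim.of_step {X X₀ Δ : Type} {eX : X → X₀} {p : PMF X₀} {W : (X → ℝ≥0∞) → Prop}
    {Φ : X → Prop} {q : ℝ≥0∞}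
    (h : StepSim (fun _ : Unit => ()) eX (fun _ => p) (fun _ => True) W (fun _ => Φ) q) (wild : Δ)
    {W' : (Option Δ × X → ℝ≥0∞) → Prop}
    (hW' : ∀ m : Option Δ × X → ℝ≥0∞, W (fun x => m (none, x)) →
      (∀ γ x, γ ≠ none → γ ≠ some wild → m (γ, x) = 0) → W' m) :
    SourceSim eX p W' (fun s => s.1 = some wild ∨ s.1 = none ∧ Φ s.2) 0 q q := by
  obtain ⟨K, l, h⟩ := h
  have h1 : mass (fun _ : Unit => (1 : ℝ≥0∞)) = 1 := by simp [mass]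
  have hf : mass (fun _ : Unit => (1 : ℝ≥0∞)) ≠ ⊤ := by simp [h1]
  let f : X × Bool → (Option Δ × X) × Bool := fun r => ((if r.2 then none else some wild, r.1), true)
  have hR : ∀ s, (K ()).map f (s, true) ≠ 0 →
      (s.1 = none ∧ K () (s.2, true) ≠ 0) ∨ (s.1 = some wild ∧ K () (s.2, false) ≠ 0) := by
    rintro ⟨γ, x⟩ hs
    rw [map_apply_eq_integral] at hs
    obtain ⟨⟨y, _ | _⟩, h1, h2⟩ := integral_ne_zero.1 hs <;>
    · simp [f, ind_ne_zero] at h2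
      obtain ⟨rfl, rfl⟩ := h2
      simp [h1]
  have hnone : ∀ x, (K ()).map f ((none, x), true) = K () (x, true) := by
    intro x
    rw [map_apply_eq_integral, apply_eq_integral (K ())]
    refine integral_congr fun r _ => ind_congr ?_
    obtain ⟨y, _ | _⟩ := r <;> simp [f]
  have hfail : failProb ((K ()).map f) = 0 := by
    rw [failProb_map]
    simp [f, ind, integral]
  have hmark : markedMass (fun s => (K ()).map f (s, true)) ≤ q := by
    have := h.fail _ True.intro hf
    rw [h1, mul_one] at this
    refine le_trans (le_of_eq ?_) this
    have e : (fun s => (K ()).map f (s, true)) = okPart (fun _ : Unit => 1) fun _ => (K ()).map f :=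
      funext fun s => (okPart_unit _ s).symm
    rw [e, markedMass, integral_okPart, failMass]
    refine integral_congr fun _ _ => ?_
    rw [integral_map, failProb]
    refine integral_congr fun r _ => ?_
    obtain ⟨y, _ | _⟩ := r <;> simp [f, ind]
  refine ⟨(K ()).map f, ?_, hW' _ ?_ ?_, fun s hs => ?_, hfail.le, hmark, by rwa [hfail, zero_add]⟩
  · rw [PMF.map_comp]
    exact l ()
  · simp only [hnone]
    have := h.ok _ True.intro hf
    convert this using 2 with x
    exact (okPart_unit (K ()) x).symm
  · intro γ x h1 h2
    by_contra h3
    rcases hR _ h3 with h | h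
    · exact h1 h.1
    · exact h2 h.1
  · rcases hR s hs with h3 | h3
    · exact Or.inr ⟨h3.1, h.supp _ True.intro hf () s.2 one_ne_zero h3.2⟩
    · exact Or.inl h3.1

/-- The preparation of an ancilla before the error corrections. -/
theorem GadgetSpec.encode {P : Noise → Prop} (hP : ∀ ν i, P ν → P (ν.sub i)) {G : Gadgets k}
    (h : GadgetSpec P b k G A B C) {ν : Noise} (hν : P ν) :
    StepSim (fun _ : Unit => ()) cfgErrors
      (fun _ => (transverse 7 fun i => if i = 0 ∨ i = 1 ∨ i = 3 then plusOf G.zero ((ν.sub 0).sub i)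
        else G.zero ((ν.sub 0).sub i)).bind (runCNOTs G encodingCNOTs (ν.sub 1)))
      (fun _ => True) (Joint fun _ => Well b k) (fun _ v => states v = 0) (7 * A + 9 * C) := by
  have h1 : ∀ i : Fin 7, StepSim (fun _ : Unit => ()) MBlk.errors
      (fun _ => if i = 0 ∨ i = 1 ∨ i = 3 then plusOf G.zero ((ν.sub 0).sub i)
        else G.zero ((ν.sub 0).sub i)) (fun _ => True) (Well b k) (fun _ x => mstate x = 0) A := by
    intro i
    have h0 := h.zero _ (hP _ i (hP _ 0 hν))
    by_cases hi : i = 0 ∨ i = 1 ∨ i = 3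
    · simp only [if_pos hi, plusOf, hadamardAll_eq]
      refine (StepSim.map_sym isSym_swap h0).mono (fun _ h => h) (fun _ h => h) ?_ le_rfl
      intro _ x hx
      rw [isSym_swap.mstate_mmap] at hx
      exact Prod.ext (congrArg Prod.snd hx) (congrArg Prod.fst hx)
    · simp only [if_neg hi]
      exact h0
  have h2 := (StepSim.strict h1 fun _ => isCone_well k).comap (V := fun _ : Unit → ℝ≥0∞ => True)
    (eZ := fun _ : Unit => ()) (f := fun _ _ => ()) (f₀ := fun _ _ => ()) (fun _ => rfl)
    fun _ _ _ _ => True.intro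
  have h3 := StepSim.runCNOTs hP h.cnot encodingCNOTs (by decide) (ν.sub 1) (hP _ _ hν)
  refine (h2.comp h3 cfgErrors_surjective).mono (fun _ h => h) (fun _ h => h) ?_ (le_of_eq ?_)
  · rintro _ v ⟨w, hw, h⟩
    exact h (funext hw)
  · simp [encodingCNOTs]

/-- The status in the preparation of an ancilla: `none` if there was no fault, `some none` after a
fault before the corrections of the subblocks, and `some (some j)` if the fault is confined to the
subblock `j`. -/
abbrev AncStatus : Type := Option (Option (Fin 7))

theorem mem_markSet_join {γ : AncStatus} {i : Fin 7} : i ∈ markSet γ.join ↔ γ = some (some i) := by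
  rw [markSet, Set.mem_ofPred_eq, Option.join_eq_some_iff]

/-- Jointly well blocks, except for the one to which a fault is confined. -/
def AncWell (b : ℕ → ℝ) (k : ℕ) : (AncStatus × (Fin 7 → MBlk k) → ℝ≥0∞) → Prop :=
  StatusJoint fun γ => Off (markSet γ.join) (Well b k)

/-- Jointly well pairs of blocks, except for the pair to which a fault is confined. -/
def PairAncWell (b : ℕ → ℝ) (k : ℕ) : (AncStatus × (Fin 7 → MBlk k × MBlk k) → ℝ≥0∞) → Prop :=
  StatusJoint fun γ => Off (markSet γ.join) (Both (Well b k) (Well b k))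

/-- Unless there has been a fault before the corrections, there is no error outside of the subblock
with a fault, and no error on the encoded qubit. -/
def AncOk (s : AncStatus × (Fin 7 → MBlk k)) : Prop :=
  s.1 ≠ some none → PNear s.1.join (states s.2) ∧ decode (states s.2) = 0

/-- After a fault in the encoder nothing is known about the subblocks, but corrections make
arbitrary subblocks well. The ancilla then suffers only from unknown states of well subblocks, to
which verification can be applied. -/
theorem FTSim.anc_correct {corr : Fin 7 → Blk k → PMF (Blk k)}
    (hw : ∀ i, StepSim MBlk.errors MBlk.errors (corr i) (Well b k) (Well b k)
      (fun x y => mstate y = mstate x) B)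
    (ha : ∀ i, StepSim MBlk.errors MBlk.errors (corr i) (fun _ => True) (Well b k)
      (fun _ _ => True) B) :
    FTSim cfgErrors cfgErrors (fun v => SteaneFT.transverse 7 fun i => corr i (v i))
      (StatusJoint fun (γ : AncStatus) i m => γ ≠ some none → Off (markSet γ.join) (Well b k) i m)
      (AncWell b k) (statusRel some fun γ i x y =>
        γ ≠ some none → i ∉ markSet γ.join → mstate y = mstate x)
      0 (7 * B) (21 * B ^ 2) (7 * B) := by
  have hcone : IsCone (Well b k) := isCone_well k
  have h' : ∀ (γ : AncStatus) i, StepSim MBlk.errors MBlk.errors (corr i)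
      (fun m => γ ≠ some none → Off (markSet γ.join) (Well b k) i m)
      (Off (markSet γ.join) (Well b k) i)
      (fun x y => γ ≠ some none → i ∉ markSet γ.join → mstate y = mstate x) B := by
    intro γ i
    by_cases hγ : γ = some none
    · exact (ha i).mono (fun _ _ => True.intro) (fun _ h _ => h) (fun _ _ _ h => absurd hγ h) le_rfl
    by_cases hi : i ∈ markSet γ.join
    · exact (StepSim.trivial (errors_surjective k) (corr i) B).mono (fun _ _ => True.intro)
        (fun _ _ h => absurd hi h) (fun _ _ _ _ h => absurd hi h) le_rfl
    · exact (hw i).mono (fun _ hm => hm hγ hi) (fun _ hm _ => hm) (fun _ _ h _ _ => h) le_rfl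
  refine FTSim.transverse (some : Fin 7 → Option (Fin 7)) h' (fun γ i => hcone.off _ i) ?_
  intro j i m h hi
  refine h ?_ (by simp [markSet])
  rintro rfl
  exact hi (mem_markSet_join.2 rfl)

/-- An unverified ancilla. -/
theorem GadgetSpec.unverified {P : Noise → Prop} (hP : ∀ ν i, P ν → P (ν.sub i)) {G : Gadgets k}
    (h : GadgetSpec P b k G A B C) {ν : Noise} (hν : P ν) :
    SourceSim cfgErrors (unverifiedZero G ν) (AncWell b k) AncOk
      (21 * B ^ 2 + 7 * B * (7 * A + 9 * C)) (7 * A + 9 * C + 7 * B) (7 * A + 9 * C + 7 * B) := by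
  have h1 := (SourceSim.of_step (h.encode hP hν) (none : Option (Fin 7))
    (W' := StatusJoint fun (γ : AncStatus) i m => γ ≠ some none → Off (markSet γ.join) (Well b k) i m)
    ?_).comp (FTSim.anc_correct (fun i => h.well ((ν.sub 2).sub i) (hP _ _ (hP _ _ hν)))
      fun i => h.any _ (hP _ _ (hP _ _ hν))) cfgErrors_surjective
  · have e : unverifiedZero G ν = ((transverse 7 fun i => if i = 0 ∨ i = 1 ∨ i = 3 then
        plusOf G.zero ((ν.sub 0).sub i) else G.zero ((ν.sub 0).sub i)).bind
        (runCNOTs G encodingCNOTs (ν.sub 1))).bind fun v =>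
          transverse 7 fun i => G.correct ((ν.sub 2).sub i) (v i) :=
      (PMF.bind_bind _ _ _).symm
    rw [e]
    refine h1.mono (fun _ h => h) ?_ (by simp) le_rfl le_rfl
    rintro s ⟨p, hp, hs⟩ hw
    rcases hs with ⟨hs, hrel⟩ | ⟨h0, j, hs, hrel⟩
    · rcases hp with hp | ⟨hp, hp0⟩
      · exact absurd (hs.trans hp) hw
      · have : states s.2 = fun _ => 0 := funext fun i =>
          (hrel i (by simp [hp]) (by simp [hp, markSet])).trans (congrFun hp0 i)
        rw [hs, hp, this]
        exact ⟨pnear_zero, decode_zero⟩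
    · rcases hp with hp | ⟨hp, hp0⟩
      · simp [hp] at h0
      · have := (pnear_zero.of_none (some j)).congr (s' := states s.2) fun i hi =>
          (hrel i (fun h => hi (by rw [h])) (by simp) (by simp [markSet])).trans (congrFun hp0 i)
        rw [hs]
        exact ⟨this.1, this.2.trans decode_zero⟩
  · intro m hm h0 γ i v hγ hi
    rcases γ with _ | _ | j
    · exact hm i v
    · exact absurd rfl hγ
    · simp only [h0 (some (some j)) _ (by simp) (by simp)]
      exact (isCone_well k).zero

/-- The measurement of a block detects no X error. -/
def AcceptX (s : Fin 7 → Pauli) : Prop := Near none (fun i => (s i).1) ∧ (decode s).1 = 0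

theorem acceptX_of_decode {s : Fin 7 → Pauli} (h : PNear none s) (h0 : decode s = 0) : AcceptX s :=
  ⟨h.1, (Prod.ext_iff.1 h0).1⟩

theorem decode_fst (s : Fin 7 → Pauli) : (decode s).1 = decodeBits fun i => (s i).1 := rfl

theorem AcceptX.congr {s s' : Fin 7 → Pauli} (h : AcceptX s)
    (e : (fun i => (s' i).1) = fun i => (s i).1) : AcceptX s' := by
  rw [AcceptX, decode_fst] at h ⊢
  rwa [e]

theorem AcceptX.add {s s' s'' : Fin 7 → Pauli} (h : AcceptX s) (h' : AcceptX s')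
    (e : (fun i => (s'' i).1) = (fun i => (s i).1) + fun i => (s' i).1) : AcceptX s'' := by
  rw [AcceptX, decode_fst] at h h' ⊢
  have := h.1.add h'.1
  rw [e, this.2, h.2, h'.2, add_zero]
  exact ⟨this.1, rfl⟩

/-- The properties of a pair of ancillas after the transverse CNOT gates. -/
def PairAncOk (s : AncStatus × (Fin 7 → MBlk k × MBlk k)) : Prop :=
  (s.1 ≠ some none →
    (PNear s.1.join (states fun i => (s.2 i).1) ∧ decode (states fun i => (s.2 i).1) = 0) ∧
    (PNear s.1.join (states fun i => (s.2 i).2) ∧ decode (states fun i => (s.2 i).2) = 0)) ∧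
  (s.1 = some none → AcceptX (states fun i => (s.2 i).2) → AcceptX (states fun i => (s.2 i).1))

theorem FTSim.anc_cnot {op : Fin 7 → Blk k × Blk k → PMF (Blk k × Blk k)}
    (h : ∀ i, StepSim pairErrors pairErrors (op i) (Both (Well b k) (Well b k))
      (Both (Well b k) (Well b k)) cnotRel C) :
    FTSim pairsErrors pairsErrors (fun v => SteaneFT.transverse 7 fun i => op i (v i))
      (PairAncWell b k) (PairAncWell b k)
      (statusRel some fun γ i x y => i ∉ markSet γ.join → cnotRel x y)
      0 (7 * C) (21 * C ^ 2) (7 * C) := by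
  have hcone : IsCone (Both (Well b k) (Well b k)) := (isCone_well k).both (isCone_well k)
  have h' : ∀ (γ : AncStatus) i, StepSim pairErrors pairErrors (op i)
      (Off (markSet γ.join) (Both (Well b k) (Well b k)) i)
      (Off (markSet γ.join) (Both (Well b k) (Well b k)) i)
      (fun x y => i ∉ markSet γ.join → cnotRel x y) C := by
    intro γ i
    by_cases hi : i ∈ markSet γ.join
    · exact (StepSim.trivial pairErrors_surjective (op i) C).mono (fun _ _ => True.intro)
        (fun _ _ h => absurd hi h) (fun _ _ _ h => absurd hi h) le_rfl
    · exact (h i).mono (fun _ hm => hm hi) (fun _ hm _ => hm) (fun _ _ h _ => h) le_rfl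
  refine FTSim.transverse (some : Fin 7 → Option (Fin 7)) h' (fun γ i => hcone.off _ i) ?_
  intro j i m h hi
  refine h ?_ (by simp [markSet])
  rintro rfl
  exact hi (mem_markSet_join.2 rfl)

/-- At most one copy has a status other than `none`. If the first copy is perfect, its X components
are not altered by the gates. If the second is, the measured X components are those of the first
copy plus a string that is itself acceptable; acceptance of the sum thus certifies the first copy.
-/
theorem pairAncOk_of_cnot {γ₁ γ₂ γ : AncStatus} {v w : Fin 7 → MBlk k × MBlk k}
    (h0 : γ₁ = none ∨ γ₂ = none) (h1 : AncOk (γ₁, fun i => (v i).1))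
    (h2 : AncOk (γ₂, fun i => (v i).2))
    (h : statusRel some (fun γ i x y => i ∉ markSet γ.join → cnotRel x y) (γ₁.or γ₂, v) (γ, w)) :
    PairAncOk (γ, w) := by
  have hst : ∀ i, cnotRel (v i) (w i) →
      states (fun i => (w i).1) i = (cnotState (states (fun i => (v i).1) i)
        (states (fun i => (v i).2) i)).1 ∧
      states (fun i => (w i).2) i = (cnotState (states (fun i => (v i).1) i)
        (states (fun i => (v i).2) i)).2 := fun i hi => Prod.ext_iff.1 hi
  have hc0 : cnotState 0 0 = 0 := rfl
  have main : ∀ g : Option (Fin 7), PNear g (states fun i => (v i).1) →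
      decode (states fun i => (v i).1) = 0 → PNear g (states fun i => (v i).2) →
      decode (states fun i => (v i).2) = 0 → (∀ i, g ≠ some i → cnotRel (v i) (w i)) →
      (PNear g (states fun i => (w i).1) ∧ decode (states fun i => (w i).1) = 0) ∧
        (PNear g (states fun i => (w i).2) ∧ decode (states fun i => (w i).2) = 0) := by
    intro g hp hp0 hq hq0 hrel
    obtain ⟨⟨h4, h5⟩, h6⟩ := hp.cnot hq
    rw [hp0, hq0, hc0, Prod.ext_iff] at h6
    have h7 := h4.congr (s' := states fun i => (w i).1) fun i hi => (hst i (hrel i hi)).1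
    have h8 := h5.congr (s' := states fun i => (w i).2) fun i hi => (hst i (hrel i hi)).2
    exact ⟨⟨h7.1, h7.2.trans h6.1⟩, h8.1, h8.2.trans h6.2⟩
  constructor
  · intro hγ
    dsimp only at hγ ⊢
    have hn1 : γ₁ ≠ some none := by
      rintro rfl
      rcases h with ⟨h, -⟩ | ⟨h, -⟩ <;> simp at h
      exact hγ h
    have hn2 : γ₂ ≠ some none := by
      rintro rfl
      rcases h0 with rfl | h0
      · rcases h with ⟨h, -⟩ | ⟨h, -⟩ <;> simp at h
        exact hγ h
      · simp at h0
    obtain ⟨hp, hp0⟩ := h1 hn1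
    obtain ⟨hq, hq0⟩ := h2 hn2
    dsimp only at hp hp0 hq hq0
    rcases h with ⟨h, hrel⟩ | ⟨h, j, hj, hrel⟩
    · dsimp only at h hrel
      refine main γ.join ?_ hp0 ?_ hq0 fun i hi => hrel i ?_
      · rcases h0 with rfl | rfl
        · exact hp.of_none _
        · rwa [h, Option.or_none]
      · rcases h0 with rfl | rfl
        · rwa [h, Option.none_or]
        · exact hq.of_none _
      · rw [← h]; exact hi
    · dsimp only at h hj hrel
      rw [Option.or_eq_none_iff] at h
      obtain ⟨rfl, rfl⟩ := h
      subst hj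
      exact main (some j) (hp.of_none _) hp0 (hq.of_none _) hq0 fun i hi =>
        hrel i (fun h => hi (by rw [h])) (by simp [markSet])
  · intro hγ ha
    dsimp only at hγ ha ⊢
    subst hγ
    -- A faulty gate would have produced a status `some (some j)`; with the status `some none` all
    -- seven gates acted perfectly.
    rcases h with ⟨h, hrel⟩ | ⟨h, j, hj, hrel⟩
    swap
    · simp at hj
    dsimp only at h hrel
    rw [← h] at hrel
    have hrel : ∀ i, cnotRel (v i) (w i) := fun i => hrel i (by simp [markSet])
    have hX1 : (fun i => (states (fun i => (w i).1) i).1) = fun i => (states (fun i => (v i).1) i).1 :=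
      funext fun i => by rw [(hst i (hrel i)).1]; rfl
    have hX2 : (fun i => (states (fun i => (w i).2) i).1) =
        (fun i => (states (fun i => (v i).2) i).1) + fun i => (states (fun i => (v i).1) i).1 :=
      funext fun i => by rw [(hst i (hrel i)).2]; rfl
    rcases h0 with rfl | rfl
    · exact (acceptX_of_decode (h1 (by simp)).1 (h1 (by simp)).2).congr hX1
    · refine AcceptX.add ha (acceptX_of_decode (h2 (by simp)).1 (h2 (by simp)).2) ?_
      rw [hX1, hX2, add_right_comm]
      funext i
      simp [two_eq_zero_zmod]

/-- Two unverified ancillas after the transverse CNOT gates. -/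
theorem GadgetSpec.unverified_pair {P : Noise → Prop} (hP : ∀ ν i, P ν → P (ν.sub i)) {G : Gadgets k}
    (h : GadgetSpec P b k G A B C) {ν : Noise} (hν : P ν) :
    SourceSim pairsErrors (((unverifiedZero G (ν.sub 0)).bind fun d =>
        (unverifiedZero G (ν.sub 1)).map fun a i => (d i, a i)).bind fun v =>
          transverse 7 fun i => G.cnot ((ν.sub 2).sub i) (v i).1 (v i).2)
      (PairAncWell b k) PairAncOk
      (2 * (21 * B ^ 2 + 7 * B * (7 * A + 9 * C)) + (7 * A + 9 * C + 7 * B) ^ 2 + 21 * C ^ 2 +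
        7 * C * (2 * (7 * A + 9 * C + 7 * B)))
      (2 * (7 * A + 9 * C + 7 * B) + 7 * C) (2 * (7 * A + 9 * C + 7 * B) + 7 * C) := by
  have hW : ∀ (γ : AncStatus) i, IsCone (Off (markSet γ.join) (Well b k) i) := fun γ i =>
    (isCone_well k).off _ i
  have hW0 : ∀ (γ : AncStatus) i m, Off (markSet (none : AncStatus).join) (Well b k) i m →
      Off (markSet γ.join) (Well b k) i m := fun γ i m h _ => h (by simp [markSet])
  have h1 := (FTSim.attach (X := MBlk k) (eX := MBlk.errors) (eX' := MBlk.errors)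
    (h.unverified hP (hP _ 1 hν)) hW hW hW0 hW0).mono (V := AncWell b k) (V' := PairAncWell b k)
    (fun _ h => h)
    (fun m h γ i v hi => ⟨fun x' => (h γ i v).1 x' hi, fun x => (h γ i v).2 x hi⟩) (fun _ _ h => h)
  have h2 := (h.unverified hP (hP _ 0 hν)).comp h1 pairsErrors_surjective
  have h3 := h2.comp (FTSim.anc_cnot fun i => h.cnot ((ν.sub 2).sub i) (hP _ _ (hP _ _ hν)))
    pairsErrors_surjective
  refine h3.mono (fun _ h => h) ?_ (le_of_eq ?_) (le_of_eq ?_) (le_of_eq ?_)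
  · rintro ⟨γ, w⟩ ⟨⟨γ', v⟩, ⟨⟨γ₁, d⟩, hp, ⟨γ₂, h0, hγ, h2⟩, hd⟩, hs⟩
    dsimp only at h0 hγ h2 hd
    subst hγ
    refine pairAncOk_of_cnot h0 ?_ h2 hs
    rwa [funext hd]
  all_goals ring

end Sources
end SteaneFT

namespace SteaneFT
open scoped ENNReal

/-! ### Postselection of verified ancillas -/

section Verification

variable {k : ℕ} {b : ℕ → ℝ}

theorem postselect_eq {X : Type} (p : PMF X) (S : Set X) (hS : integral p (fun x => ind (x ∈ S)) ≠ 0)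
    (x : X) :
    postselect p S x = (integral p fun x => ind (x ∈ S))⁻¹ * (p x * ind (x ∈ S)) := by
  classical
  obtain ⟨y, hy, hyS⟩ := integral_ne_zero.1 hS
  rw [ind_ne_zero] at hyS
  have h1 : ∀ x, S.indicator p x = p x * ind (x ∈ S) := fun x => by
    by_cases hx : x ∈ S <;> simp [hx, ind]
  rw [postselect, dif_pos ⟨y, hyS, (p.mem_support_iff y).2 hy⟩, PMF.filter_apply, mul_comm]
  simp only [h1]
  rfl

theorem integral_postselect {X : Type} (p : PMF X) (S : Set X)
    (hS : integral p (fun x => ind (x ∈ S)) ≠ 0) (h : X → ℝ≥0∞) :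
    integral (postselect p S) h =
      (integral p fun x => ind (x ∈ S))⁻¹ * integral p fun x => ind (x ∈ S) * h x := by
  rw [← integral_const_mul]
  refine tsum_congr fun x => ?_
  rw [postselect_eq p S hS]
  ring

theorem postselect_map {X Y : Type} (p : PMF X) (f : X → Y) (S : Set Y) :
    postselect (p.map f) S = (postselect p {x | f x ∈ S}).map f := by
  by_cases hS : integral p (fun x => ind (f x ∈ S)) = 0
  · have h : ∀ {Z : Type} (q : PMF Z) (T : Set Z), integral q (fun z => ind (z ∈ T)) = 0 →
        postselect q T = q := by
      intro Z q T h0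
      refine dif_neg ?_
      rintro ⟨z, hz, hq⟩
      exact integral_ne_zero.2 ⟨z, (q.mem_support_iff z).1 hq, ind_ne_zero.2 hz⟩ h0
    rw [h, h p {x | f x ∈ S} hS]
    rwa [integral_map]
  ext y
  rw [map_apply_eq_integral, integral_postselect p {x | f x ∈ S} hS,
    postselect_eq _ _ (by rwa [integral_map]), integral_map, map_apply_eq_integral,
    mul_comm _ (ind _), ← integral_const_mul]
  congr 1
  refine integral_congr fun x _ => ?_
  by_cases hx : y = f x
  · subst hx; rfl
  · simp [ind, hx]

/-- The mark of a verified ancilla: the subblock with a fault; or, after a fault before the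
corrections, the subblock in relative error, if any. -/
noncomputable def verifiedMark (γ : AncStatus) (s : Fin 7 → Pauli) : Option (Fin 7) :=
  γ.map fun j => j.getD (exists_near fun i => (s i).2).choose

/-- The verified ancilla, up to the logical `Z` operator. -/
noncomputable def verifiedConf (z : AncStatus × (Fin 7 → MBlk k × MBlk k)) : MConf k :=
  (verifiedMark z.1 (states fun i => (z.2 i).1), fun i =>
    mmap (fun Q => (Q.1 + (0, (decode (states fun i => (z.2 i).1)).2).1,
      Q.2 + (0, (decode (states fun i => (z.2 i).1)).2).2)) k (z.2 i).1)

/-- After a fault in the encoder, acceptance leaves no X relative error and no logical X. The Z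
syndrome is explained by a single position because the code is perfect, and this position is marked.
The transverse Z operator in `verifiedConf` cancels the remaining logical Z and changes no relative
state. -/
theorem verifiedConf_spec {z : AncStatus × (Fin 7 → MBlk k × MBlk k)} (hz : PairAncOk z)
    (ha : AcceptX (states fun i => (z.2 i).2)) :
    PNear (verifiedConf z).1 (states (verifiedConf z).2) ∧ decode (states (verifiedConf z).2) = 0 := by
  obtain ⟨γ, v⟩ := z
  set s : Fin 7 → Pauli := states fun i => (v i).1 with hs
  have hsym := isSym_shift (0, (decode s).2)
  have hst : states (verifiedConf (γ, v)).2 =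
      fun i => ((s i).1 + (0, (decode s).2).1, (s i).2 + (0, (decode s).2).2) :=
    funext fun i => hsym.mstate_mmap _
  have hmain : PNear (verifiedMark γ s) s ∧ (decode s).1 = 0 := by
    rcases γ with _ | _ | j
    · obtain ⟨h1, h2⟩ := (hz.1 (by simp)).1
      exact ⟨h1, (Prod.ext_iff.1 h2).1⟩
    · obtain ⟨h1, h2⟩ := hz.2 rfl ha
      exact ⟨⟨h1.of_none _, (exists_near fun i => (s i).2).choose_spec⟩, h2⟩
    · obtain ⟨h1, h2⟩ := (hz.1 (by simp)).1
      exact ⟨h1, (Prod.ext_iff.1 h2).1⟩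
  rw [hst]
  refine ⟨hsym.pnear _ _ hmain.1, ?_⟩
  rw [hsym.decode, hmain.2]
  exact Prod.ext (add_zero 0) (CharTwo.add_self_eq_zero (decode s).2)

theorem states_update_fst (v : Fin 7 → MBlk k × MBlk k) (i : Fin 7) {c c' : MBlk k} (x : MBlk k)
    (h : mstate c = mstate c') :
    (states fun j => (Function.update v i (c, x) j).1) =
      states fun j => (Function.update v i (c', x) j).1 := by
  ext1 j
  by_cases hj : j = i
  · subst hj; simpa [states] using h
  · simp [states, hj]

theorem update_pair_snd (v : Fin 7 → MBlk k × MBlk k) (i : Fin 7) (c c' x : MBlk k) :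
    (fun j => (Function.update v i (c, x) j).2) = fun j => (Function.update v i (c', x) j).2 := by
  ext1 j
  by_cases hj : j = i
  · subst hj; simp
  · simp [hj]

/-- Postselection of a pair of ancillas. -/
theorem SourceSim.verify {p : PMF (Fin 7 → Blk k × Blk k)} {α a es N : ℝ≥0∞}
    (h : SourceSim pairsErrors p (PairAncWell b k) PairAncOk α a es) (hN : N ≠ 0) (hes : es + N ≤ 1) :
    SourceSim cfgErrors
      ((postselect p {r | AcceptX fun i => state k (r i).2}).map fun r =>
        applyAll (0, (decode fun i => state k (r i).1).2) (k + 1) fun i => (r i).1)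
      (WellOff b k) (fun p => PNear p.1 (states p.2) ∧ decode (states p.2) = 0)
      (N⁻¹ * α) (N⁻¹ * a) (N⁻¹ * α + N⁻¹ * a) := by
  obtain ⟨R, hR, h⟩ := h
  let acc : AncStatus × (Fin 7 → MBlk k × MBlk k) → Prop := fun z => AcceptX (states fun i => (z.2 i).2)
  let S : Set ((AncStatus × (Fin 7 → MBlk k × MBlk k)) × Bool) := {r | acc r.1}
  let Z : ℝ≥0∞ := integral R fun r => ind (r ∈ S)
  -- A successful run without a recorded fault is always accepted, and such runs have probability at
  -- least `1 - es`.
  have hNZ : N ≤ Z := by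
    have h1 := mass_true_add_failProb R
    rw [← unmarkedMass_add_markedMass] at h1
    have h2 : es + N ≤ es + unmarkedMass fun p => R (p, true) := by
      refine hes.trans ?_
      rw [← h1, add_assoc, add_comm, add_comm (markedMass _)]
      gcongr
      exact h.strict
    have h3 : N ≤ unmarkedMass fun p => R (p, true) := by
      refine (ENNReal.add_le_add_iff_left ?_).1 h2
      rintro rfl
      simp at hes
    refine h3.trans ?_
    rw [unmarkedMass]
    refine le_trans ?_ (le_of_eq (tsum_flag fun r => R r * ind (r ∈ S)).symm)
    refine le_trans ?_ le_self_add
    refine integral_mono fun z hz => ind_mono fun h0 => ?_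
    obtain ⟨h4, h5⟩ := ((h.supp z hz).1 (by simp [h0])).2
    rw [h0] at h4
    exact acceptX_of_decode h4 h5
  have hZ0 : Z ≠ 0 := fun h0 => hN (by simpa [h0] using hNZ)
  have hZN : Z⁻¹ ≤ N⁻¹ := ENNReal.inv_le_inv.2 hNZ
  let R' := (postselect R S).map fun r => (verifiedConf r.1, r.2)
  have hint : ∀ f : MConf k × Bool → ℝ≥0∞,
      integral R' f = Z⁻¹ * integral R fun r => ind (acc r.1) * f (verifiedConf r.1, r.2) := fun f => by
    rw [integral_map, integral_postselect R S hZ0]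
    rfl
  have htrue : ∀ f : MConf k → ℝ≥0∞, (integral (fun c => R' (c, true)) f) =
      Z⁻¹ * integral (fun z => R (z, true)) fun z => ind (acc z) * f (verifiedConf z) := fun f => by
    have h1 := hint fun r => f r.1 * ind (r.2 = true)
    rw [integral, tsum_flag, integral, tsum_flag] at h1
    simpa [ind, integral] using h1
  have hfail : failProb R' ≤ N⁻¹ * α := by
    rw [failProb, hint]
    refine mul_le_mul' hZN (le_trans (integral_mono fun r _ => ?_) h.fail)
    exact mul_le_of_le_one_left' (ind_le_one _)
  have hmark : markedMass (fun c => R' (c, true)) ≤ N⁻¹ * a := by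
    rw [markedMass, htrue]
    refine mul_le_mul' hZN (le_trans (integral_mono fun z _ => ?_) h.marked)
    refine (mul_le_of_le_one_left' (ind_le_one _)).trans (ind_mono fun h1 h2 => h1 ?_)
    simp [verifiedConf, verifiedMark, h2]
  refine ⟨R', ?_, ?_, fun c hc => ?_, hfail, hmark, add_le_add hfail hmark⟩
  · rw [← hR, postselect_map, PMF.map_comp, PMF.map_comp]
    refine congrArg (fun f => PMF.map f _) (funext fun r => ?_)
    refine Eq.trans ?_ (congrFun (applyAll_eq _ (k + 1)) _).symm
    exact funext fun i => errors_mmap _ _ _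
  · intro γ' i w hi
    have h1 : (fun c => R' ((γ', Function.update w i c), true)) = fun c => Z⁻¹ * ∑' γ : AncStatus,
        integral (fun v => R ((γ, v), true)) fun v => (ind (acc (γ, v)) *
          ind (γ' = verifiedMark γ (states fun i => (v i).1))) *
          ind (Function.update w i c = (verifiedConf (γ, v)).2) := by
      ext c
      rw [apply_eq_integral (fun c => R' (c, true)), htrue, integral_prod]
      congr 1
      refine tsum_congr fun γ => integral_congr fun v _ => ?_
      rw [mul_assoc]
      exact congrArg (fun t => ind (acc (γ, v)) * t) ((ind_congr Prod.ext_iff).trans (ind_and _ _))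
    rw [h1]
    refine (isCone_well k).smul ((isCone_well k).tsum fun γ => ?_) _
    -- If the fault is confined to subblock `i`, the mark is `i`, contrary to the choice of `i`, so
    -- this status contributes nothing. Otherwise subblock `i` was well, and acceptance, mark and
    -- logical Z depend on it only through its state.
    by_cases hγ : i ∈ markSet γ.join
    · rw [mem_markSet_join] at hγ
      subst hγ
      have h0 : ∀ s, γ' ≠ verifiedMark (some (some i)) s := by
        rintro s rfl
        exact hi (by simp [verifiedMark, markSet])
      simp only [ind_of_not (h0 _), mul_zero, zero_mul, integral, tsum_zero]
      exact (isCone_well k).zero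
    · refine well_pushforward_pairs (m := fun v => R ((γ, v), true)) (fun v => h.ok γ i v hγ) w
        (φ := fun v => ind (acc (γ, v)) * ind (γ' = verifiedMark γ (states fun i => (v i).1)))
        (P := fun v _ => (0, (decode (states fun i => (v i).1)).2)) fun v c c' x hc => ?_
      simp only [acc, states_update_fst v i x hc, update_pair_snd v i c c' x, and_self]
  · have h1 : integral (fun c => R' (c, true)) (fun c' => ind (c = c')) ≠ 0 := by
      rwa [← apply_eq_integral (fun c => R' (c, true))]
    rw [htrue] at h1
    obtain ⟨z, hz, h2⟩ := integral_ne_zero.1 (right_ne_zero_of_mul h1)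
    have h3 := ind_ne_zero.1 (left_ne_zero_of_mul h2)
    have h4 := ind_ne_zero.1 (right_ne_zero_of_mul h2)
    rw [h4]
    exact verifiedConf_spec (h.supp z hz) h3

theorem verifiedZero_eq (G : Gadgets k) (ν : Noise) :
    verifiedZero G ν = (postselect (((unverifiedZero G (ν.sub 0)).bind fun d =>
        (unverifiedZero G (ν.sub 1)).map fun a i => (d i, a i)).bind fun v =>
          transverse 7 fun i => G.cnot ((ν.sub 2).sub i) (v i).1 (v i).2)
      {r | AcceptX fun i => state k (r i).2}).map fun r =>
        applyAll (0, (decode fun i => state k (r i).1).2) (k + 1) fun i => (r i).1 := by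
  let unzip : (Fin 7 → Blk k × Blk k) → Blk (k + 1) × Blk (k + 1) := fun r =>
    (fun i => (r i).1, fun i => (r i).2)
  have h : ((unverifiedZero G (ν.sub 0)).bind fun c₁ => (unverifiedZero G (ν.sub 1)).bind fun c₂ =>
      transverseCNOT G (ν.sub 2) c₁ c₂) =
        (((unverifiedZero G (ν.sub 0)).bind fun d =>
          (unverifiedZero G (ν.sub 1)).map fun a i => (d i, a i)).bind fun v =>
            transverse 7 fun i => G.cnot ((ν.sub 2).sub i) (v i).1 (v i).2).map unzip := by
    simp only [PMF.map_bind, PMF.bind_bind, PMF.bind_map]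
    rfl
  refine (congrArg (fun p => (postselect p _).map _) h).trans ?_
  rw [postselect_map, PMF.map_comp]
  have hS : {r : Fin 7 → Blk k × Blk k | unzip r ∈ {r : Blk (k + 1) × Blk (k + 1) |
      (∀ i, measuredX r.2 i = 0) ∧ (state (k + 1) r.2).1 = 0}} =
        {r | AcceptX fun i => state k (r i).2} :=
    Set.ext fun r => and_congr_left' (forall_congr' fun i =>
      ⟨fun h _ => h, fun h => h (by simp)⟩)
  rw [hS]
  rfl

variable {A B C : ℝ≥0∞}

/-- The verified ancillas. -/
theorem GadgetSpec.verified {P : Noise → Prop} (hP : ∀ ν i, P ν → P (ν.sub i)) {G : Gadgets k}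
    (h : GadgetSpec P b k G A B C) {N A' a' : ℝ≥0∞} (hN : N ≠ 0)
    (hes : 2 * (7 * A + 9 * C + 7 * B) + 7 * C + N ≤ 1)
    (hA : N⁻¹ * (2 * (21 * B ^ 2 + 7 * B * (7 * A + 9 * C)) + (7 * A + 9 * C + 7 * B) ^ 2 +
      21 * C ^ 2 + 7 * C * (2 * (7 * A + 9 * C + 7 * B))) ≤ A')
    (ha : N⁻¹ * (2 * (7 * A + 9 * C + 7 * B) + 7 * C) ≤ a') :
    AncillaSpec P b k (verifiedZero G) A' a' := by
  intro ν hν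
  rw [verifiedZero_eq]
  exact ((h.unverified_pair hP hν).verify hN hes).mono (fun _ h => h) (fun _ h => h) hA ha
    (add_le_add hA ha)

end Verification
end SteaneFT

namespace SteaneFT
open scoped ENNReal NNReal

/-! ### The parameters and the induction on the level -/

section Recursion

variable {k : ℕ} {b : ℕ → ℝ}

/-- A verified ancilla is well. -/
theorem AncillaSpec.zero {P : Noise → Prop} {zero : Noise → PMF (Blk (k + 1))} {A a : ℝ≥0∞}
    (h : AncillaSpec P b k zero A a)
    (hb : a + ENNReal.ofReal (b (k + 1)) * A ≤ ENNReal.ofReal (b (k + 1))) {ν : Noise} (hν : P ν) :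
    StepSim (fun _ : Unit => ()) (MBlk.errors (k := k + 1)) (fun _ => zero ν) (fun _ => True)
      (Well b (k + 1)) (fun _ x => mstate x = 0) A := by
  obtain ⟨(R : PMF (MBlk (k + 1) × Bool)), hR, h⟩ := h ν hν
  have hsupp : ∀ c : MBlk (k + 1), R (c, true) ≠ 0 → mstate c = 0 := fun c hc => (h.supp c hc).2
  have hwell : Well b (k + 1) fun c => R (c, true) := by
    refine well_succ_iff.2 ⟨controlled_iff_wellOff.2 ⟨fun c hc => (h.supp c hc).1, h.ok⟩, fun s => ?_⟩
    by_cases hs : s = 0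
    · subst hs
      have h1 : integral (fun c : MBlk (k + 1) => R (c, true)) (fun c => ind (mstate c = 0)) =
          mass fun c : MBlk (k + 1) => R (c, true) := by
        rw [← integral_one]
        exact integral_congr fun c hc => ind_of (hsupp c hc)
      have h2 : integral (fun c : MBlk (k + 1) => R (c, true))
          (fun c => ind (mstate c = 0 ∧ c.1 ≠ none)) ≤ a :=
        (integral_mono fun c _ => ind_mono fun h => h.2).trans h.marked
      rw [h1]
      refine h2.trans ?_
      have h3 := mass_true_add_failProb R
      have hf : ENNReal.ofReal (b (k + 1)) * failProb R ≠ ⊤ :=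
        ENNReal.mul_ne_top ENNReal.ofReal_ne_top
          (ne_top_of_le_ne_top ENNReal.one_ne_top (failProb_le_one R))
      -- Adding `b` times the failure probability turns the mass of the successful runs into one;
      -- `hb` was stated for this.
      refine (ENNReal.add_le_add_iff_right hf).1 ?_
      refine (add_le_add_right (mul_le_mul_right h.fail _) a).trans (hb.trans (le_of_eq ?_))
      refine Eq.trans ?_ (mul_add _ _ _)
      exact (congrArg (_ * ·) h3).trans (mul_one _) |>.symm
    · refine le_of_eq_of_le (b := 0) ?_ zero_le
      by_contra h0
      obtain ⟨c, hc, h1⟩ := integral_ne_zero.1 h0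
      exact hs ((ind_ne_zero.1 h1).1.symm.trans (hsupp c hc))
  refine ⟨fun _ => R, fun _ => hR, fun m _ _ => ?_, fun m _ _ => ?_, fun m _ _ _ c _ hc => hsupp c hc⟩
  · have : okPart m (fun _ => R) = fun c : MBlk (k + 1) => m () * R (c, true) := by
      ext c
      simp [okPart, push, integral]
    rw [this]
    exact (isCone_well (k + 1)).smul hwell _
  · rw [mul_comm]
    simp only [failMass, integral, mass, ← ENNReal.tsum_mul_right]
    gcongr
    exact h.fail

/-- The physical CNOT gate. -/
theorem physCNOT_spec {p : ℝ} {ν : Noise} (hν : BaseErrorModel p ν) :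
    StepSim (pairErrors (k := 0)) (pairErrors (k := 0)) (fun x => (gadgets 0).cnot ν x.1 x.2)
      (Both (Well b 0) (Well b 0)) (Both (Well b 0) (Well b 0)) cnotRel (ENNReal.ofReal p) := by
  classical
  -- Success means that the trivial Pauli product was drawn; every other product is declared a
  -- failure.
  let f : MBlk 0 × MBlk 0 → Pauli × Pauli → (MBlk 0 × MBlk 0) × Bool := fun x e =>
    (((x.1.1, x.1.2 + x.2.2) + e.1, (x.2.1 + x.1.1, x.2.2) + e.2), decide (e = (0, 0)))
  refine ⟨fun x => (ν []).map (f x), fun x => ?_, fun m _ _ => ⟨fun _ => trivial, fun _ => trivial⟩,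
    fun m _ _ => ?_, fun m _ _ x y _ hy => ?_⟩
  · rw [PMF.map_comp]; rfl
  · have h1 : ∀ x, failProb ((ν []).map (f x)) ≤ ENNReal.ofReal p := by
      intro x
      rw [failProb, integral_map]
      have h2 : integral (ν []) (fun e => ind (e = (0, 0))) +
          integral (ν []) (fun e => ind (¬e = (0, 0))) = 1 := by
        rw [← integral_add]
        simp only [ind_add_not, integral_one, mass_pmf]
      have h3 : integral (ν []) (fun e => ind (e = (0, 0))) = ν [] (0, 0) := by
        rw [apply_eq_integral (ν [])]
        exact integral_congr fun e _ => ind_congr eq_comm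
      have h4 : integral (ν []) (fun e => ind (¬e = (0, 0))) ≤ ENNReal.ofReal p := by
        have h5 := hν []
        rw [← h3] at h5
        have h6 : (1 : ℝ≥0∞) ≤ ENNReal.ofReal (1 - p) + ENNReal.ofReal p := by
          refine le_trans ?_ ENNReal.ofReal_add_le
          simp
        exact (ENNReal.add_le_add_iff_left ENNReal.ofReal_ne_top).1
          (((add_le_add_left h5 _).trans h2.le).trans h6)
      refine le_trans (le_of_eq ?_) h4
      refine integral_congr fun e _ => ind_congr ?_
      simp [f]
    refine (integral_mono fun x _ => h1 x).trans (le_of_eq ?_)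
    rw [mul_comm]
    exact ENNReal.tsum_mul_right
  · rw [map_apply_eq_integral] at hy
    obtain ⟨e, -, he⟩ := integral_ne_zero.1 hy
    have h1 := ind_ne_zero.1 he
    obtain ⟨h2, h3⟩ := Prod.ext_iff.1 h1
    have h4 : e = (0, 0) := of_decide_eq_true h3.symm
    subst h4
    change y = _ at h2
    subst h2
    exact Prod.ext (add_zero (M := Pauli) _) (add_zero (M := Pauli) _)

theorem BaseErrorModel.sub {p : ℝ} {ν : Noise} (h : BaseErrorModel p ν) (i : ℕ) :
    BaseErrorModel p (ν.sub i) := fun l => h (i :: l)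

theorem BaseErrorModel.nonneg {p : ℝ} {ν : Noise} (h : BaseErrorModel p ν) : 0 ≤ p := by
  have h1 := (h []).trans ((ν []).coe_le_one _)
  rw [ENNReal.ofReal_le_one] at h1
  linarith

/-- The operations on unencoded qubits. -/
theorem gadgetSpec_zero (p : ℝ) :
    GadgetSpec (BaseErrorModel p) b 0 (gadgets 0) 0 0 (ENNReal.ofReal p) where
  zero ν _ := ⟨fun _ => PMF.pure ((0, 0), true), fun _ => PMF.pure_map _ _, fun _ _ _ => trivial,
    fun m _ _ => by simp [failMass, failProb, integral_pure, ind]; simp [integral], fun m _ _ _ c _ hc => by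
      by_contra h
      rw [PMF.pure_apply, if_neg] at hc
      · exact hc rfl
      · intro h1
        exact h (Prod.ext_iff.1 h1).1⟩
  well ν _ := (StepSim.refl MBlk.errors (Well b 0)).mono (fun _ h => h) (fun _ h => h)
    (fun _ _ h => by rw [h]) le_rfl
  any ν _ := (StepSim.refl MBlk.errors (Well b 0)).mono (fun _ h => h) (fun _ h => h)
    (fun _ _ _ => trivial) le_rfl
  cnot ν hν := physCNOT_spec hν

/-- The equations for the parameters of the next level, without denominators. -/
theorem Params.next_spec {Q R : Params} (h : R = Q.next 7 9) (hN : R.N ≠ 0) (hA : R.A ≠ 1)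
    (hB' : R.B' ≠ 1) (hB : R.B ≠ 1) :
    R.N = 1 - 14 * Q.A - 14 * Q.B - 25 * Q.C ∧
    R.N * R.A = 91 * (Q.A ^ 2 + Q.B ^ 2) + 300 * Q.C ^ 2 + 350 * (Q.A + Q.B) * Q.C + 196 * Q.A * Q.B ∧
    R.N * ((1 - R.A) * R.a) = 14 * (Q.A + Q.B) + 25 * Q.C ∧
    R.B' = 4 * R.A + (4 * R.a + 14 * Q.B + 28 * Q.C) ∧
    (1 - R.B') * R.b = 4 * R.a + 14 * Q.B + 28 * Q.C ∧
    R.B = 4 * R.A + 378 * Q.C ^ 2 + 6 * R.a ^ 2 + 91 * Q.B ^ 2 +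
      R.b * (28 * Q.C + 4 * R.a + 14 * Q.B) + 28 * Q.C * (4 * R.a + 14 * Q.B) + 56 * R.a * Q.B ∧
    (1 - R.B) * R.bt = 4 * R.a + 14 * Q.B + 28 * Q.C ∧
    R.C = 2 * R.B + 14 * Q.C * R.B' + 21 * Q.C ^ 2 + 2 * R.b * (2 * R.B' + 7 * Q.C) + R.b ^ 2 := by
  have c1 : ((2 * 7).choose 2 : ℝ) = 91 := by norm_num [Nat.choose]
  have c2 : ((2 * 9 + 7).choose 2 : ℝ) = 300 := by norm_num [Nat.choose]
  have c3 : ((4 * 7).choose 2 : ℝ) = 378 := by norm_num [Nat.choose]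
  have c4 : (Nat.choose 4 2 : ℝ) = 6 := by norm_num [Nat.choose]
  have c5 : (Nat.choose 7 2 : ℝ) = 21 := by norm_num [Nat.choose]
  have eN : R.N = 1 - 14 * Q.A - 14 * Q.B - 25 * Q.C := by
    rw [h]; simp only [Params.next]; push_cast; ring
  have eA : R.A = (91 * (Q.A ^ 2 + Q.B ^ 2) + 300 * Q.C ^ 2 + 350 * (Q.A + Q.B) * Q.C +
      196 * Q.A * Q.B) / R.N := by
    rw [h]; simp only [Params.next, c1, c2]; push_cast; congr 1; ring
  have ea : R.a = (14 * (Q.A + Q.B) + 25 * Q.C) / ((1 - R.A) * R.N) := by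
    rw [h]; simp only [Params.next]; push_cast; congr 1; ring
  have eB' : R.B' = 4 * R.A + (4 * R.a + 14 * Q.B + 28 * Q.C) := by
    rw [h]; simp only [Params.next]; push_cast; ring
  have eb : R.b = (4 * R.a + 14 * Q.B + 28 * Q.C) / (1 - R.B') := by
    rw [h]; simp only [Params.next]; push_cast; congr 1; ring
  have eB : R.B = 4 * R.A + 378 * Q.C ^ 2 + 6 * R.a ^ 2 + 91 * Q.B ^ 2 +
      R.b * (28 * Q.C + 4 * R.a + 14 * Q.B) + 28 * Q.C * (4 * R.a + 14 * Q.B) + 56 * R.a * Q.B := by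
    rw [h]; simp only [Params.next, c1, c3, c4]; push_cast; ring
  have ebt : R.bt = (4 * R.a + 14 * Q.B + 28 * Q.C) / (1 - R.B) := by
    rw [h]; simp only [Params.next]; push_cast; congr 1; ring
  have eC : R.C = 2 * R.B + 14 * Q.C * R.B' + 21 * Q.C ^ 2 + 2 * R.b * (2 * R.B' + 7 * Q.C) +
      R.b ^ 2 := by
    rw [h]; simp only [Params.next, c5]; push_cast; ring
  refine ⟨eN, ?_, ?_, eB', ?_, eB, ?_, eC⟩
  · rw [eA, mul_div_cancel₀ _ hN]
  · rw [ea, mul_comm (1 - R.A) R.N, ← mul_assoc, mul_div_cancel₀]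
    exact mul_ne_zero hN (sub_ne_zero.2 hA.symm)
  · rw [eb, mul_div_cancel₀ _ (sub_ne_zero.2 hB'.symm)]
  · rw [ebt, mul_div_cancel₀ _ (sub_ne_zero.2 hB.symm)]

/-- The conditions on the parameters of a level. -/
def Params.Valid (R : Params) : Prop :=
  0 < R.N ∧ R.A < 1 ∧ R.B < 1 ∧ R.B' < 1 ∧ R.bt ≤ R.b

/-- The parameters used as bounds are not negative. -/
def Params.Nonneg (R : Params) : Prop :=
  0 ≤ R.A ∧ 0 ≤ R.B ∧ 0 ≤ R.C

theorem Params.Nonneg.next {Q R : Params} (hQ : Q.Nonneg) (h : R = Q.next 7 9) (hR : R.Valid) :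
    R.Nonneg ∧ 0 ≤ R.a ∧ 0 ≤ R.b ∧ 0 ≤ R.B' := by
  obtain ⟨hN, hA1, hB1, hB'1, hbt⟩ := hR
  obtain ⟨eN, eA, ea, eB', eb, eB, ebt, eC⟩ := Params.next_spec h hN.ne' hA1.ne hB'1.ne hB1.ne
  obtain ⟨hA, hB, hC⟩ := hQ
  have h1 : 0 ≤ R.A := by
    refine nonneg_of_mul_nonneg_right (a := R.N) ?_ hN
    rw [eA]; positivity
  have h2 : 0 ≤ R.a := by
    have : 0 ≤ (1 - R.A) * R.a := by
      refine nonneg_of_mul_nonneg_right (a := R.N) ?_ hN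
      rw [ea]; positivity
    exact nonneg_of_mul_nonneg_right this (by linarith)
  have h3 : 0 ≤ R.B' := by rw [eB']; positivity
  have h4 : 0 ≤ R.b := by
    refine nonneg_of_mul_nonneg_right (a := 1 - R.B') ?_ (by linarith)
    rw [eb]; positivity
  have h5 : 0 ≤ R.B := by rw [eB]; positivity
  exact ⟨⟨h1, h5, by rw [eC]; positivity⟩, h2, h4, h3⟩

/-- The guarantees for the gadgets of the next level. -/
theorem GadgetSpec.next {P : Noise → Prop} (hP : ∀ ν i, P ν → P (ν.sub i)) {G : Gadgets k}
    {Q R : Params} (hQ : Q.Nonneg) (h : R = Q.next 7 9) (hR : R.Valid) (hb : b (k + 1) = R.b)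
    (hG : GadgetSpec P b k G (ENNReal.ofReal Q.A) (ENNReal.ofReal Q.B) (ENNReal.ofReal Q.C)) :
    GadgetSpec P b (k + 1) ⟨verifiedZero G, correction G (verifiedZero G),
        cnotOp G (correction G (verifiedZero G))⟩
      (ENNReal.ofReal R.A) (ENNReal.ofReal R.B) (ENNReal.ofReal R.C) ∧
    ∀ ν, P ν → StepSim (MBlk.errors (k := k + 1)) (MBlk.errors (k := k + 1))
      (correction G (verifiedZero G) ν) (Controlled (Well b k)) (Well b (k + 1))
      (fun x y => mstate y = mstate x) (ENNReal.ofReal R.B') := by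
  obtain ⟨⟨hA', hBn, hCn⟩, ha, hb0, hB'0⟩ := hQ.next h hR
  obtain ⟨hN, hA1, hB1, hB'1, hbt⟩ := hR
  obtain ⟨eN, eA, ea, eB', eb, eB, ebt, eC⟩ := Params.next_spec h hN.ne' hA1.ne hB'1.ne hB1.ne
  obtain ⟨hA, hB, hC⟩ := hQ
  clear h
  obtain ⟨QN, QA, Qa, QB', Qb, QB, Qbt, QC⟩ := Q
  obtain ⟨RN, RA, Ra, RB', Rb, RB, Rbt, RC⟩ := R
  dsimp only at *
  have ha' : 0 ≤ (1 - RA) * Ra := mul_nonneg (by linarith) ha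
  have hRN := hN.le
  have hle : (1 - RA) * Ra ≤ Ra := by nlinarith
  -- The hypothesis `bt ≤ b` in the form `ε ≤ (1 - B) * b`. It is what makes the output of a
  -- correction well with the same parameter `b` for any input, as failure has probability at most
  -- `B`.
  have hbt2 : 4 * Ra + 14 * QB + 28 * QC ≤ (1 - RB) * Rb := by
    rw [← ebt]
    exact mul_le_mul_of_nonneg_left hbt (by linarith)
  have hba : Ra ≤ Rb := by nlinarith [mul_nonneg hBn hb0]
  -- The quantity `u` bounds the joint probability of success and a mark on a verified ancilla;
  -- dividing by the success probability gives the conditional bound `a`, which is at most `b`.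
  generalize hu : (1 - RA) * Ra = u at *
  have hub : u + Rb * RA ≤ Rb := by nlinarith
  lift QA to ℝ≥0 using hA
  lift QB to ℝ≥0 using hB
  lift QC to ℝ≥0 using hC
  lift RN to ℝ≥0 using hRN
  lift RA to ℝ≥0 using hA'
  lift Ra to ℝ≥0 using ha
  lift RB' to ℝ≥0 using hB'0
  lift Rb to ℝ≥0 using hb0
  lift RB to ℝ≥0 using hBn
  lift RC to ℝ≥0 using hCn
  lift u to ℝ≥0 using ha'
  have hbe : ENNReal.ofReal (b (k + 1)) = (Rb : ℝ≥0∞) := by rw [hb, ENNReal.ofReal_coe_nnreal]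
  simp only [ENNReal.ofReal_coe_nnreal] at *
  have hN0 : (RN : ℝ≥0∞) ≠ 0 := by exact_mod_cast hN.ne'
  have hes : 2 * (7 * (QA : ℝ≥0∞) + 9 * QC + 7 * QB) + 7 * QC + RN ≤ 1 := by
    norm_cast
    rw [← NNReal.coe_le_coe]
    push_cast
    linarith
  -- Only an inequality: the recursion counts all pairs of faults, whereas several faults in one
  -- encoder amount to a single status `some none`.
  have hfail : (RN : ℝ≥0∞)⁻¹ * (2 * (21 * (QB : ℝ≥0∞) ^ 2 + 7 * QB * (7 * QA + 9 * QC)) +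
      (7 * QA + 9 * QC + 7 * QB) ^ 2 + 21 * QC ^ 2 + 7 * QC * (2 * (7 * QA + 9 * QC + 7 * QB))) ≤
        RA := by
    rw [ENNReal.inv_mul_le_iff hN0 ENNReal.coe_ne_top]
    norm_cast
    rw [← NNReal.coe_le_coe]
    push_cast
    rw [eA]
    have h1 : (0 : ℝ) ≤ QA ^ 2 := by positivity
    have h2 : (0 : ℝ) ≤ QC ^ 2 := by positivity
    have h3 : (0 : ℝ) ≤ QA * QC := by positivity
    linarith
  have hmark : (RN : ℝ≥0∞)⁻¹ * (2 * (7 * QA + 9 * QC + 7 * QB) + 7 * QC) ≤ u := by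
    rw [ENNReal.inv_mul_le_iff hN0 ENNReal.coe_ne_top]
    norm_cast
    rw [← NNReal.coe_le_coe]
    push_cast
    rw [ea]
    linarith
  have hz := hG.verified hP hN0 hes hfail hmark
  have hz' := hG.verified hP hN0 hes hfail (hmark.trans (by exact_mod_cast hle : (u : ℝ≥0∞) ≤ Ra))
  have he : 0 ≤ (Rb : ℝ) * (4 * Ra + 14 * QB + 28 * QC) := by positivity
  -- Here `roundE₁` is half of `ε`, and `2 * A + roundE₂` is at most `B`, so the condition of
  -- `RoundSpec.well` reduces to `hbt2`.
  have hc : roundE₁ (Ra : ℝ≥0∞) QB QC + ENNReal.ofReal (b (k + 1)) *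
      (2 * RA + roundE₂ (Ra : ℝ≥0∞) QB QC) ≤ ENNReal.ofReal (b (k + 1)) := by
    rw [hbe, roundE₁, roundE₂]
    norm_cast
    rw [← NNReal.coe_le_coe]
    push_cast
    refine le_trans (add_le_add_right (mul_le_mul_of_nonneg_left ?_ Rb.2) _)
      (?_ : (7 * (QB : ℝ) + 2 * (Ra + 7 * QC)) + Rb * RB ≤ Rb)
    · rw [eB]
      have : 0 ≤ (RA : ℝ) ∧ 0 ≤ (Ra : ℝ) * QB ∧ 0 ≤ (Ra : ℝ) * QC ∧ 0 ≤ (QB : ℝ) * QC ∧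
          0 ≤ (Ra : ℝ) ^ 2 ∧ 0 ≤ (QB : ℝ) ^ 2 ∧ 0 ≤ (QC : ℝ) ^ 2 := by
        refine ⟨?_, ?_, ?_, ?_, ?_, ?_, ?_⟩ <;> positivity
      linarith
    · have : 0 ≤ (QB : ℝ) ∧ 0 ≤ (Ra : ℝ) ∧ 0 ≤ (QC : ℝ) := ⟨QB.2, Ra.2, QC.2⟩
      linarith
  have h1 : 2 * (RA : ℝ≥0∞) + roundE₁ (Ra : ℝ≥0∞) QB QC ≤ 1 := by
    rw [roundE₁]
    norm_cast
    rw [← NNReal.coe_le_coe]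
    push_cast
    have : 0 ≤ (QB : ℝ) ∧ 0 ≤ (Ra : ℝ) ∧ 0 ≤ (QC : ℝ) ∧ 0 ≤ (RA : ℝ) := ⟨QB.2, Ra.2, QC.2, RA.2⟩
    linarith
  have hbut : ∀ ν, P ν → StepSim (MBlk.errors (k := k + 1)) (MBlk.errors (k := k + 1))
      (correction G (verifiedZero G) ν) (Controlled (Well b k)) (Well b (k + 1))
      (fun x y => mstate y = mstate x) RB' := fun ν hν => by
    refine (hG.correction_butOne hP hz' hν).mono (fun _ h => h) (fun _ h => h) (fun _ _ h => h) ?_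
    rw [roundE₁]
    norm_cast
    rw [← NNReal.coe_le_coe]
    push_cast
    linarith
  have hwell : ∀ ν, P ν → StepSim (MBlk.errors (k := k + 1)) (MBlk.errors (k := k + 1))
      (correction G (verifiedZero G) ν) (Well b (k + 1)) (Well b (k + 1))
      (fun x y => mstate y = mstate x) RB := fun ν hν => by
    refine (hG.correction_well hP hz' hν hc h1).mono (fun _ h => h) (fun _ h => h)
      (fun _ _ h => h) ?_
    rw [roundE₁, roundE₂, hbe]
    norm_cast
    rw [← NNReal.coe_le_coe]
    push_cast
    rw [eB]
    linarith
  refine ⟨⟨fun ν hν => hz.zero ?_ hν, hwell, fun ν hν => ?_, fun ν hν => ?_⟩, hbut⟩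
  · rw [hbe]
    exact_mod_cast hub
  · refine (hG.correction_any hP hz' hν hc h1).mono (fun _ h => h) (fun _ h => h)
      (fun _ _ h => h) ?_
    rw [roundE₁, roundE₂]
    norm_cast
    rw [← NNReal.coe_le_coe]
    push_cast
    rw [eB]
    -- The square in `correction_any` contains products of `A` with first-order terms that are
    -- absent from `B`. They are absorbed by the unused half of `4 * A`, because `2 * A + ε` is at
    -- most `B'`, which is less than one.
    have h2 : (2 * (RA : ℝ)) * (2 * RA + (4 * Ra + 14 * QB + 28 * QC)) ≤ 2 * RA * 1 := by
      refine mul_le_mul_of_nonneg_left ?_ (by positivity)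
      have : 0 ≤ (RA : ℝ) := RA.2
      linarith
    have : 0 ≤ (RA : ℝ) ∧ 0 ≤ (Ra : ℝ) * QB ∧ 0 ≤ (Ra : ℝ) * QC ∧ 0 ≤ (QB : ℝ) * QC ∧
        0 ≤ (Ra : ℝ) ^ 2 ∧ 0 ≤ (QB : ℝ) ^ 2 ∧ 0 ≤ (QC : ℝ) ^ 2 := by
      refine ⟨?_, ?_, ?_, ?_, ?_, ?_, ?_⟩ <;> positivity
    linarith
  · refine (hG.cnot_succ hP hwell hbut hν).mono (fun _ h => h) (fun _ h => h) (fun _ _ h => h) ?_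
    rw [hbe]
    norm_cast
    rw [← NNReal.coe_le_coe]
    push_cast
    rw [eC]
    linarith

/-- The guarantees for the gadgets of all levels. -/
theorem gadgetSpec {p : ℝ} (hp : 0 ≤ p) : ∀ k, InRange p k → (params p k).Nonneg ∧
    GadgetSpec (BaseErrorModel p) (fun j => (params p j).b) k (gadgets k)
      (ENNReal.ofReal (params p k).A) (ENNReal.ofReal (params p k).B) (ENNReal.ofReal (params p k).C)
  | 0, _ => ⟨⟨le_rfl, le_rfl, hp⟩, by
      have := gadgetSpec_zero (b := fun j => (params p j).b) p
      simpa only [params, ENNReal.ofReal_zero] using this⟩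
  | k + 1, h => by
    obtain ⟨h1, h2⟩ := gadgetSpec hp k fun j hj hj' => h j hj (hj'.trans k.le_succ)
    have hR : (params p (k + 1)).Valid := h (k + 1) k.succ_pos le_rfl
    exact ⟨(h1.next rfl hR).1, (h2.next (fun ν i hν => hν.sub i) h1 rfl hR rfl).1⟩

end Recursion
end SteaneFT

namespace SteaneFT
open scoped ENNReal

/-! ### From kernels to the success of a correction -/

section Main

variable {b : ℕ → ℝ} {k : ℕ}

open Classical in
theorem map_tag_apply {Env : Type*} (p : PMF (MBlk k × Bool)) (e₀ e : Env) (x₀ x : Blk k)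
    (r : MBlk k × Bool) :
    p.map (fun r => (e₀, x₀, r.1, r.2)) (e, x, r.1, r.2) = if e = e₀ ∧ x = x₀ then p r else 0 := by
  rw [PMF.map_apply, tsum_eq_single r]
  · simp only [Prod.mk.injEq, and_true]
  · intro r' hr
    rw [if_neg]
    intro h
    simp only [Prod.mk.injEq] at h
    exact hr (Prod.ext h.2.2.1.symm h.2.2.2.symm)

/-- The kernel is run on each slice of the input at a fixed environment `e`. It does not look at
`e`, and the slices have total mass one, so the failure bounds sum to `δ`, while wellness holds
slice by slice. -/
theorem succeeds_of_stepSim {Env : Type*} {corr : Blk k → PMF (Blk k)} {W : (MBlk k → ℝ≥0∞) → Prop}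
    {rel : MBlk k → MBlk k → Prop} {δ : ℝ} {noEffect : Prop}
    (h : StepSim MBlk.errors MBlk.errors corr W (Well b k) rel (ENNReal.ofReal δ))
    {μ : PMF (Env × Blk k)} {M : PMF (Env × MBlk k)} (hM : M.map (fun x => (x.1, x.2.errors)) = μ)
    (hW : ∀ e, W fun B => M (e, B)) (hrel : noEffect → ∀ x y, rel x y → mstate y = mstate x) :
    Succeeds b δ noEffect k (μ.bind fun x => (corr x.2).map fun y => (x.1, x.2, y)) := by
  classical
  obtain ⟨K, l, h⟩ := h
  have hmass : ∑' e, mass (fun B => M (e, B)) = 1 := by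
    rw [← M.tsum_coe, ENNReal.tsum_prod']
    rfl
  have hfin : ∀ e, mass (fun B => M (e, B)) ≠ ⊤ := fun e =>
    ne_top_of_le_ne_top ENNReal.one_ne_top ((ENNReal.le_tsum e).trans hmass.le)
  let R : PMF (Env × Blk k × MBlk k × Bool) :=
    M.bind fun x => (K x.2).map fun r => (x.1, x.2.errors, r.1, r.2)
  have hR : ∀ e x B f, R (e, x, B, f) =
      ∑' B', M (e, B') * if x = B'.errors then K B' (B, f) else 0 := by
    intro e x B f
    rw [PMF.bind_apply, ENNReal.tsum_prod', tsum_eq_single e]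
    · refine tsum_congr fun B' => ?_
      rw [map_tag_apply (K B') e e B'.errors x (B, f)]
      simp
    · intro e' he
      refine ENNReal.tsum_eq_zero.2 fun B' => ?_
      rw [map_tag_apply (K B') e' e B'.errors x (B, f), if_neg fun h => he h.1.symm, mul_zero]
  refine ⟨R, ?_, ?_, fun e => ?_, fun hn e x B hx => ?_⟩
  · rw [← hM, PMF.map_bind, PMF.bind_map]
    refine congrArg (PMF.bind M) (funext fun x => ?_)
    change _ = (corr x.2.errors).map _
    rw [← l x.2, PMF.map_comp, PMF.map_comp]
    rfl
  · have h1 : ∀ x, ((K x).toOuterMeasure {r | r.2 = false}) = failProb (K x) := by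
      intro x
      rw [PMF.toOuterMeasure_apply]
      refine tsum_congr fun r => ?_
      by_cases hr : r.2 = false <;> simp [ind, hr]
    have h2 : R.toOuterMeasure {x | x.2.2.2 = false} = ∑' e, failMass (fun B => M (e, B)) K := by
      rw [PMF.toOuterMeasure_bind_apply, ENNReal.tsum_prod']
      refine tsum_congr fun e => tsum_congr fun B => ?_
      rw [PMF.toOuterMeasure_map_apply]
      exact congrArg (M (e, B) * ·) (h1 B)
    rw [h2]
    refine (ENNReal.tsum_le_tsum fun e => h.fail _ (hW e) (hfin e)).trans ?_
    rw [ENNReal.tsum_mul_left, hmass, mul_one]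
  · have h1 : (fun B => ∑' x : Blk k, R (e, x, B, true)) = okPart (fun B => M (e, B)) K := by
      ext B
      simp only [hR]
      rw [ENNReal.tsum_comm]
      refine tsum_congr fun B' => ?_
      rw [ENNReal.tsum_mul_left, tsum_ite_eq]
    rw [h1]
    exact h.ok _ (hW e) (hfin e)
  · rw [hR] at hx
    obtain ⟨B', hB'⟩ : ∃ B', M (e, B') * (if x = B'.errors then K B' (B, true) else 0) ≠ 0 := by
      by_contra h0
      push Not at h0
      exact hx (ENNReal.tsum_eq_zero.2 h0)
    obtain ⟨h1, h2⟩ := mul_ne_zero_iff.1 hB'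
    obtain ⟨h3, h4⟩ := ite_ne_right_iff.1 h2
    rw [h3]
    exact sub_eq_zero.2 (hrel hn _ _ (h.supp _ (hW e) (hfin e) B' B h1 h4))

end Main
end SteaneFT

theorem mainTheorem3 {Env : Type*} (p : ℝ) (k : ℕ) (hrange : SteaneFT.InRange p (k + 1))
    (ν : SteaneFT.Noise) (hν : SteaneFT.BaseErrorModel p ν)
    (μ : PMF (Env × SteaneFT.Blk (k + 1))) :
    SteaneFT.Succeeds (fun j => (SteaneFT.params p j).b) (SteaneFT.params p (k + 1)).B
      (SteaneFT.IsWell (fun j => (SteaneFT.params p j).b) (k + 1) μ) (k + 1)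
      (SteaneFT.correctionRun (k + 1) ν μ) ∧
    (SteaneFT.IsWellButOne (fun j => (SteaneFT.params p j).b) k μ →
      SteaneFT.Succeeds (fun j => (SteaneFT.params p j).b) (SteaneFT.params p (k + 1)).B'
        True (k + 1) (SteaneFT.correctionRun (k + 1) ν μ)) := by
  have hp := hν.nonneg
  obtain ⟨h1, h2⟩ := SteaneFT.gadgetSpec hp k fun j hj hj' => hrange j hj (hj'.trans k.le_succ)
  obtain ⟨h3, h4⟩ := h2.next (fun ν i hν => hν.sub i) h1 rfl (hrange (k + 1) k.succ_pos le_rfl) rfl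
  refine ⟨?_, ?_⟩
  -- The same bound `B` covers two different analyses. The absence of a logical effect is claimed
  -- only for a well input, so the marking and the flag may be chosen after deciding whether `μ` is
  -- well.
  · by_cases hw : SteaneFT.IsWell (fun j => (SteaneFT.params p j).b) (k + 1) μ
    · obtain ⟨M, hM, hW⟩ := id hw
      exact SteaneFT.succeeds_of_stepSim (h3.well ν hν) hM hW fun _ _ _ h => h
    -- The guarantee for arbitrary input asks nothing of the marks, so the marking without marks
    -- will do.
    · refine SteaneFT.succeeds_of_stepSim (h3.any ν hν)
        (M := μ.map fun x => (x.1, SteaneFT.unmarked x.2)) ?_ (fun _ => trivial)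
        fun h => absurd h hw
      rw [PMF.map_comp]
      refine Eq.trans (congrArg (fun f => PMF.map f μ) (funext fun x => ?_)) (PMF.map_id μ)
      exact Prod.ext rfl (SteaneFT.errors_unmarked x.2)
  · rintro ⟨M, hM, hW⟩
    exact SteaneFT.succeeds_of_stepSim (h4 ν hν) hM hW fun _ _ _ h => h
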